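/- **Definitions.** Let $\mathbb K$ be a field. A *Frobenius pair* $(R,l)$ over $\mathbb K$ is a finite-dimensional unital associative $\mathbb K$-algebra $R$ with a linear form $l$ such that $(x,y)_R=l(xy)$ is symmetric and non-degenerate. An *equipped Cardy–Frobenius algebra* $((A,l_A),(B,l_B),\phi,U,\star)$ over $\mathbb K$ consists of a commutative Frobenius pair $(A,l_A)$, a Frobenius pair $(B,l_B)$, a unital algebra homomorphism $\phi:A\to B$ with central image such that $(\phi^*(b'),\phi^*(b''))_A=\operatorname{Tr}(b\mapsto b'bb'')$ for all $b',b''\in B$ (where $l_A(\phi^*(b)a)=l_B(b\,\phi(a))$), linear involutive anti-automorphisms $\star$ of $A$ and of $B$ with $l_A(x^\star)=l_A(x)$, $l_B(x^\star)=l_B(x)$, $\phi(x^\star)=\phi(x)^\star$, and an element $U\in A$ with $U^2=K_A^\star$ and $\phi(U)=K_B^\star$. Here $K_R^\star=\sum_{i,j}F^{ij}r_ir_j^\star$, where $(r_i)$ is a basis of $R$ and $(F^{ij})$ is the inverse of the matrix $((r_i,r_j)_R)$. It is *semi-simple* if $A$ and $B$ are semi-simple algebras. Direct sums and extensions of scalars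 are formed in the obvious way (with $\star$ extended linearly), and isomorphisms are pairs of algebra isomorphisms respecting all the data. For $\mathbb D=\mathbb R,\mathbb C,\mathbb H$, $d=\dim_{\mathbb R}\mathbb D$, an integer $n\ge 0$ and $\mu\in\mathbb R\setminus\{0\}$, let $H^{\mathbb D}_{n,\mu}$ be the following data over $\mathbb R$: $A=Z(\mathbb D)$, $l_A(a)=\mu^2\operatorname{Re}(a)/d$, $B=\mathrm{Mat}_n(\mathbb D)$, $l_B(x)=\mu\operatorname{Re}\operatorname{Tr}(x)$, $\phi(a)=a\,\mathrm{Id}$, $a^\star=\bar a$ on $A$, $x^\star=\bar x^{t}$ on $B$, $U=(2-d)/\mu$. **Theorem.** Let $G$ be a finite group, $\rho$ a finite-dimensional real representation of $G$ with a $G$-invariant non-degenerate symmetric bilinear form, and $\boldsymbol\mu$ an invertible element of $Z(\mathbb R[G])$ invariant under the antipode $g\mapsto g^{-1}$. Let $H^\rho_{\boldsymbol\mu}$ be the following data over $\mathbb R$: $A=Z(\mathbb R[G])$ with $l_A(x)$ equal to the coefficient of $\boldsymbol\mu^2x/|G|$ at $1\in G$; $B=\operatorname{End}_G(\rho)$ with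 $l_B(x)=\operatorname{Tr}_\rho(\boldsymbol\mu x/|G|)$; $\phi:A\to B$ the action of $A$ on $\rho$; $\star$ the antipode on $A$ and the adjoint with respect to the invariant form on $B$; and $U=\boldsymbol\mu^{-1}\sum_{g\in G}g^2\in A$. Then $H^\rho_{\boldsymbol\mu}$ is a semi-simple equipped Cardy–Frobenius algebra over $\mathbb R$, and $H^\rho_{\boldsymbol\mu}\otimes\mathbb C$ is a semi-simple equipped Cardy–Frobenius algebra over $\mathbb C$. Moreover, let $\mathrm{Ir}(G)$ be the set of isomorphism classes of irreducible real representations of $G$ and, for $\mathbb D=\mathbb R,\mathbb C,\mathbb H$, let $\mathrm{Ir}_{\mathbb D}(G)$ be the set of those $\pi\in\mathrm{Ir}(G)$ with $\operatorname{End}_G(\pi)\cong\mathbb D$. Then $\rho\cong\bigoplus_{\pi\in\mathrm{Ir}(G)}n_\pi\pi$ for some integers $n_\pi\ge 0$, $\boldsymbol\mu$ acts on each $\pi\in\mathrm{Ir}(G)$ by a non-zero real scalar $\boldsymbol\mu(\pi)$, and with these $n_\pi$ and $\boldsymbol\mu(\pi)$ $$H^\rho_{\boldsymbol\mu}\otimes\mathbb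 C\;\cong\;\bigoplus_{\mathbb D=\mathbb R,\mathbb C,\mathbb H}\ \bigoplus_{\pi\in\mathrm{Ir}_{\mathbb D}(G)}H^{\mathbb D}_{n_\pi,\ \boldsymbol\mu(\pi)\frac{\dim\pi}{|G|}}\otimes\mathbb C$$ as equipped Cardy–Frobenius algebras over $\mathbb C$. -/

import Mathlib

open scoped Quaternion TensorProduct

noncomputable section

universe u v w u' v' t

namespace CardyFrobenius

set_option linter.checkUnivs false

/-! ## Equipped Cardy--Frobenius algebras -/

/-- The data `((A, l_A), (B, l_B), φ, U, ⋆)` underlying an equipped Cardy--Frobenius algebra over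
a field `K`; the laws are stated in `EquippedData.IsEquipped` below. -/
structure EquippedData (K : Type u) [Field K] where
  /-- the (commutative) algebra `A` -/
  A : Type v
  [commRingA : CommRing A]
  [algebraA : Algebra K A]
  /-- the algebra `B` -/
  B : Type w
  [ringB : Ring B]
  [algebraB : Algebra K B]
  /-- the linear form `l_A` -/
  lA : A →ₗ[K] K
  /-- the linear form `l_B` -/
  lB : B →ₗ[K] K
  /-- the algebra homomorphism `φ : A → B` -/
  φ : A →ₐ[K] B
  /-- the element `U` of `A` -/
  U : A
  /-- the map `⋆` on `A` -/
  starA : A →ₗ[K] A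
  /-- the map `⋆` on `B` -/
  starB : B →ₗ[K] B

attribute [instance] EquippedData.commRingA EquippedData.algebraA
  EquippedData.ringB EquippedData.algebraB

/-- `(R, l)` is a Frobenius pair: `R` is a finite-dimensional unital associative algebra, and
`(x, y) ↦ l (x y)` is a symmetric non-degenerate bilinear form. -/
structure IsFrobeniusPair {K : Type u} [Field K] {R : Type v} [Ring R] [Algebra K R]
    (l : R →ₗ[K] K) : Prop where
  finite : Module.Finite K R
  symm : ∀ x y : R, l (x * y) = l (y * x)
  nondegenerate : ∀ x : R, (∀ y : R, l (x * y) = 0) → x = 0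

/-- The twisted Casimir element `K^⋆ = ∑ F^{ij} b_i b_j^⋆` computed in a basis `b`, where `F^{ij}` is
the inverse of the Gram matrix `(l (b_i b_j))`. -/
def twistedCasimir {K : Type u} [Field K] {R : Type v} [Ring R] [Algebra K R]
    (l : R →ₗ[K] K) (s : R →ₗ[K] R) {n : ℕ} (b : Module.Basis (Fin n) K R) : R :=
  ∑ i, ∑ j, (Matrix.of fun i j => l (b i * b j) : Matrix (Fin n) (Fin n) K)⁻¹ i j •
    (b i * s (b j))

namespace EquippedData

variable {K : Type u} [Field K]

/-- The laws of a Cardy--Frobenius algebra `((A, l_A), (B, l_B), φ)`. The map `φ^*` occurring in the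
Cardy condition is the one dual to `φ` (it is unique because `l_A` is non-degenerate), and the
Cardy condition reads `(φ^* b', φ^* b'')_A = Tr (b ↦ b' b b'')`. -/
structure IsCardyFrobenius (H : EquippedData.{u, v, w} K) : Prop where
  frobeniusA : IsFrobeniusPair H.lA
  frobeniusB : IsFrobeniusPair H.lB
  central : ∀ (a : H.A) (b : H.B), H.φ a * b = b * H.φ a
  cardy : ∃ φstar : H.B →ₗ[K] H.A,
    (∀ (b : H.B) (a : H.A), H.lA (φstar b * a) = H.lB (b * H.φ a)) ∧
    ∀ b' b'' : H.B, H.lA (φstar b' * φstar b'') =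
      LinearMap.trace K H.B (LinearMap.mulLeftRight K (b', b''))

/-- The laws of an equipped Cardy--Frobenius algebra `((A, l_A), (B, l_B), φ, U, ⋆)`. The elements
`K_A^⋆` and `K_B^⋆` do not depend on a basis; the laws are stated in every basis. -/
structure IsEquipped (H : EquippedData.{u, v, w} K) : Prop extends H.IsCardyFrobenius where
  starA_invol : ∀ a : H.A, H.starA (H.starA a) = a
  starB_invol : ∀ b : H.B, H.starB (H.starB b) = b
  starA_mul : ∀ a a' : H.A, H.starA (a * a') = H.starA a' * H.starA a
  starB_mul : ∀ b b' : H.B, H.starB (b * b') = H.starB b' * H.starB b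
  lA_star : ∀ a : H.A, H.lA (H.starA a) = H.lA a
  lB_star : ∀ b : H.B, H.lB (H.starB b) = H.lB b
  φ_star : ∀ a : H.A, H.φ (H.starA a) = H.starB (H.φ a)
  U_sq : ∀ (n : ℕ) (b : Module.Basis (Fin n) K H.A), H.U ^ 2 = twistedCasimir H.lA H.starA b
  φ_U : ∀ (n : ℕ) (b : Module.Basis (Fin n) K H.B), H.φ H.U = twistedCasimir H.lB H.starB b

/-- Both algebras `A` and `B` are semisimple. -/
def IsSemisimple (H : EquippedData.{u, v, w} K) : Prop :=
  IsSemisimpleRing H.A ∧ IsSemisimpleRing H.B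

/-- An isomorphism of equipped Cardy--Frobenius algebras: algebra isomorphisms on `A` and on `B`
that respect all of the data. -/
structure Iso (H : EquippedData.{u, v, w} K) (H' : EquippedData.{u, v', t} K) where
  eA : H.A ≃ₐ[K] H'.A
  eB : H.B ≃ₐ[K] H'.B
  lA_eq : ∀ a, H'.lA (eA a) = H.lA a
  lB_eq : ∀ b, H'.lB (eB b) = H.lB b
  φ_eq : ∀ a, H'.φ (eA a) = eB (H.φ a)
  U_eq : eA H.U = H'.U
  starA_eq : ∀ a, H'.starA (eA a) = eA (H.starA a)
  starB_eq : ∀ b, H'.starB (eB b) = eB (H.starB b)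

/-- The direct sum of a finite family of equipped Cardy--Frobenius algebras: the algebras are the
products, the linear forms are added up, everything else is componentwise. -/
def directSum {ι : Type t} [Fintype ι] (H : ι → EquippedData.{u, v, w} K) :
    EquippedData.{u, max t v, max t w} K where
  A := ∀ i, (H i).A
  B := ∀ i, (H i).B
  lA := ∑ i, (H i).lA ∘ₗ LinearMap.proj i
  lB := ∑ i, (H i).lB ∘ₗ LinearMap.proj i
  φ := AlgHom.pi fun i => (H i).φ.comp (Pi.evalAlgHom K _ i)
  U := fun i => (H i).U
  starA := LinearMap.pi fun i => (H i).starA ∘ₗ LinearMap.proj i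
  starB := LinearMap.pi fun i => (H i).starB ∘ₗ LinearMap.proj i

/-- Extension of scalars `H ⊗_K L` along a field extension `L / K`; all maps (including `⋆`) are
extended `L`-linearly. -/
def baseChange (L : Type u') [Field L] [Algebra K L] (H : EquippedData.{u, v, w} K) :
    EquippedData.{u', max u' v, max u' w} L where
  A := L ⊗[K] H.A
  B := L ⊗[K] H.B
  lA := (TensorProduct.AlgebraTensorModule.rid K L L).toLinearMap ∘ₗ H.lA.baseChange L
  lB := (TensorProduct.AlgebraTensorModule.rid K L L).toLinearMap ∘ₗ H.lB.baseChange L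
  φ := Algebra.TensorProduct.map (AlgHom.id L L) H.φ
  U := 1 ⊗ₜ[K] H.U
  starA := H.starA.baseChange L
  starB := H.starB.baseChange L

end EquippedData

/-! ## The algebras `H^𝔻_{n,μ}` -/

section Matrix

variable (D : Type v) [DivisionRing D] [Algebra ℝ D] [StarRing D] [StarModule ℝ D]

/-- Conjugation `z ↦ z̄` restricted to the center `Z(𝔻)`. -/
def centerStar : Subalgebra.center ℝ D →ₗ[ℝ] Subalgebra.center ℝ D where
  toFun z := ⟨star (z : D), Set.star_mem_center z.2⟩
  map_add' x y := Subtype.ext (star_add (x : D) (y : D))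
  map_smul' r x := Subtype.ext (by simp)

/-- The inclusion `a ↦ a • Id` of `Z(𝔻)` in `Mat_n(𝔻)`. -/
def centerToMatrix (n : ℕ) : Subalgebra.center ℝ D →ₐ[ℝ] Matrix (Fin n) (Fin n) D :=
  { (Matrix.scalar (Fin n) : D →+* Matrix (Fin n) (Fin n) D).comp
      (Subalgebra.center ℝ D).val.toRingHom with
    commutes' := fun r => by
      ext i j
      simp [Matrix.algebraMap_matrix_apply, Matrix.diagonal_apply] }

/-- The conjugate transpose `x ↦ x̄ᵗ` on `Mat_n(𝔻)`. -/
def matrixStar (n : ℕ) : Matrix (Fin n) (Fin n) D →ₗ[ℝ] Matrix (Fin n) (Fin n) D where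
  toFun := Matrix.conjTranspose
  map_add' := Matrix.conjTranspose_add
  map_smul' r x := by simp [Matrix.conjTranspose_smul]

/-- The data `H^𝔻_{n,μ}` for a real division algebra `𝔻` with conjugation `star` and real part `re`;
here `d = dim_ℝ 𝔻`,
`A = Z(𝔻)`, `l_A(a) = μ² Re(a) / d`, `B = Mat_n(𝔻)`, `l_B(x) = μ Re(Tr x)`, `φ(a) = a • Id`,
`U = (2 - d) / μ`, and `⋆` is conjugation on `A` and conjugate transposition on `B`. -/
def matrixData (re : D →ₗ[ℝ] ℝ) (n : ℕ) (μ : ℝ) : EquippedData.{0, v, v} ℝ where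
  A := Subalgebra.center ℝ D
  B := Matrix (Fin n) (Fin n) D
  lA := (μ ^ 2 / (Module.finrank ℝ D : ℝ)) • (re ∘ₗ (Subalgebra.center ℝ D).val.toLinearMap)
  lB := μ • (re ∘ₗ Matrix.traceLinearMap (Fin n) ℝ D)
  φ := centerToMatrix D n
  U := algebraMap ℝ _ ((2 - (Module.finrank ℝ D : ℝ)) / μ)
  starA := centerStar D
  starB := matrixStar D n

end Matrix

/-- The three finite-dimensional real division algebras `ℝ`, `ℂ`, `ℍ`. -/
inductive DivAlg : Type
  | real
  | complex
  | quaternion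

instance : Finite DivAlg :=
  Finite.of_surjective
    (fun i : Fin 3 => match i with
      | 0 => DivAlg.real
      | 1 => DivAlg.complex
      | 2 => DivAlg.quaternion)
    (fun D => match D with
      | .real => ⟨0, rfl⟩
      | .complex => ⟨1, rfl⟩
      | .quaternion => ⟨2, rfl⟩)

instance : StarModule ℝ ℍ[ℝ] where
  star_smul r x := by simp [Quaternion.star_smul]

/-- The equipped Cardy--Frobenius algebra `H^𝔻_{n,μ}` for `𝔻 = ℝ, ℂ, ℍ`. -/
def stdData : DivAlg → ℕ → ℝ → EquippedData.{0, 0, 0} ℝ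
  | .real, n, μ => matrixData ℝ LinearMap.id n μ
  | .complex, n, μ => matrixData ℂ Complex.reLm n μ
  | .quaternion, n, μ => matrixData ℍ[ℝ] (QuaternionAlgebra.reₗ _ _ _) n μ

/-! ## Real representations of a finite group -/

section Representation

variable {G : Type u} [Group G]

/-- The algebra `End_G(ρ)` of intertwining operators of a real representation. -/
abbrev EndG {V : Type v} [AddCommGroup V] [Module ℝ V] (ρ : Representation ℝ G V) :
    Subalgebra ℝ (Module.End ℝ V) :=
  Subalgebra.centralizer ℝ (Set.range ρ)

/-- The center `Z(ℝ[G])` of the group algebra. -/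
abbrev ZGroupAlgebra (G : Type u) [Group G] : Subalgebra ℝ (MonoidAlgebra ℝ G) :=
  Subalgebra.center ℝ (MonoidAlgebra ℝ G)

theorem antipode_mul (x y : MonoidAlgebra ℝ G) :
    HopfAlgebra.antipode ℝ (x * y) = HopfAlgebra.antipode ℝ y * HopfAlgebra.antipode ℝ x := by
  induction x using MonoidAlgebra.induction_linear with
  | zero => simp
  | add x x' hx hx' => simp [add_mul, mul_add, hx, hx']
  | single g a =>
    induction y using MonoidAlgebra.induction_linear with
    | zero => simp
    | add y y' hy hy' => simp [add_mul, mul_add, hy, hy']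
    | single h b => simp [MonoidAlgebra.single_mul_single, mul_comm]

theorem antipode_antipode (x : MonoidAlgebra ℝ G) :
    HopfAlgebra.antipode ℝ (HopfAlgebra.antipode ℝ x) = x := by
  induction x using MonoidAlgebra.induction_linear with
  | zero => simp
  | add x x' hx hx' => simp [hx, hx']
  | single g a => simp

theorem antipode_mem_center {z : MonoidAlgebra ℝ G} (hz : z ∈ ZGroupAlgebra G) :
    HopfAlgebra.antipode ℝ z ∈ ZGroupAlgebra G := by
  rw [Subalgebra.mem_center_iff] at hz ⊢
  intro y
  rw [← antipode_antipode y, ← antipode_mul, ← antipode_mul, hz]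

/-- The involution of `Z(ℝ[G])` induced by the antipode `g ↦ g⁻¹` of `ℝ[G]`. -/
def antipodeCenter (G : Type u) [Group G] : ZGroupAlgebra G →ₗ[ℝ] ZGroupAlgebra G :=
  LinearMap.restrict (HopfAlgebra.antipode ℝ : MonoidAlgebra ℝ G →ₗ[ℝ] MonoidAlgebra ℝ G)
    (p := Subalgebra.toSubmodule (ZGroupAlgebra G)) (q := Subalgebra.toSubmodule (ZGroupAlgebra G))
    (fun _ hz => antipode_mem_center hz)

/-- The central element `∑_{g ∈ G} g²` of `ℝ[G]`. -/
def sumSquares (G : Type u) [Group G] [Fintype G] : ZGroupAlgebra G :=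
  ⟨∑ g : G, MonoidAlgebra.of ℝ G (g ^ 2), by
    rw [Subalgebra.mem_center_iff]
    intro y
    induction y using MonoidAlgebra.induction_linear with
    | zero => simp
    | add x x' hx hx' => simp only [add_mul, mul_add, hx, hx']
    | single h b =>
      simp only [MonoidAlgebra.of_apply, Finset.mul_sum, Finset.sum_mul,
        MonoidAlgebra.single_mul_single, mul_one, one_mul]
      refine Fintype.sum_equiv (MulAut.conj h).toEquiv _ _ fun g => ?_
      simp [pow_two, mul_assoc]⟩

variable {V : Type v} [AddCommGroup V] [Module ℝ V]

/-- A `G`-invariant non-degenerate symmetric bilinear form on a real representation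
(not necessarily definite). -/
structure InvariantForm (ρ : Representation ℝ G V) where
  form : LinearMap.BilinForm ℝ V
  symm : form.IsSymm
  nondegenerate : form.Nondegenerate
  invariant : ∀ (g : G) (x y : V), form (ρ g x) (ρ g y) = form x y

theorem asAlgebraHom_mem (ρ : Representation ℝ G V) (z : ZGroupAlgebra G) :
    ρ.asAlgebraHom (z : MonoidAlgebra ℝ G) ∈ EndG ρ := by
  rw [Subalgebra.mem_centralizer_iff]
  rintro _ ⟨g, rfl⟩
  rw [← ρ.asAlgebraHom_of g, ← map_mul, ← map_mul, Subalgebra.mem_center_iff.1 z.2]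

variable [FiniteDimensional ℝ V] {ρ : Representation ℝ G V}

/-- The operator `x^τ` adjoint to `x` with respect to the form, as a linear function of `x`. -/
def InvariantForm.adjoint (β : InvariantForm ρ) : Module.End ℝ V →ₗ[ℝ] Module.End ℝ V :=
  (β.form.toDual β.nondegenerate).symm.conj.toLinearMap ∘ₗ Module.Dual.transpose

theorem InvariantForm.form_adjoint (β : InvariantForm ρ) (x : Module.End ℝ V) (v w : V) :
    β.form (β.adjoint x v) w = β.form v (x w) := by
  simp only [InvariantForm.adjoint, LinearMap.comp_apply, LinearEquiv.coe_coe,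
    LinearEquiv.conj_apply, LinearMap.BilinForm.apply_toDual_symm_apply, LinearEquiv.symm_symm,
    Module.Dual.transpose_apply, LinearMap.BilinForm.toDual_def]

theorem InvariantForm.adjoint_mem (β : InvariantForm ρ) {x : Module.End ℝ V} (hx : x ∈ EndG ρ) :
    β.adjoint x ∈ EndG ρ := by
  rw [Subalgebra.mem_centralizer_iff] at hx ⊢
  rintro _ ⟨g, rfl⟩
  have inv' : ∀ (g : G) (a b : V), β.form (ρ g a) b = β.form a (ρ g⁻¹ b) := by
    intro g a b
    rw [← β.invariant g⁻¹ (ρ g a) b]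
    simp
  ext v
  refine sub_eq_zero.1 (β.nondegenerate.1 _ fun w => ?_)
  have hc := LinearMap.congr_fun (hx (ρ g⁻¹) ⟨g⁻¹, rfl⟩) w
  simp only [Module.End.mul_apply] at hc
  simp only [map_sub, LinearMap.sub_apply, Module.End.mul_apply, β.form_adjoint, inv', hc, sub_self]

/-- The map `⋆` on `End_G(ρ)`: passage to the adjoint operator. -/
def InvariantForm.adjointG (β : InvariantForm ρ) : EndG ρ →ₗ[ℝ] EndG ρ :=
  LinearMap.restrict β.adjoint
    (p := Subalgebra.toSubmodule (EndG ρ)) (q := Subalgebra.toSubmodule (EndG ρ))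
    (fun _ hx => β.adjoint_mem hx)

/-- The data `H^ρ_μ` of a real representation `ρ` of a finite group `G` with an invariant form and
an invertible element `μ` of `Z(ℝ[G])`:
`A = Z(ℝ[G])`, `l_A(x) = (μ² x)(1) / |G|`, `B = End_G(ρ)`, `l_B(x) = Tr_ρ(μ x) / |G|`,
`φ(a)` is the action of `a` on `ρ`, `U = μ⁻¹ ∑ g²`, and `⋆` is the antipode on `A` and the adjoint
on `B`. -/
def repData [Fintype G] (ρ : Representation ℝ G V) (β : InvariantForm ρ)
    (μ : (ZGroupAlgebra G)ˣ) : EquippedData.{0, u, v} ℝ where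
  A := ZGroupAlgebra G
  B := EndG ρ
  lA :=
    { toFun := fun x =>
        (((μ : ZGroupAlgebra G) ^ 2 * x : ZGroupAlgebra G) : MonoidAlgebra ℝ G).coeff 1 /
          (Fintype.card G : ℝ)
      map_add' := fun x y => by simp [mul_add, add_div]
      map_smul' := fun r x => by simp [mul_div_assoc] }
  lB := (Fintype.card G : ℝ)⁻¹ • (LinearMap.trace ℝ V ∘ₗ
    LinearMap.mulLeft ℝ (ρ.asAlgebraHom ((μ : ZGroupAlgebra G) : MonoidAlgebra ℝ G)) ∘ₗ
    (EndG ρ).val.toLinearMap)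
  φ := (ρ.asAlgebraHom.comp (ZGroupAlgebra G).val).codRestrict (EndG ρ) (asAlgebraHom_mem ρ)
  U := ((μ⁻¹ : (ZGroupAlgebra G)ˣ) : ZGroupAlgebra G) * sumSquares G
  starA := antipodeCenter G
  starB := β.adjointG

end Representation

/-! ## Irreducible real representations -/

section Irreducible

variable (G : Type u) [Group G]

/-- An irreducible real representation of `G` on a space `ℝ^m`. Every finite-dimensional real
representation is isomorphic to one on some `ℝ^m`. -/
structure IrrRep where
  dim : ℕ
  rep : Representation ℝ G (Fin dim → ℝ)
  irr : rep.IsIrreducible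

instance : Setoid (IrrRep G) where
  r π σ := Nonempty (π.rep.Equiv σ.rep)
  iseqv :=
    ⟨fun π => ⟨.refl π.rep⟩, fun ⟨e⟩ => ⟨e.symm⟩, fun ⟨e⟩ ⟨f⟩ => ⟨e.trans f⟩⟩

/-- `Ir(G)`: the isomorphism classes of irreducible real representations of `G`. -/
def Irr : Type u := Quotient (inferInstance : Setoid (IrrRep G))

variable {G}

/-- A representative of the class `π`. -/
def Irr.out (π : Irr G) : IrrRep G := Quotient.out π

/-- `dim π`. -/
def Irr.dim (π : Irr G) : ℕ := π.out.dim

/-- The representation of `G` on `ℝ^(dim π)` given by a representative of the class `π`. -/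
def Irr.rep (π : Irr G) : Representation ℝ G (Fin π.dim → ℝ) := π.out.rep

variable (G) in
/-- A finite group has only finitely many irreducible real representations up to isomorphism. -/
theorem finite_irr [Finite G] : Finite (Irr G) := by
  have key (π : Irr G) : ∃ I : Submodule (MonoidAlgebra ℝ G) (MonoidAlgebra ℝ G),
      IsSimpleModule (MonoidAlgebra ℝ G) I ∧
        Nonempty (π.rep.asModule ≃ₗ[MonoidAlgebra ℝ G] I) := by
    have : π.rep.IsIrreducible := π.out.irr
    have : NeZero (Nat.card G : ℝ) := ⟨by exact_mod_cast Nat.card_pos.ne'⟩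
    have : IsSimpleModule (MonoidAlgebra ℝ G) π.rep.asModule := inferInstance
    obtain ⟨I, ⟨e⟩⟩ := IsSemisimpleRing.exists_linearEquiv_ideal_of_isSimpleModule
      (MonoidAlgebra ℝ G) π.rep.asModule
    exact ⟨I, .congr e.symm, ⟨e⟩⟩
  choose I hI e using key
  have : IsNoetherian (MonoidAlgebra ℝ G) (MonoidAlgebra ℝ G) :=
    isNoetherian_of_tower ℝ inferInstance
  let f (π : Irr G) : isotypicComponents (MonoidAlgebra ℝ G) (MonoidAlgebra ℝ G) :=
    ⟨isotypicComponent _ _ (I π), I π, hI π, rfl⟩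
  refine Finite.of_injective f fun π σ h => ?_
  have h' : isotypicComponent (MonoidAlgebra ℝ G) (MonoidAlgebra ℝ G) (I π) =
      isotypicComponent (MonoidAlgebra ℝ G) (MonoidAlgebra ℝ G) (I σ) := congrArg Subtype.val h
  have := hI π
  have := hI σ
  obtain ⟨k⟩ := isIsotypicOfType_submodule_iff.mp
    (IsIsotypicOfType.isotypicComponent (MonoidAlgebra ℝ G) (MonoidAlgebra ℝ G) (I σ)) (I π)
    ((Submodule.le_isotypicComponent (I π)).trans h'.le)
  obtain ⟨eπ⟩ := e π
  obtain ⟨eσ⟩ := e σ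
  let E : π.rep.asModule ≃ₗ[MonoidAlgebra ℝ G] σ.rep.asModule := (eπ.trans k).trans eσ.symm
  let F := (Representation.IntertwiningMap.equivLinearMapAsModule π.rep σ.rep).symm E.toLinearMap
  have hF : Function.Bijective F := E.bijective
  have : π.out ≈ σ.out := ⟨F.ofBijective hF⟩
  rw [← Quotient.out_eq π, ← Quotient.out_eq σ]
  exact Quotient.sound this

instance [Finite G] : Finite (Irr G) := finite_irr G

/-- The type of an irreducible representation: `π` is of type `𝔻` if `End_G(π) ≅ 𝔻`. -/
def Irr.HasType (π : Irr G) : DivAlg → Prop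
  | .real => Nonempty (EndG π.rep ≃ₐ[ℝ] ℝ)
  | .complex => Nonempty (EndG π.rep ≃ₐ[ℝ] ℂ)
  | .quaternion => Nonempty (EndG π.rep ≃ₐ[ℝ] ℍ[ℝ])

variable (G) in
/-- The index set of the sum over `𝔻 = ℝ, ℂ, ℍ` and over `π ∈ Ir_𝔻(G)`. -/
abbrev TypedIrr : Type u := Σ D : DivAlg, {π : Irr G // π.HasType D}

instance [Finite G] : Fintype (TypedIrr G) := Fintype.ofFinite _

/-- The representation `⊕_π n_π π`. -/
def sumRep (n : Irr G → ℕ) :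
    Representation ℝ G (DirectSum (Σ π : Irr G, Fin (n π)) fun p => Fin p.1.dim → ℝ) :=
  Representation.directSum fun p : Σ π : Irr G, Fin (n π) => p.1.rep

end Irreducible

end CardyFrobenius

universe w' x y

namespace CardyFrobenius

set_option linter.unusedSectionVars false

/-! ### Casimir tensors of nondegenerate forms -/

section CasimirPair

variable {K : Type u} [Field K] {R : Type v} [Ring R] [Algebra K R]

/-- Two finite families `c`, `d` with `z = ∑ l (z c_k) d_k` for all `z`: the tensor `∑ c_k ⊗ d_k` is
the inverse of the form `(x, y) ↦ l (x y)`. -/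
structure CasimirPair (l : R →ₗ[K] K) where
  ι : Type x
  [fintype : Fintype ι]
  c : ι → R
  d : ι → R
  expand : ∀ z, ∑ k, l (z * c k) • d k = z

attribute [instance] CasimirPair.fintype

namespace CasimirPair

variable {l : R →ₗ[K] K}

theorem finite (P : CasimirPair.{u, v, x} l) : Module.Finite K R := by
  refine Module.Finite.of_surjective (Fintype.linearCombination K P.d) fun z => ?_
  exact ⟨fun k => l (z * P.c k), by simpa [Fintype.linearCombination_apply] using P.expand z⟩

theorem eq_zero (P : CasimirPair.{u, v, x} l) {z : R} (h : ∀ y, l (z * y) = 0) : z = 0 := by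
  rw [← P.expand z]
  simp [h]

theorem isFrobeniusPair (P : CasimirPair.{u, v, x} l) (h : ∀ x y, l (x * y) = l (y * x)) :
    IsFrobeniusPair l :=
  ⟨P.finite, h, fun _ hz => P.eq_zero hz⟩

/-- The inverse Gram matrix and the pair describe the same tensor, `∑ F^{ij} b_i ⊗ b_j = ∑ c_k ⊗
d_k`: the numbers `l (b_j c_k)` expand `b_j` along the `d_k`, and the inverse Gram matrix turns them
into the coordinates of `c_k`. -/
theorem twistedCasimir_eq (P : CasimirPair.{u, v, x} l) (s : R →ₗ[K] R) {n : ℕ}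
    (b : Module.Basis (Fin n) K R) : twistedCasimir l s b = ∑ k, P.c k * s (P.d k) := by
  set M : Matrix (Fin n) (Fin n) K := Matrix.of fun i j => l (b i * b j) with hM
  have hdet : IsUnit M.det := by
    rw [isUnit_iff_ne_zero]
    intro h0
    obtain ⟨v, hv, hvM⟩ := Matrix.exists_vecMul_eq_zero_iff.2 h0
    refine hv ?_
    have hx : ∑ i, v i • b i = 0 := by
      refine P.eq_zero fun y => ?_
      have hb : l ∘ₗ LinearMap.mulLeft K (∑ i, v i • b i) = 0 := by
        refine b.ext fun j => ?_
        have := congrFun hvM j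
        simpa [Matrix.vecMul, dotProduct, hM, Finset.sum_mul] using this
      exact LinearMap.congr_fun hb y
    funext i
    exact Fintype.linearIndependent_iff.1 b.linearIndependent v hx i
  have hc (k : P.ι) : P.c k = ∑ i, ∑ j, (M⁻¹ i j * l (b j * P.c k)) • b i := by
    have h1 (j : Fin n) : l (b j * P.c k) = ∑ i, M j i * b.repr (P.c k) i := by
      conv_lhs => rw [← b.sum_repr (P.c k)]
      simp only [Finset.mul_sum, map_sum, mul_smul_comm, map_smul, smul_eq_mul]
      exact Finset.sum_congr rfl fun i _ => mul_comm _ _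
    have h2 (i : Fin n) : ∑ j, M⁻¹ i j * l (b j * P.c k) = b.repr (P.c k) i := by
      have h3 : M.mulVec (fun i => b.repr (P.c k) i) = fun j => l (b j * P.c k) := by
        funext j
        rw [h1]
        rfl
      have h4 := congrArg (fun v => M⁻¹.mulVec v i) h3
      simp only [Matrix.mulVec_mulVec, Matrix.nonsing_inv_mul _ hdet, Matrix.one_mulVec] at h4
      exact h4.symm
    conv_lhs => rw [← b.sum_repr (P.c k)]
    refine Finset.sum_congr rfl fun i _ => ?_
    rw [← Finset.sum_smul, h2]
  have hd (j : Fin n) : b j = ∑ k, l (b j * P.c k) • P.d k := (P.expand _).symm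
  calc twistedCasimir l s b = ∑ i, ∑ j, M⁻¹ i j • (b i * s (b j)) := rfl
    _ = ∑ i, ∑ j, ∑ k, (M⁻¹ i j * l (b j * P.c k)) • (b i * s (P.d k)) := by
        refine Finset.sum_congr rfl fun i _ => Finset.sum_congr rfl fun j _ => ?_
        conv_lhs => rw [hd j]
        simp only [map_sum, map_smul, Finset.mul_sum, Finset.smul_sum, mul_smul_comm, smul_smul]
    _ = ∑ k, ∑ i, ∑ j, (M⁻¹ i j * l (b j * P.c k)) • (b i * s (P.d k)) := by
        rw [Finset.sum_comm (s := (Finset.univ : Finset P.ι))]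
        exact Finset.sum_congr rfl fun i _ => Finset.sum_comm
    _ = _ := by
        refine Finset.sum_congr rfl fun k _ => ?_
        conv_rhs => rw [hc k]
        simp only [Finset.sum_mul, smul_mul_assoc]

/-- Expanding `f z` writes `f` as a sum of the rank-one maps `z ↦ l (f z * c_k) d_k`, whose traces
are immediate. -/
theorem trace_eq (P : CasimirPair.{u, v, x} l) (f : R →ₗ[K] R) :
    LinearMap.trace K R f = ∑ k, l (f (P.d k) * P.c k) := by
  have := P.finite
  have hf : f = ∑ k, (l ∘ₗ LinearMap.mulRight K (P.c k) ∘ₗ f).smulRight (P.d k) := by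
    ext z
    simpa using (P.expand (f z)).symm
  conv_lhs => rw [hf]
  simp

theorem expand' (P : CasimirPair.{u, v, x} l) (hl : ∀ x y, l (x * y) = l (y * x)) (w : R) :
    ∑ k, l (w * P.d k) • P.c k = w := by
  rw [← sub_eq_zero]
  refine P.eq_zero fun y => ?_
  have : l (w * y) = ∑ k, l (y * P.c k) * l (w * P.d k) := by
    conv_lhs => rw [← P.expand y]
    simp [Finset.mul_sum]
  rw [sub_mul, map_sub, this, Finset.sum_mul, map_sum, sub_eq_zero]
  refine Finset.sum_congr rfl fun k _ => ?_
  rw [smul_mul_assoc, map_smul, hl (P.c k), smul_eq_mul, mul_comm]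

/-- The Casimir tensor is balanced: `∑ c_k y ⊗ d_k = ∑ c_k ⊗ y d_k`. -/
theorem balanced (P : CasimirPair.{u, v, x} l) (hl : ∀ x y, l (x * y) = l (y * x))
    {M : Type*} [AddCommGroup M] [Module K M] (F : R →ₗ[K] R →ₗ[K] M) (y : R) :
    ∑ k, F (P.c k * y) (P.d k) = ∑ k, F (P.c k) (y * P.d k) := by
  -- Both sides equal `∑ l (c_j y d_k) F (c_k, d_j)`: on the right `y d_k` is expanded along the
  -- `d_j`, on the left `c_j y` along the `c_k`.
  have h1 (k : P.ι) : F (P.c k) (y * P.d k) =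
      ∑ j, l (P.c j * y * P.d k) • F (P.c k) (P.d j) := by
    conv_lhs => rw [← P.expand (y * P.d k)]
    simp only [map_sum, map_smul]
    refine Finset.sum_congr rfl fun j _ => ?_
    rw [hl, ← mul_assoc]
  have h2 (j : P.ι) : F (P.c j * y) (P.d j) =
      ∑ k, l (P.c j * y * P.d k) • F (P.c k) (P.d j) := by
    conv_lhs => rw [← P.expand' hl (P.c j * y)]
    simp
  simp_rw [h1, h2]
  exact Finset.sum_comm

/-- `∑ d_k t c_k` is central. -/
theorem sum_mul_mul_comm (P : CasimirPair.{u, v, x} l) (hl : ∀ x y, l (x * y) = l (y * x))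
    (r t : R) : r * ∑ k, P.d k * t * P.c k = (∑ k, P.d k * t * P.c k) * r := by
  -- Balancedness is applied to the bilinear map `(c, d) ↦ d t c`.
  have := P.balanced hl ((LinearMap.mul K R).compl₁₂ (LinearMap.mulRight K t) LinearMap.id).flip r
  simp only [LinearMap.flip_apply, LinearMap.compl₁₂_apply, LinearMap.mulRight_apply,
    LinearMap.id_apply, LinearMap.mul_apply'] at this
  simp only [Finset.mul_sum, Finset.sum_mul]
  simpa only [mul_assoc] using this.symm

/-- Extension of scalars of a Casimir pair. -/
def baseChange (L : Type u') [Field L] [Algebra K L] (P : CasimirPair.{u, v, x} l) :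
    CasimirPair.{u', max u' v, x}
      ((TensorProduct.AlgebraTensorModule.rid K L L).toLinearMap ∘ₗ l.baseChange L) where
  ι := P.ι
  c k := 1 ⊗ₜ P.c k
  d k := 1 ⊗ₜ P.d k
  expand z := by
    induction z with
    | zero => simp
    | add x y hx hy =>
      conv_rhs => rw [← hx, ← hy]
      simp [add_mul, add_smul, Finset.sum_add_distrib]
    | tmul a r =>
      conv_rhs => rw [← P.expand r]
      simp only [TensorProduct.tmul_sum]
      refine Finset.sum_congr rfl fun k _ => ?_
      simp [TensorProduct.smul_tmul', TensorProduct.tmul_smul]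

/-- Transport of a Casimir pair along an isomorphism. -/
def map {R' : Type v'} [Ring R'] [Algebra K R'] {l' : R' →ₗ[K] K} (P : CasimirPair.{u, v, x} l)
    (e : R ≃ₐ[K] R') (h : ∀ z, l' (e z) = l z) : CasimirPair.{u, v', x} l' where
  ι := P.ι
  c k := e (P.c k)
  d k := e (P.d k)
  expand z := by
    obtain ⟨z, rfl⟩ := e.surjective z
    conv_rhs => rw [← P.expand z]
    simp [← map_mul, h]

/-- Direct sum of Casimir pairs. -/
def pi {ι : Type t} [Fintype ι] [DecidableEq ι] {R : ι → Type v} [∀ i, Ring (R i)]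
    [∀ i, Algebra K (R i)]
    {l : ∀ i, R i →ₗ[K] K} (P : ∀ i, CasimirPair.{u, v, x} (l i)) :
    CasimirPair.{u, max t v, max t x} (∑ i, l i ∘ₗ LinearMap.proj i) where
  ι := Σ i, (P i).ι
  c k := Pi.single k.1 ((P k.1).c k.2)
  d k := Pi.single k.1 ((P k.1).d k.2)
  expand z := by
    have h (i : ι) (k : (P i).ι) : (∑ j, l j ∘ₗ LinearMap.proj j : (∀ i, R i) →ₗ[K] K)
        (z * Pi.single i ((P i).c k)) = l i (z i * (P i).c k) := by
      rw [LinearMap.sum_apply, Finset.sum_eq_single i]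
      · simp
      · intro j _ hj
        simp [Pi.single_eq_of_ne hj]
      · simp
    rw [Fintype.sum_sigma]
    simp only [h]
    funext j
    rw [Finset.sum_apply, Finset.sum_eq_single j]
    · simpa using (P j).expand (z j)
    · intro i _ hi
      simp [Pi.single_eq_of_ne hi.symm]
    · simp

theorem sum_pi {ι : Type t} [Fintype ι] [DecidableEq ι] {R : ι → Type v} [∀ i, Ring (R i)]
    [∀ i, Algebra K (R i)] {l : ∀ i, R i →ₗ[K] K} (P : ∀ i, CasimirPair.{u, v, x} (l i))
    {M : Type*} [AddCommMonoid M] (F : (∀ i, R i) → (∀ i, R i) → M) :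
    ∑ k, F ((CasimirPair.pi P).c k) ((CasimirPair.pi P).d k) =
      ∑ i, ∑ k, F (Pi.single i ((P i).c k)) (Pi.single i ((P i).d k)) :=
  Fintype.sum_sigma fun k : Σ i, (P i).ι =>
    F (Pi.single k.1 ((P k.1).c k.2)) (Pi.single k.1 ((P k.1).d k.2))

end CasimirPair

end CasimirPair

/-! ### The laws in terms of Casimir pairs, and their transport -/

namespace EquippedData

variable {K : Type u} [Field K]

/-- The laws of an equipped Cardy--Frobenius algebra expressed through Casimir pairs; the Cardy
condition becomes `φ (φ^* b) = ∑ d_k b c_k`. -/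
structure CasimirLaws {A : Type v} {B : Type w} [CommRing A] [Algebra K A] [Ring B] [Algebra K B]
    (lA : A →ₗ[K] K) (lB : B →ₗ[K] K) (φ : A →ₐ[K] B) (U : A) (sA : A →ₗ[K] A) (sB : B →ₗ[K] B) where
  cA : CasimirPair.{u, v, x} lA
  cB : CasimirPair.{u, w, x} lB
  lB_comm : ∀ b b' : B, lB (b * b') = lB (b' * b)
  central : ∀ (a : A) (b : B), φ a * b = b * φ a
  φstar : B →ₗ[K] A
  lA_φstar : ∀ (b : B) (a : A), lA (φstar b * a) = lB (b * φ a)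
  φ_φstar : ∀ b : B, φ (φstar b) = ∑ k, cB.d k * b * cB.c k
  starA_invol : ∀ a : A, sA (sA a) = a
  starB_invol : ∀ b : B, sB (sB b) = b
  starA_mul : ∀ a a' : A, sA (a * a') = sA a' * sA a
  starB_mul : ∀ b b' : B, sB (b * b') = sB b' * sB b
  lA_star : ∀ a : A, lA (sA a) = lA a
  lB_star : ∀ b : B, lB (sB b) = lB b
  φ_star : ∀ a : A, φ (sA a) = sB (φ a)
  U_sq : U ^ 2 = ∑ k, cA.c k * sA (cA.d k)
  φ_U : φ U = ∑ k, cB.c k * sB (cB.d k)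

/-- `CasimirLaws` for bundled data. -/
abbrev Certificate (H : EquippedData.{u, v, w} K) :=
  CasimirLaws.{u, v, w, x} H.lA H.lB H.φ H.U H.starA H.starB

/-- For the Cardy condition, `l_A (φ^* b' φ^* b'') = l_B (b' φ (φ^* b'')) = ∑ l_B (b' d_k b'' c_k)`,
and `CasimirPair.trace_eq` recognises the last sum as the trace of `b ↦ b' b b''`. -/
theorem Certificate.isEquipped {H : EquippedData.{u, v, w} K} (C : Certificate.{u, v, w, x} H) :
    H.IsEquipped where
  frobeniusA := C.cA.isFrobeniusPair fun a a' => by rw [mul_comm]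
  frobeniusB := C.cB.isFrobeniusPair C.lB_comm
  central := C.central
  cardy := by
    refine ⟨C.φstar, C.lA_φstar, fun b' b'' => ?_⟩
    rw [C.lA_φstar, C.φ_φstar, C.cB.trace_eq, Finset.mul_sum, map_sum]
    exact Finset.sum_congr rfl fun k _ => by simp [LinearMap.mulLeftRight_apply, mul_assoc]
  starA_invol := C.starA_invol
  starB_invol := C.starB_invol
  starA_mul := C.starA_mul
  starB_mul := C.starB_mul
  lA_star := C.lA_star
  lB_star := C.lB_star
  φ_star := C.φ_star
  U_sq n b := by rw [C.cA.twistedCasimir_eq, C.U_sq]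
  φ_U n b := by rw [C.cB.twistedCasimir_eq, C.φ_U]

/-! ### Isomorphisms -/

namespace Iso

/-- Composition of isomorphisms. -/
def trans {H : EquippedData.{u, v, w} K} {H' : EquippedData.{u, v', w'} K}
    {H'' : EquippedData.{u, x, y} K} (e : Iso H H') (e' : Iso H' H'') : Iso H H'' where
  eA := e.eA.trans e'.eA
  eB := e.eB.trans e'.eB
  lA_eq a := by simp [e.lA_eq, e'.lA_eq]
  lB_eq a := by simp [e.lB_eq, e'.lB_eq]
  φ_eq a := by simp [e.φ_eq, e'.φ_eq]
  U_eq := by simp [e.U_eq, e'.U_eq]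
  starA_eq a := by simp [e.starA_eq, e'.starA_eq]
  starB_eq a := by simp [e.starB_eq, e'.starB_eq]

/-- The inverse isomorphism. -/
def symm {H : EquippedData.{u, v, w} K} {H' : EquippedData.{u, v', w'} K} (e : Iso H H') :
    Iso H' H where
  eA := e.eA.symm
  eB := e.eB.symm
  lA_eq a := by simp [← e.lA_eq]
  lB_eq a := by simp [← e.lB_eq]
  φ_eq a := e.eB.injective (by simp [← e.φ_eq])
  U_eq := e.eA.injective (by simp [← e.U_eq])
  starA_eq a := e.eA.injective (by simp [← e.starA_eq])
  starB_eq a := e.eB.injective (by simp [← e.starB_eq])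

section

variable (L : Type u') [Field L] [Algebra K L] {R : Type v} {R' : Type v'} {S : Type w}
  {S' : Type w'} [Ring R] [Ring R'] [Ring S] [Ring S'] [Algebra K R] [Algebra K R'] [Algebra K S]
  [Algebra K S']

theorem rid_baseChange_congr {l : R →ₗ[K] K} {l' : R' →ₗ[K] K} (e : R ≃ₐ[K] R')
    (h : ∀ a, l' (e a) = l a) (a : L ⊗[K] R) :
    ((TensorProduct.AlgebraTensorModule.rid K L L).toLinearMap ∘ₗ l'.baseChange L)
      (Algebra.TensorProduct.congr (AlgEquiv.refl : L ≃ₐ[L] L) e a) =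
    ((TensorProduct.AlgebraTensorModule.rid K L L).toLinearMap ∘ₗ l.baseChange L) a := by
  induction a using TensorProduct.induction_on with
  | zero => simp
  | add x y hx hy => simp only [map_add, hx, hy]
  | tmul c a => simp [h]

theorem baseChange_congr {f : R →ₗ[K] R} {f' : R' →ₗ[K] R'} (e : R ≃ₐ[K] R')
    (h : ∀ a, f' (e a) = e (f a)) (a : L ⊗[K] R) :
    f'.baseChange L (Algebra.TensorProduct.congr (AlgEquiv.refl : L ≃ₐ[L] L) e a) =
      Algebra.TensorProduct.congr (AlgEquiv.refl : L ≃ₐ[L] L) e (f.baseChange L a) := by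
  induction a using TensorProduct.induction_on with
  | zero => simp
  | add x y hx hy => simp only [map_add, hx, hy]
  | tmul c a => simp [h]

theorem map_congr {f : R →ₐ[K] S} {f' : R' →ₐ[K] S'} (e : R ≃ₐ[K] R') (e' : S ≃ₐ[K] S')
    (h : ∀ a, f' (e a) = e' (f a)) (a : L ⊗[K] R) :
    Algebra.TensorProduct.map (AlgHom.id L L) f'
      (Algebra.TensorProduct.congr (AlgEquiv.refl : L ≃ₐ[L] L) e a) =
    Algebra.TensorProduct.congr (AlgEquiv.refl : L ≃ₐ[L] L) e'
      (Algebra.TensorProduct.map (AlgHom.id L L) f a) := by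
  induction a using TensorProduct.induction_on with
  | zero => simp
  | add x y hx hy => simp only [map_add, hx, hy]
  | tmul c a => simp [h]

end

/-- Extension of scalars of an isomorphism. -/
def baseChange (L : Type u') [Field L] [Algebra K L] {H : EquippedData.{u, v, w} K}
    {H' : EquippedData.{u, v', w'} K} (e : Iso H H') : Iso (H.baseChange L) (H'.baseChange L) where
  eA := Algebra.TensorProduct.congr AlgEquiv.refl e.eA
  eB := Algebra.TensorProduct.congr AlgEquiv.refl e.eB
  lA_eq := rid_baseChange_congr L e.eA e.lA_eq
  lB_eq := rid_baseChange_congr L e.eB e.lB_eq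
  φ_eq := map_congr L e.eA e.eB e.φ_eq
  U_eq := (Algebra.TensorProduct.congr_apply _ _ _).trans
    ((Algebra.TensorProduct.map_tmul _ _ _ _).trans (congrArg _ e.U_eq))
  starA_eq := baseChange_congr L e.eA e.starA_eq
  starB_eq := baseChange_congr L e.eB e.starB_eq

theorem isSemisimple {H : EquippedData.{u, v, w} K} {H' : EquippedData.{u, v', w'} K}
    (e : Iso H H') (h : H.IsSemisimple) : H'.IsSemisimple := by
  obtain ⟨_, _⟩ := h
  exact ⟨e.eA.toRingEquiv.isSemisimpleRing, e.eB.toRingEquiv.isSemisimpleRing⟩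

end Iso

/-- Transport of a certificate along an isomorphism. -/
def Certificate.map {H : EquippedData.{u, v, w} K} {H' : EquippedData.{u, v', w'} K}
    (C : Certificate.{u, v, w, x} H) (e : Iso H H') : Certificate.{u, v', w', x} H' where
  cA := C.cA.map e.eA e.lA_eq
  cB := C.cB.map e.eB e.lB_eq
  lB_comm b b' := by
    obtain ⟨b, rfl⟩ := e.eB.surjective b
    obtain ⟨b', rfl⟩ := e.eB.surjective b'
    simp only [← map_mul, e.lB_eq, C.lB_comm b b']
  central a b := by
    obtain ⟨a, rfl⟩ := e.eA.surjective a
    obtain ⟨b, rfl⟩ := e.eB.surjective b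
    simp only [e.φ_eq, ← map_mul, C.central]
  φstar := e.eA.toLinearMap ∘ₗ C.φstar ∘ₗ e.eB.symm.toLinearMap
  lA_φstar b a := by
    obtain ⟨a, rfl⟩ := e.eA.surjective a
    obtain ⟨b, rfl⟩ := e.eB.surjective b
    simp [← map_mul, e.lA_eq, C.lA_φstar, e.φ_eq, e.lB_eq]
  φ_φstar b := by
    obtain ⟨b, rfl⟩ := e.eB.surjective b
    simp only [LinearMap.comp_apply, AlgEquiv.toLinearMap_apply, AlgEquiv.symm_apply_apply,
      e.φ_eq, C.φ_φstar, map_sum, map_mul]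
    rfl
  starA_invol a := by
    obtain ⟨a, rfl⟩ := e.eA.surjective a
    simp only [e.starA_eq, C.starA_invol]
  starB_invol b := by
    obtain ⟨b, rfl⟩ := e.eB.surjective b
    simp only [e.starB_eq, C.starB_invol]
  starA_mul a a' := by
    obtain ⟨a, rfl⟩ := e.eA.surjective a
    obtain ⟨a', rfl⟩ := e.eA.surjective a'
    simp only [e.starA_eq, ← map_mul, C.starA_mul]
  starB_mul b b' := by
    obtain ⟨b, rfl⟩ := e.eB.surjective b
    obtain ⟨b', rfl⟩ := e.eB.surjective b'
    simp only [e.starB_eq, ← map_mul, C.starB_mul]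
  lA_star a := by
    obtain ⟨a, rfl⟩ := e.eA.surjective a
    simp only [e.starA_eq, e.lA_eq, C.lA_star]
  lB_star b := by
    obtain ⟨b, rfl⟩ := e.eB.surjective b
    simp only [e.starB_eq, e.lB_eq, C.lB_star]
  φ_star a := by
    obtain ⟨a, rfl⟩ := e.eA.surjective a
    simp only [e.starA_eq, e.φ_eq, C.φ_star, e.starB_eq]
  U_sq := by
    simp only [← e.U_eq, ← map_pow, C.U_sq, map_sum, map_mul, ← e.starA_eq]
    rfl
  φ_U := by
    simp only [← e.U_eq, e.φ_eq, C.φ_U, map_sum, map_mul, ← e.starB_eq]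
    rfl

/-! ### Field extensions and direct sums of the laws -/

namespace CasimirLaws

/-- Extension of scalars of a certificate. -/
def baseChange (L : Type u') [Field L] [Algebra K L] {A : Type v} {B : Type w} [CommRing A]
    [Algebra K A] [Ring B] [Algebra K B] {lA : A →ₗ[K] K} {lB : B →ₗ[K] K} {φ : A →ₐ[K] B} {U : A}
    {sA : A →ₗ[K] A} {sB : B →ₗ[K] B} (C : CasimirLaws.{u, v, w, x} lA lB φ U sA sB) :
    CasimirLaws.{u', max u' v, max u' w, x}
      ((TensorProduct.AlgebraTensorModule.rid K L L).toLinearMap ∘ₗ lA.baseChange L)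
      ((TensorProduct.AlgebraTensorModule.rid K L L).toLinearMap ∘ₗ lB.baseChange L)
      (Algebra.TensorProduct.map (AlgHom.id L L) φ) ((1 : L) ⊗ₜ[K] U)
      (sA.baseChange L) (sB.baseChange L) where
  cA := C.cA.baseChange L
  cB := C.cB.baseChange L
  lB_comm b b' := by
    induction b using TensorProduct.induction_on with
    | zero => simp
    | add x y hx hy => simp only [map_add, add_mul, mul_add, hx, hy]
    | tmul c b =>
      induction b' using TensorProduct.induction_on with
      | zero => simp
      | add x y hx hy => simp only [map_add, add_mul, mul_add, hx, hy]
      | tmul c' b' => simp [C.lB_comm b b', mul_comm c c']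
  central a b := by
    induction a using TensorProduct.induction_on with
    | zero => simp
    | add x y hx hy => simp only [map_add, add_mul, mul_add, hx, hy]
    | tmul c a =>
      induction b using TensorProduct.induction_on with
      | zero => simp
      | add x y hx hy => simp only [add_mul, mul_add, hx, hy]
      | tmul c' b => simp [C.central a b, mul_comm c c']
  φstar := C.φstar.baseChange L
  lA_φstar b a := by
    induction a using TensorProduct.induction_on with
    | zero => simp
    | add x y hx hy => simp only [map_add, mul_add, hx, hy]
    | tmul c a =>
      induction b using TensorProduct.induction_on with
      | zero => simp
      | add x y hx hy => simp only [map_add, add_mul, hx, hy]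
      | tmul c' b => simp [C.lA_φstar]
  φ_φstar b := by
    induction b using TensorProduct.induction_on with
    | zero => simp
    | add x y hx hy => simp only [map_add, add_mul, mul_add, hx, hy, Finset.sum_add_distrib]
    | tmul c b =>
      simp [C.φ_φstar, CasimirPair.baseChange, TensorProduct.tmul_sum]
      rfl
  starA_invol a := by
    induction a using TensorProduct.induction_on with
    | zero => simp
    | add x y hx hy => simp only [map_add, hx, hy]
    | tmul c a => simp [C.starA_invol]
  starB_invol a := by
    induction a using TensorProduct.induction_on with
    | zero => simp
    | add x y hx hy => simp only [map_add, hx, hy]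
    | tmul c a => simp [C.starB_invol]
  starA_mul a a' := by
    induction a using TensorProduct.induction_on with
    | zero => simp
    | add x y hx hy => simp only [map_add, add_mul, mul_add, hx, hy]
    | tmul c a =>
      induction a' using TensorProduct.induction_on with
      | zero => simp
      | add x y hx hy => simp only [map_add, add_mul, mul_add, hx, hy]
      | tmul c' a' => simp [C.starA_mul a a', mul_comm c c']
  starB_mul a a' := by
    induction a using TensorProduct.induction_on with
    | zero => simp
    | add x y hx hy => simp only [map_add, add_mul, mul_add, hx, hy]
    | tmul c a =>
      induction a' using TensorProduct.induction_on with
      | zero => simp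
      | add x y hx hy => simp only [map_add, add_mul, mul_add, hx, hy]
      | tmul c' a' => simp [C.starB_mul a a', mul_comm c c']
  lA_star a := by
    induction a using TensorProduct.induction_on with
    | zero => simp
    | add x y hx hy => simp only [map_add, hx, hy]
    | tmul c a => simp [C.lA_star]
  lB_star a := by
    induction a using TensorProduct.induction_on with
    | zero => simp
    | add x y hx hy => simp only [map_add, hx, hy]
    | tmul c a => simp [C.lB_star]
  φ_star a := by
    induction a using TensorProduct.induction_on with
    | zero => simp
    | add x y hx hy => simp only [map_add, hx, hy]
    | tmul c a => simp [C.φ_star]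
  U_sq := by
    simp [C.U_sq, CasimirPair.baseChange, TensorProduct.tmul_sum]
    rfl
  φ_U := by
    simp [C.φ_U, CasimirPair.baseChange, TensorProduct.tmul_sum]
    rfl

/-- Direct sum of certificates. -/
def pi {ι : Type t} [Fintype ι] [DecidableEq ι] {A : ι → Type v} {B : ι → Type w}
    [∀ i, CommRing (A i)] [∀ i, Algebra K (A i)] [∀ i, Ring (B i)] [∀ i, Algebra K (B i)]
    {lA : ∀ i, A i →ₗ[K] K} {lB : ∀ i, B i →ₗ[K] K} {φ : ∀ i, A i →ₐ[K] B i} {U : ∀ i, A i}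
    {sA : ∀ i, A i →ₗ[K] A i} {sB : ∀ i, B i →ₗ[K] B i}
    (C : ∀ i, CasimirLaws.{u, v, w, x} (lA i) (lB i) (φ i) (U i) (sA i) (sB i)) :
    CasimirLaws.{u, max t v, max t w, max t x} (∑ i, lA i ∘ₗ LinearMap.proj i)
      (∑ i, lB i ∘ₗ LinearMap.proj i) (AlgHom.pi fun i => (φ i).comp (Pi.evalAlgHom K _ i)) U
      (LinearMap.pi fun i => sA i ∘ₗ LinearMap.proj i)
      (LinearMap.pi fun i => sB i ∘ₗ LinearMap.proj i) where
  cA := CasimirPair.pi fun i => (C i).cA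
  cB := CasimirPair.pi fun i => (C i).cB
  lB_comm b b' := by
    simp only [LinearMap.sum_apply, LinearMap.comp_apply,
      LinearMap.proj_apply, Pi.mul_apply]
    exact Finset.sum_congr rfl fun i _ => (C i).lB_comm _ _
  central a b := funext fun i => (C i).central _ _
  φstar := LinearMap.pi fun i => (C i).φstar ∘ₗ LinearMap.proj i
  lA_φstar b a := by
    simp only [LinearMap.sum_apply, LinearMap.comp_apply,
      LinearMap.proj_apply, Pi.mul_apply, LinearMap.pi_apply]
    exact Finset.sum_congr rfl fun i _ => (C i).lA_φstar _ _
  φ_φstar b := by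
    refine funext fun i => ((C i).φ_φstar (b i)).trans ?_
    refine ((congrFun (CasimirPair.sum_pi (fun i => (C i).cB) fun c d =>
      d * b * c) i).trans ?_).symm
    rw [Finset.sum_apply, Finset.sum_eq_single i]
    · rw [Finset.sum_apply]
      exact Finset.sum_congr rfl fun k _ => by simp
    · intro j _ hj
      rw [Finset.sum_apply]
      exact Finset.sum_eq_zero fun k _ => by
        simp [Pi.single_eq_of_ne hj.symm]
    · simp
  starA_invol a := funext fun i => (C i).starA_invol _
  starB_invol a := funext fun i => (C i).starB_invol _
  starA_mul a a' := funext fun i => (C i).starA_mul _ _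
  starB_mul a a' := funext fun i => (C i).starB_mul _ _
  lA_star a := by
    simp only [LinearMap.sum_apply, LinearMap.comp_apply,
      LinearMap.proj_apply, LinearMap.pi_apply]
    exact Finset.sum_congr rfl fun i _ => (C i).lA_star _
  lB_star a := by
    simp only [LinearMap.sum_apply, LinearMap.comp_apply,
      LinearMap.proj_apply, LinearMap.pi_apply]
    exact Finset.sum_congr rfl fun i _ => (C i).lB_star _
  φ_star a := funext fun i => (C i).φ_star _
  U_sq := by
    refine funext fun i => ((C i).U_sq).trans ?_
    refine ((congrFun (CasimirPair.sum_pi (fun i => (C i).cA) fun c d =>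
      c * (LinearMap.pi fun i => sA i ∘ₗ LinearMap.proj i) d) i).trans ?_).symm
    rw [Finset.sum_apply, Finset.sum_eq_single i]
    · rw [Finset.sum_apply]
      exact Finset.sum_congr rfl fun k _ => by simp
    · intro j _ hj
      rw [Finset.sum_apply]
      exact Finset.sum_eq_zero fun k _ => by
        simp [Pi.single_eq_of_ne hj.symm]
    · simp
  φ_U := by
    refine funext fun i => ((C i).φ_U).trans ?_
    refine ((congrFun (CasimirPair.sum_pi (fun i => (C i).cB) fun c d =>
      c * (LinearMap.pi fun i => sB i ∘ₗ LinearMap.proj i) d) i).trans ?_).symm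
    rw [Finset.sum_apply, Finset.sum_eq_single i]
    · rw [Finset.sum_apply]
      exact Finset.sum_congr rfl fun k _ => by simp
    · intro j _ hj
      rw [Finset.sum_apply]
      exact Finset.sum_eq_zero fun k _ => by
        simp [Pi.single_eq_of_ne hj.symm]
    · simp

end CasimirLaws

end EquippedData

/-! ### Extension of scalars preserves semisimplicity in characteristic zero -/

section Semisimple

variable {K : Type u} [Field K] {R : Type v} [Ring R] [Algebra K R]

variable (K R) in
/-- The linear form `x ↦ Tr (y ↦ x y)`. -/
def regularTrace : R →ₗ[K] K := LinearMap.trace K R ∘ₗ LinearMap.mul K R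

theorem regularTrace_comm (x y : R) : regularTrace K R (x * y) = regularTrace K R (y * x) := by
  have h (a b : R) : LinearMap.mul K R (a * b) = LinearMap.mul K R a * LinearMap.mul K R b := by
    ext z
    simp [mul_assoc]
  simp only [regularTrace, LinearMap.comp_apply, h]
  exact LinearMap.trace_mul_comm K _ _

/-- The radical of the trace form is an ideal, hence generated by an idempotent `e` when the ring is
semisimple. The trace of multiplication by `e` is its rank, so in characteristic zero its vanishing
forces `e = 0`. -/
theorem isFrobeniusPair_regularTrace [CharZero K] [Module.Finite K R] [IsSemisimpleRing R] :
    IsFrobeniusPair (regularTrace K R) := by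
  refine ⟨inferInstance, regularTrace_comm, fun x hx => ?_⟩
  let I : Ideal R :=
    { carrier := {x | ∀ y, regularTrace K R (x * y) = 0}
      add_mem' := fun {a b} ha hb y => by rw [add_mul, map_add, ha, hb, add_zero]
      zero_mem' := fun y => by simp
      smul_mem' := fun r a ha y => by
        rw [smul_eq_mul, regularTrace_comm, ← mul_assoc, regularTrace_comm, ha] }
  obtain ⟨e, he, hI⟩ := IsSemisimpleRing.ideal_eq_span_idempotent I
  have heI : e ∈ I := hI ▸ Ideal.subset_span rfl
  have h1 : LinearMap.trace K R (LinearMap.mul K R e) = 0 := by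
    simpa [regularTrace] using heI 1
  have h2 : IsIdempotentElem (LinearMap.mul K R e) := by
    ext z
    simp [← mul_assoc, he.eq]
  have h3 : e = 0 := by
    have := (LinearMap.IsIdempotentElem.trace_eq_zero_iff h2).1 h1
    simpa using LinearMap.congr_fun this 1
  have hxI : x ∈ I := hx
  rw [hI, h3] at hxI
  simpa using hxI

/-- The Jacobson radical of an Artinian ring is nilpotent, so products with its elements have trace
zero and it lies in the radical of the trace form. -/
theorem isSemisimpleRing_of_isFrobeniusPair_regularTrace (h : IsFrobeniusPair (regularTrace K R)) :
    IsSemisimpleRing R := by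
  have := h.finite
  have : IsArtinianRing R := isArtinian_of_tower K inferInstance
  have hJ : Ring.jacobson R = ⊥ := by
    rw [eq_bot_iff]
    intro x hx
    refine h.nondegenerate x fun y => ?_
    have hxy : x * y ∈ Ring.jacobson R := Ideal.mul_mem_right y _ hx
    obtain ⟨n, hn⟩ := IsSemiprimaryRing.isNilpotent (R := R)
    have h0 : (x * y) ^ n = 0 := by
      have := Ideal.pow_mem_pow hxy n
      rwa [hn] at this
    have hnil : IsNilpotent (LinearMap.mul K R (x * y)) := by
      refine ⟨n, ?_⟩
      ext z
      have : ∀ m : ℕ, ((LinearMap.mul K R (x * y)) ^ m) z = (x * y) ^ m * z := by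
        intro m
        induction m with
        | zero => simp
        | succ m ih => rw [pow_succ', Module.End.mul_apply, ih, pow_succ']; simp [mul_assoc]
      rw [this, h0]
      simp
    exact (LinearMap.isNilpotent_trace_of_isNilpotent hnil).eq_zero
  exact IsArtinianRing.isSemisimpleRing_iff_jacobson.2 hJ

/-- A basis together with its dual basis for the form is a Casimir pair. -/
theorem IsFrobeniusPair.nonempty_casimirPair {l : R →ₗ[K] K} (h : IsFrobeniusPair l) :
    Nonempty (CasimirPair.{u, v, 0} l) := by
  have := h.finite
  let b := Module.finBasis K R
  let F : R →ₗ[K] Module.Dual K R := (LinearMap.mul K R).compr₂ l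
  have hF : Function.Injective F := by
    rw [← LinearMap.ker_eq_bot, LinearMap.ker_eq_bot']
    intro x hx
    exact h.nondegenerate x fun y => LinearMap.congr_fun hx y
  let E : R ≃ₗ[K] Module.Dual K R :=
    LinearEquiv.ofInjectiveOfFinrankEq F hF (Subspace.dual_finrank_eq).symm
  refine ⟨⟨Fin (Module.finrank K R), fun k => E.symm (b.coord k), b, fun z => ?_⟩⟩
  have (k : Fin (Module.finrank K R)) : l (z * E.symm (b.coord k)) = b.repr z k := by
    rw [h.symm]
    exact LinearMap.congr_fun (E.apply_symm_apply (b.coord k)) z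
  simp_rw [this]
  exact b.sum_repr z

variable (L : Type u') [Field L] [Algebra K L]

theorem regularTrace_baseChange [Module.Finite K R] : regularTrace L (L ⊗[K] R) =
    (TensorProduct.AlgebraTensorModule.rid K L L).toLinearMap ∘ₗ
      (regularTrace K R).baseChange L := by
  ext r
  have : LinearMap.mul L (L ⊗[K] R) (1 ⊗ₜ r) = (LinearMap.mul K R r).baseChange L := by
    ext z
    simp
  simp [regularTrace, this, LinearMap.trace_baseChange, Algebra.algebraMap_eq_smul_one]

/-- Nondegeneracy of the trace form detects semisimplicity, and it survives any field extension
because it is witnessed by the equations of a Casimir pair. -/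
theorem isSemisimpleRing_baseChange [CharZero K] [Module.Finite K R] [IsSemisimpleRing R] :
    IsSemisimpleRing (L ⊗[K] R) := by
  refine isSemisimpleRing_of_isFrobeniusPair_regularTrace (K := L) ?_
  obtain ⟨P⟩ := (isFrobeniusPair_regularTrace (K := K) (R := R)).nonempty_casimirPair
  rw [regularTrace_baseChange]
  refine (P.baseChange L).isFrobeniusPair ?_
  rw [← regularTrace_baseChange]
  exact regularTrace_comm

end Semisimple

namespace EquippedData

variable {K : Type u} [Field K]

theorem IsSemisimple.baseChange [CharZero K] (L : Type u') [Field L] [Algebra K L]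
    {H : EquippedData.{u, v, w} K} (h : H.IsSemisimple) [Module.Finite K H.A]
    [Module.Finite K H.B] : (H.baseChange L).IsSemisimple := by
  obtain ⟨_, _⟩ := h
  exact ⟨isSemisimpleRing_baseChange (K := K) (R := H.A) L,
    isSemisimpleRing_baseChange (K := K) (R := H.B) L⟩

theorem isSemisimple_directSum {ι : Type t} [Fintype ι] {H : ι → EquippedData.{u, v, w} K}
    (h : ∀ i, (H i).IsSemisimple) : (directSum H).IsSemisimple := by
  have := fun i => (h i).1
  have := fun i => (h i).2
  exact ⟨inferInstanceAs (IsSemisimpleRing (∀ i, (H i).A)),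
    inferInstanceAs (IsSemisimpleRing (∀ i, (H i).B))⟩

/-! ### Direct sums -/

section

variable {ι : Type t} [Fintype ι] [DecidableEq ι] (L : Type u') [Field L] [Algebra K L]
  {R : ι → Type v} {S : ι → Type w} [∀ i, Ring (R i)] [∀ i, Ring (S i)] [∀ i, Algebra K (R i)]
  [∀ i, Algebra K (S i)]

theorem sum_rid_piRight (l : ∀ i, R i →ₗ[K] K) (a : L ⊗[K] ∀ i, R i) :
    (∑ i, ((TensorProduct.AlgebraTensorModule.rid K L L).toLinearMap ∘ₗ (l i).baseChange L) ∘ₗ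
      LinearMap.proj i) (Algebra.TensorProduct.piRight K L L R a) =
    ((TensorProduct.AlgebraTensorModule.rid K L L).toLinearMap ∘ₗ
      (∑ i, l i ∘ₗ LinearMap.proj i).baseChange L) a := by
  induction a using TensorProduct.induction_on with
  | zero => simp
  | add x y hx hy => simp only [map_add, hx, hy]
  | tmul c a => simp [LinearMap.sum_apply, Finset.sum_smul]

theorem pi_baseChange_piRight (f : ∀ i, R i →ₗ[K] R i) (a : L ⊗[K] ∀ i, R i) :
    (LinearMap.pi fun i => (f i).baseChange L ∘ₗ LinearMap.proj i)
      (Algebra.TensorProduct.piRight K L L R a) =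
    Algebra.TensorProduct.piRight K L L R
      ((LinearMap.pi fun i => f i ∘ₗ LinearMap.proj i).baseChange L a) := by
  induction a using TensorProduct.induction_on with
  | zero => simp
  | add x y hx hy => simp only [map_add, hx, hy]
  | tmul c a => ext i; simp

theorem pi_map_piRight (f : ∀ i, R i →ₐ[K] S i) (a : L ⊗[K] ∀ i, R i) :
    (AlgHom.pi fun i => (Algebra.TensorProduct.map (AlgHom.id L L) (f i)).comp
      (Pi.evalAlgHom L _ i)) (Algebra.TensorProduct.piRight K L L R a) =
    Algebra.TensorProduct.piRight K L L S (Algebra.TensorProduct.map (AlgHom.id L L)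
      (AlgHom.pi fun i => (f i).comp (Pi.evalAlgHom K _ i)) a) := by
  induction a using TensorProduct.induction_on with
  | zero => simp
  | add x y hx hy => simp only [map_add, hx, hy]
  | tmul c a => ext i; simp

end

/-- Extension of scalars commutes with direct sums. -/
def baseChangeDirectSum {ι : Type t} [Fintype ι] [DecidableEq ι] (L : Type u') [Field L]
    [Algebra K L] (H : ι → EquippedData.{u, v, w} K) :
    Iso ((directSum H).baseChange L) (directSum fun i => (H i).baseChange L) where
  eA := Algebra.TensorProduct.piRight K L L fun i => (H i).A
  eB := Algebra.TensorProduct.piRight K L L fun i => (H i).B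
  lA_eq := sum_rid_piRight L fun i => (H i).lA
  lB_eq := sum_rid_piRight L fun i => (H i).lB
  φ_eq := pi_map_piRight L fun i => (H i).φ
  U_eq := rfl
  starA_eq := pi_baseChange_piRight L fun i => (H i).starA
  starB_eq := pi_baseChange_piRight L fun i => (H i).starB

/-- A component of a decomposition of equipped data. -/
structure Component (H : EquippedData.{u, v, w} K) (H' : EquippedData.{u, v', w'} K) where
  fA : H.A →ₐ[K] H'.A
  fB : H.B →ₐ[K] H'.B
  φ_eq : ∀ a, H'.φ (fA a) = fB (H.φ a)
  U_eq : fA H.U = H'.U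
  starA_eq : ∀ a, H'.starA (fA a) = fA (H.starA a)
  starB_eq : ∀ b, H'.starB (fB b) = fB (H.starB b)

/-- A lift of an element of one factor vanishes in all the others and carries the right value of the
linear form. Summing lifts gives surjectivity, and by injectivity every element is the sum of the
lifts of its components, which yields the formula for `l`. -/
theorem bijective_pi_of_lift {ι : Type t} [Fintype ι] [DecidableEq ι] {R : Type v}
    {S : ι → Type w} [Ring R] [∀ i, Ring (S i)] [Algebra K R] [∀ i, Algebra K (S i)]
    (f : ∀ i, R →ₐ[K] S i) (inj : ∀ a, (∀ i, f i a = 0) → a = 0) {l : R →ₗ[K] K}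
    {l' : ∀ i, S i →ₗ[K] K}
    (lift : ∀ i (a' : S i), ∃ a, f i a = a' ∧ (∀ j, j ≠ i → f j a = 0) ∧ l a = l' i a') :
    Function.Bijective (AlgHom.pi f) ∧
      ∀ a, (∑ i, l' i ∘ₗ LinearMap.proj i) (AlgHom.pi f a) = l a := by
  choose s hs hs0 hsl using lift
  have key (a' : ∀ i, S i) (j : ι) : f j (∑ i, s i (a' i)) = a' j := by
    rw [map_sum, Finset.sum_eq_single j, hs]
    · exact fun i _ hi => hs0 i _ _ hi.symm
    · simp
  refine ⟨⟨?_, fun a' => ⟨∑ i, s i (a' i), funext (key a')⟩⟩, fun a => ?_⟩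
  · rw [injective_iff_map_eq_zero]
    exact fun a ha => inj a fun i => congrFun ha i
  · have ha : a = ∑ i, s i (f i a) := by
      rw [← sub_eq_zero]
      refine inj _ fun j => ?_
      rw [map_sub, key fun i => f i a, sub_self]
    conv_rhs => rw [ha]
    simp [LinearMap.sum_apply, hsl]

/-- Equipped data is the direct sum of its components. -/
theorem nonempty_iso_directSum {ι : Type t} [Fintype ι] [DecidableEq ι]
    {H : EquippedData.{u, v, w} K} {H' : ι → EquippedData.{u, v', w'} K}
    (f : ∀ i, Component H (H' i))
    (injA : ∀ a, (∀ i, (f i).fA a = 0) → a = 0) (injB : ∀ b, (∀ i, (f i).fB b = 0) → b = 0)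
    (liftA : ∀ i (a' : (H' i).A), ∃ a, (f i).fA a = a' ∧ (∀ j, j ≠ i → (f j).fA a = 0) ∧
      H.lA a = (H' i).lA a')
    (liftB : ∀ i (b' : (H' i).B), ∃ b, (f i).fB b = b' ∧ (∀ j, j ≠ i → (f j).fB b = 0) ∧
      H.lB b = (H' i).lB b') :
    Nonempty (Iso H (directSum H')) := by
  obtain ⟨hA, hlA⟩ := bijective_pi_of_lift (fun i => (f i).fA) injA liftA
  obtain ⟨hB, hlB⟩ := bijective_pi_of_lift (fun i => (f i).fB) injB liftB
  exact ⟨{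
    eA := AlgEquiv.ofBijective _ hA
    eB := AlgEquiv.ofBijective _ hB
    lA_eq := hlA
    lB_eq := hlB
    φ_eq := fun a => funext fun i => (f i).φ_eq a
    U_eq := funext fun i => (f i).U_eq
    starA_eq := fun a => funext fun i => (f i).starA_eq a
    starB_eq := fun a => funext fun i => (f i).starB_eq a }⟩

/-! ### Changing the involution on `B` -/

/-- The same data with another map `⋆` on `B`. -/
def withStar (H : EquippedData.{u, v, w} K) (s : H.B →ₗ[K] H.B) : EquippedData.{u, v, w} K :=
  { H with starB := s }

/-- The involution `⋆` of an equipped Cardy--Frobenius algebra may be twisted by an invertible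
`⋆`-symmetric element `S`. -/
def Certificate.twist {H : EquippedData.{u, v, w} K} (C : Certificate.{u, v, w, x} H)
    (S : H.Bˣ) (hS : H.starB S = S) (s : H.B →ₗ[K] H.B)
    (hs : ∀ b, s b = ↑S⁻¹ * H.starB b * S) :
    CasimirLaws.{u, v, w, x} H.lA H.lB H.φ H.U H.starA s := by
  have hone : H.starB 1 = 1 := by
    have := C.starB_mul 1 (H.starB 1)
    rwa [one_mul, C.starB_invol, one_mul, eq_comm] at this
  have hS' : H.starB ↑S⁻¹ = ↑S⁻¹ := by
    have h1 : H.starB ↑S⁻¹ * S = 1 := by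
      conv_lhs => rw [← hS, ← C.starB_mul, S.mul_inv, hone]
    exact (Units.inv_eq_of_mul_eq_one_left h1).symm
  exact {
    C with
    starB_invol := fun b => by
      simp only [hs, C.starB_mul, C.starB_invol, hS, hS']
      simp [mul_assoc]
    starB_mul := fun b b' => by
      simp only [hs, C.starB_mul]
      simp [mul_assoc]
    lB_star := fun b => by
      rw [hs, C.lB_comm, ← mul_assoc, Units.mul_inv, one_mul, C.lB_star]
    φ_star := fun a => by
      rw [hs, ← C.φ_star, mul_assoc, C.central, ← mul_assoc, Units.inv_mul, one_mul]
    φ_U := by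
      -- Balancing moves `S⁻¹` across the tensor: `∑ c_k S⁻¹ d_k^⋆ = ∑ c_k (S⁻¹ d_k)^⋆ = (∑ c_k
      -- d_k^⋆) S⁻¹`, and the final factor `S` of the twist cancels it.
      have := C.cB.balanced C.lB_comm
        ((LinearMap.mul K H.B).compl₁₂ LinearMap.id H.starB) ↑S⁻¹
      simp only [LinearMap.compl₁₂_apply, LinearMap.id_apply, LinearMap.mul_apply', C.starB_mul,
        hS'] at this
      simp only [hs, ← mul_assoc] at this ⊢
      rw [← Finset.sum_mul, this, ← Finset.sum_mul, ← C.φ_U, mul_assoc, Units.inv_mul, mul_one] }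

/-- Twisting the involution by `S = T²` with `T` symmetric does not change the isomorphism class. -/
def isoTwist {H : EquippedData.{u, v, w} K} (C : Certificate.{u, v, w, x} H)
    (T : H.Bˣ) (hT : H.starB T = T) (s : H.B →ₗ[K] H.B)
    (hs : ∀ b, (T * T : H.B) * s b = H.starB b * (T * T)) : Iso (H.withStar s) H where
  eA := AlgEquiv.refl
  -- This is `b ↦ T b T⁻¹`; it intertwines the two involutions since both `(T b T⁻¹)^⋆` and `T (T⁻²
  -- b^⋆ T²) T⁻¹` equal `T⁻¹ b^⋆ T`.
  eB := MulSemiringAction.toAlgEquiv K H.B (ConjAct.toConjAct T)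
  lA_eq _ := rfl
  lB_eq := fun (b : H.B) => by
    change H.lB (↑T * b * ↑T⁻¹) = H.lB b
    rw [C.lB_comm, ← mul_assoc, Units.inv_mul, one_mul]
  φ_eq := fun (a : H.A) => by
    change H.φ a = ↑T * H.φ a * ↑T⁻¹
    rw [← C.central, mul_assoc, Units.mul_inv, mul_one]
  U_eq := rfl
  starA_eq _ := rfl
  starB_eq := fun (b : H.B) => by
    change H.starB (↑T * b * ↑T⁻¹) = ↑T * s b * ↑T⁻¹
    have hone : H.starB 1 = 1 := by
      have := C.starB_mul 1 (H.starB 1)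
      rwa [one_mul, C.starB_invol, one_mul, eq_comm] at this
    have hT' : H.starB ↑T⁻¹ = ↑T⁻¹ := by
      have h1 : H.starB ↑T⁻¹ * T = 1 := by
        conv_lhs => rw [← hT, ← C.starB_mul, T.mul_inv, hone]
      exact (Units.inv_eq_of_mul_eq_one_left h1).symm
    rw [C.starB_mul, C.starB_mul, hT, hT']
    have := congrArg (fun z : H.B => ((T⁻¹ : H.Bˣ) : H.B) * z * ((T⁻¹ : H.Bˣ) : H.B)) (hs b)
    simpa [mul_assoc] using this.symm

end EquippedData

/-! ### Conjugations on real division algebras -/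

section Conjugation

variable (D : Type v) [DivisionRing D] [Algebra ℝ D] [StarRing D] [StarModule ℝ D]

/-- The properties of conjugation and of the real part common to `ℝ`, `ℂ` and `ℍ`, together with an
orthonormal basis `e`. -/
structure Conjugation (re : D →ₗ[ℝ] ℝ) where
  d : ℕ
  e : Fin d → D
  finrank_eq : Module.finrank ℝ D = d
  re_one : re 1 = 1
  re_mul_comm : ∀ x y, re (x * y) = re (y * x)
  star_eq : ∀ x, star x = algebraMap ℝ D (2 * re x) - x
  star_mul_self : ∀ x, star x * x = algebraMap ℝ D (re (star x * x))
  pos : ∀ x, x ≠ 0 → 0 < re (star x * x)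
  orthonormal : ∀ i j, re (star (e i) * e j) = if i = j then 1 else 0
  expand : ∀ x, ∑ k, re (star (e k) * x) • e k = x

namespace Conjugation

variable {D} {re : D →ₗ[ℝ] ℝ}

theorem finite (C : Conjugation D re) : Module.Finite ℝ D := by
  refine Module.Finite.of_surjective (Fintype.linearCombination ℝ C.e) fun z => ?_
  exact ⟨fun k => re (star (C.e k) * z), by
    simpa [Fintype.linearCombination_apply] using C.expand z⟩

theorem d_pos (C : Conjugation D re) : 0 < C.d := by
  have := C.finite
  rw [← C.finrank_eq]
  exact Module.finrank_pos

theorem d_ne_zero (C : Conjugation D re) : (C.d : ℝ) ≠ 0 := by exact_mod_cast C.d_pos.ne'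

theorem re_algebraMap (C : Conjugation D re) (r : ℝ) : re (algebraMap ℝ D r) = r := by
  rw [Algebra.algebraMap_eq_smul_one, map_smul, C.re_one, smul_eq_mul, mul_one]

theorem re_star (C : Conjugation D re) (x : D) : re (star x) = re x := by
  rw [C.star_eq, map_sub, C.re_algebraMap]
  ring

theorem star_e_mul_e (C : Conjugation D re) (k : Fin C.d) : star (C.e k) * C.e k = 1 := by
  rw [C.star_mul_self, C.orthonormal, if_pos rfl, map_one]

theorem e_mul_star_e (C : Conjugation D re) (k : Fin C.d) : C.e k * star (C.e k) = 1 :=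
  mul_eq_one_comm.1 (C.star_e_mul_e k)

/-- The Casimir pair of the form `re (x y)`. -/
def casimirPair (C : Conjugation D re) : CasimirPair.{0, v, 0} re where
  ι := Fin C.d
  c k := star (C.e k)
  d := C.e
  expand z := by
    simp_rw [C.re_mul_comm z]
    exact C.expand z

/-- From `ē_k = 2 Re(e_k) - e_k` and `e_k ē_k = 1` one gets `e_k² = 2 Re(e_k) e_k - 1`. The first
terms add up to twice the expansion of `1`, the others to `-d`. -/
theorem sum_e_mul_e (C : Conjugation D re) : ∑ k, C.e k * C.e k = algebraMap ℝ D (2 - C.d) := by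
  have h (k : Fin C.d) : C.e k * C.e k = (2 : ℝ) • (re (star (C.e k) * 1) • C.e k) - 1 := by
    have h1 := C.e_mul_star_e k
    rw [C.star_eq, mul_sub, sub_eq_iff_eq_add] at h1
    rw [mul_one, C.re_star, smul_smul, eq_sub_iff_add_eq, add_comm, ← h1,
      ← Algebra.commutes, Algebra.smul_def]
  rw [Finset.sum_congr rfl fun k _ => h k, Finset.sum_sub_distrib, ← Finset.smul_sum, C.expand]
  rw [map_sub, map_natCast, Algebra.algebraMap_eq_smul_one (2 : ℝ)]
  simp

theorem sum_star_e_mul_star_e (C : Conjugation D re) :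
    ∑ k, star (C.e k) * star (C.e k) = algebraMap ℝ D (2 - C.d) := by
  have := congrArg star C.sum_e_mul_e
  rw [star_sum] at this
  simpa only [star_mul, ← algebraMap_star_comm, star_trivial] using this

/-- Balancedness for `(c, d) ↦ c d̄` replaces `∑ ē_k y ē_k` by `∑ ē_k ē_k ȳ`. -/
theorem sum_star_e_mul_mul_star_e (C : Conjugation D re) (y : D) :
    ∑ k, star (C.e k) * y * star (C.e k) = algebraMap ℝ D (2 - C.d) * star y := by
  have := C.casimirPair.balanced C.re_mul_comm
    ((LinearMap.mul ℝ D).compl₁₂ LinearMap.id (starLinearEquiv ℝ (A := D)).toLinearMap) y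
  simp only [LinearMap.compl₁₂_apply, LinearMap.id_apply, LinearMap.mul_apply'] at this
  refine this.trans ?_
  rw [← C.sum_star_e_mul_star_e, Finset.sum_mul]
  refine Finset.sum_congr rfl fun k _ => ?_
  simp [casimirPair, mul_assoc]

/-- The orthogonal projection onto the center. -/
def centerProj (C : Conjugation D re) : D →ₗ[ℝ] Subalgebra.center ℝ D :=
  LinearMap.codRestrict (Subalgebra.toSubmodule (Subalgebra.center ℝ D))
    ((C.d : ℝ)⁻¹ • ∑ k, LinearMap.mulLeftRight ℝ (C.e k, star (C.e k)))
    (fun t => by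
      refine Submodule.smul_mem _ _ ?_
      rw [LinearMap.sum_apply, Subalgebra.mem_toSubmodule, Subalgebra.mem_center_iff]
      intro r
      exact C.casimirPair.sum_mul_mul_comm C.re_mul_comm r t)

theorem coe_centerProj (C : Conjugation D re) (t : D) :
    (C.centerProj t : D) = (C.d : ℝ)⁻¹ • ∑ k, C.e k * t * star (C.e k) := by
  change ((C.d : ℝ)⁻¹ • ∑ k, LinearMap.mulLeftRight ℝ (C.e k, star (C.e k))) t = _
  simp [LinearMap.sum_apply, LinearMap.mulLeftRight_apply]

theorem centerProj_mul (C : Conjugation D re) (t : D) (z : Subalgebra.center ℝ D) :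
    C.centerProj (t * z) = C.centerProj t * z := by
  refine Subtype.ext ?_
  rw [MulMemClass.coe_mul, coe_centerProj, coe_centerProj, smul_mul_assoc, Finset.sum_mul]
  congr 1
  refine Finset.sum_congr rfl fun k _ => ?_
  have := Subalgebra.mem_center_iff.1 z.2 (star (C.e k))
  simp only [mul_assoc, this]

theorem centerProj_one (C : Conjugation D re) : C.centerProj 1 = 1 := by
  refine Subtype.ext ?_
  simp [coe_centerProj, C.e_mul_star_e, ← Nat.cast_smul_eq_nsmul ℝ, smul_smul, C.d_ne_zero]

theorem centerProj_coe (C : Conjugation D re) (z : Subalgebra.center ℝ D) : C.centerProj z = z := by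
  simpa [C.centerProj_one] using C.centerProj_mul 1 z

theorem re_centerProj (C : Conjugation D re) (t : D) : re (C.centerProj t) = re t := by
  have h (k : Fin C.d) : re (C.e k * t * star (C.e k)) = re t := by
    rw [C.re_mul_comm, ← mul_assoc, C.star_e_mul_e, one_mul]
  simp [coe_centerProj, h, C.d_ne_zero]

theorem re_mul_centerProj (C : Conjugation D re) (z : Subalgebra.center ℝ D) (t : D) :
    re (z * C.centerProj t) = re (z * t) := by
  rw [C.re_mul_comm, ← MulMemClass.coe_mul, ← C.centerProj_mul, C.re_centerProj, C.re_mul_comm]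

theorem star_centerProj (C : Conjugation D re) (t : D) : star (C.centerProj t : D) = C.centerProj (star t) := by
  simp [coe_centerProj, mul_assoc]

/-- With `p` the projection, linearity over the center gives `p(ē_k)² = p(ē_k p(ē_k))`. Inside, `∑_k
ē_k p(ē_k) = d⁻¹ ∑_{j,k} ē_k e_j ē_k ē_j`; summing over `k` produces `(2 - d) ē_j ē_j`, and summing
over `j` a second factor `2 - d`. -/
theorem sum_centerProj_mul (C : Conjugation D re) : ∑ k, (C.centerProj (star (C.e k)) : D) * C.centerProj (star (C.e k)) =
    algebraMap ℝ D ((C.d : ℝ)⁻¹ * (2 - C.d) ^ 2) := by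
  have h (k : Fin C.d) : C.centerProj (star (C.e k)) * C.centerProj (star (C.e k)) =
      C.centerProj (star (C.e k) * (C.centerProj (star (C.e k)) : D)) :=
    (C.centerProj_mul _ _).symm
  have h2 : ∑ k, star (C.e k) * (C.centerProj (star (C.e k)) : D) =
      algebraMap ℝ D ((C.d : ℝ)⁻¹ * (2 - C.d) ^ 2) := by
    simp only [coe_centerProj, mul_smul_comm, ← Finset.smul_sum, Finset.mul_sum]
    rw [Finset.sum_comm]
    simp only [← mul_assoc, ← Finset.sum_mul, C.sum_star_e_mul_mul_star_e]
    simp only [mul_assoc, ← Finset.mul_sum, C.sum_star_e_mul_star_e]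
    rw [← map_mul, map_mul _ (C.d : ℝ)⁻¹, Algebra.smul_def, sq]
  have h3 := congrArg (fun z => (C.centerProj z : D)) h2
  simp only [map_sum, ← h, Algebra.algebraMap_eq_smul_one, map_smul, C.centerProj_one] at h3
  simpa [Algebra.algebraMap_eq_smul_one] using h3

theorem re_trace_mul_comm (C : Conjugation D re) {n : ℕ} (x y : Matrix (Fin n) (Fin n) D) :
    re (Matrix.trace (x * y)) = re (Matrix.trace (y * x)) := by
  simp only [Matrix.trace, Matrix.diag_apply, Matrix.mul_apply, map_sum]
  rw [Finset.sum_comm]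
  exact Finset.sum_congr rfl fun i _ => Finset.sum_congr rfl fun j _ => C.re_mul_comm _ _

end Conjugation

end Conjugation

/-! ### Verification of the laws for `H^𝔻_{n,μ}` -/

section MatrixLaws

variable (D : Type v) [DivisionRing D] [Algebra ℝ D] [StarRing D] [StarModule ℝ D]

namespace Conjugation

variable {D} {re : D →ₗ[ℝ] ℝ}

/-- The Casimir pair of `H^𝔻_{n,μ}` on `Mat_n(𝔻)`. -/
def matrixPair (C : Conjugation D re) (n : ℕ) {μ : ℝ} (hμ : μ ≠ 0) :
    CasimirPair.{0, v, 0} (μ • (re ∘ₗ Matrix.traceLinearMap (Fin n) ℝ D)) where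
  ι := Fin C.d × Fin n × Fin n
  c k := μ⁻¹ • Matrix.single k.2.2 k.2.1 (star (C.e k.1))
  d k := Matrix.single k.2.1 k.2.2 (C.e k.1)
  expand z := by
    have h (k : Fin C.d × Fin n × Fin n) : (μ • (re ∘ₗ Matrix.traceLinearMap (Fin n) ℝ D))
        (z * μ⁻¹ • Matrix.single k.2.2 k.2.1 (star (C.e k.1))) =
        re (star (C.e k.1) * z k.2.1 k.2.2) := by
      rw [C.re_mul_comm]
      simp [hμ, Matrix.trace_mul_single]
    simp only [h, Fintype.sum_prod_type_right]
    conv_rhs => rw [Matrix.matrix_eq_sum_single z]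
    rw [Finset.sum_comm]
    refine Finset.sum_congr rfl fun i _ => Finset.sum_congr rfl fun j _ => ?_
    conv_rhs => rw [← C.expand (z i j)]
    ext a b
    simp [Matrix.sum_apply, Matrix.single_apply]
    
/-- The Casimir pair of `H^𝔻_{n,μ}` on `Z(𝔻)`. -/
def centerPair (C : Conjugation D re) {μ : ℝ} (hμ : μ ≠ 0) :
    CasimirPair.{0, v, 0} ((μ ^ 2 / (Module.finrank ℝ D : ℝ)) •
      (re ∘ₗ (Subalgebra.center ℝ D).val.toLinearMap)) where
  ι := Fin C.d
  -- The factor `d / μ²` cancels the normalisation of `l_A`. The `d` projected elements need not be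
  -- independent (for `ℍ` they span a line); a Casimir pair does not ask for bases.
  c k := ((C.d : ℝ) / μ ^ 2) • C.centerProj (star (C.e k))
  d k := C.centerProj (C.e k)
  expand z := by
    have := C.d_ne_zero
    have h (k : Fin C.d) : ((μ ^ 2 / (Module.finrank ℝ D : ℝ)) •
        (re ∘ₗ (Subalgebra.center ℝ D).val.toLinearMap))
        (z * ((C.d : ℝ) / μ ^ 2) • C.centerProj (star (C.e k))) = re (star (C.e k) * z) := by
      rw [mul_smul_comm, map_smul, C.finrank_eq, C.re_mul_comm, ← C.re_mul_centerProj]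
      simp
      field_simp
    rw [Finset.sum_congr rfl fun k _ => congrArg (· • C.centerProj (C.e k)) (h k)]
    simp only [← map_smul, ← map_sum, C.expand, C.centerProj_coe]

/-- Projection commutes with conjugation, so up to the factor `d / μ²` this is the sum `∑ p(ē_k)² =
d⁻¹ (2 - d)²`. -/
theorem sum_centerPair (C : Conjugation D re) {μ : ℝ} (hμ : μ ≠ 0) :
    ∑ k : Fin C.d, (((C.d : ℝ) / μ ^ 2) • C.centerProj (star (C.e k))) *
      centerStar D (C.centerProj (C.e k)) =
    algebraMap ℝ (Subalgebra.center ℝ D) ((2 - (Module.finrank ℝ D : ℝ)) / μ) ^ 2 := by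
  have := C.d_ne_zero
  have h (k : Fin C.d) : (((C.d : ℝ) / μ ^ 2) • C.centerProj (star (C.e k))) *
      centerStar D (C.centerProj (C.e k)) = ((C.d : ℝ) / μ ^ 2) •
        (C.centerProj (star (C.e k)) * C.centerProj (star (C.e k))) := by
    rw [smul_mul_assoc]
    congr 2
    exact Subtype.ext (C.star_centerProj _)
  rw [Finset.sum_congr rfl fun k _ => h k, ← Finset.smul_sum]
  refine Subtype.ext ?_
  have h2 := C.sum_centerProj_mul
  simp only [SetLike.val_smul, AddSubmonoidClass.coe_finsetSum, MulMemClass.coe_mul, h2]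
  rw [Algebra.smul_def, ← map_mul, C.finrank_eq, ← map_pow]
  refine congrArg (algebraMap ℝ D) ?_
  field_simp

/-- The product `E_ij e_k b ē_k E_ji` is `e_k b_jj ē_k` placed at `(i, i)`; summing over `k` and `j`
gives `d` times the central projection of the trace. -/
theorem sum_matrixPair_mul_mul (C : Conjugation D re) {n : ℕ} (μ : ℝ)
    (b : Matrix (Fin n) (Fin n) D) :
    ∑ k : Fin C.d × Fin n × Fin n, Matrix.single k.2.1 k.2.2 (C.e k.1) * b *
      (μ⁻¹ • Matrix.single k.2.2 k.2.1 (star (C.e k.1))) =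
    centerToMatrix D n (((C.d : ℝ) / μ) • C.centerProj (Matrix.trace b)) := by
  have := C.d_ne_zero
  have h (k : Fin C.d × Fin n × Fin n) : Matrix.single k.2.1 k.2.2 (C.e k.1) * b *
      (μ⁻¹ • Matrix.single k.2.2 k.2.1 (star (C.e k.1))) =
      Matrix.single k.2.1 k.2.1 (μ⁻¹ • (C.e k.1 * b k.2.2 k.2.2 * star (C.e k.1))) := by
    rw [mul_smul_comm, Matrix.single_mul_mul_single, Matrix.smul_single]
  rw [Finset.sum_congr rfl fun k _ => h k]
  have h2 : ∑ k, ∑ j, μ⁻¹ • (C.e k * b j j * star (C.e k)) =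
      (((C.d : ℝ) / μ) • C.centerProj (Matrix.trace b) : Subalgebra.center ℝ D) := by
    simp only [← Finset.smul_sum, SetLike.val_smul, C.coe_centerProj, smul_smul, Matrix.trace,
      Matrix.diag_apply, Finset.mul_sum, Finset.sum_mul]
    congr 1
    field_simp
  have h3 : centerToMatrix D n (((C.d : ℝ) / μ) • C.centerProj (Matrix.trace b)) =
      Matrix.diagonal fun _ =>
        ((((C.d : ℝ) / μ) • C.centerProj (Matrix.trace b) : Subalgebra.center ℝ D) : D) := rfl
  rw [h3, ← h2]
  ext i j
  simp only [Fintype.sum_prod_type, Matrix.sum_apply, Matrix.single_apply, Matrix.diagonal_apply]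
  by_cases hij : i = j
  · subst hij
    simp
  · rw [if_neg hij]
    refine Finset.sum_eq_zero fun k _ => Finset.sum_eq_zero fun a _ => Finset.sum_eq_zero
      fun c _ => if_neg ?_
    rintro ⟨rfl, h⟩
    exact hij h

/-- Conjugate transposition turns `E_ij e_k` into `E_ji ē_k`, so each term contains `E_ji E_ji`,
which vanishes unless `i = j`. What is left on the diagonal is `μ⁻¹ ∑ ē_k² = (2 - d) / μ`. -/
theorem sum_matrixPair_star (C : Conjugation D re) (n : ℕ) (μ : ℝ) :
    ∑ k : Fin C.d × Fin n × Fin n, (μ⁻¹ • Matrix.single k.2.2 k.2.1 (star (C.e k.1))) *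
      matrixStar D n (Matrix.single k.2.1 k.2.2 (C.e k.1)) =
    centerToMatrix D n (algebraMap ℝ _ ((2 - (Module.finrank ℝ D : ℝ)) / μ)) := by
  have h (k : Fin C.d × Fin n × Fin n) :
      (μ⁻¹ • Matrix.single k.2.2 k.2.1 (star (C.e k.1))) *
        matrixStar D n (Matrix.single k.2.1 k.2.2 (C.e k.1)) =
      if k.2.1 = k.2.2 then
        Matrix.single k.2.2 k.2.2 (μ⁻¹ • (star (C.e k.1) * star (C.e k.1))) else 0 := by
    have : matrixStar D n (Matrix.single k.2.1 k.2.2 (C.e k.1)) =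
        Matrix.single k.2.2 k.2.1 (star (C.e k.1)) := Matrix.conjTranspose_single _ _ _
    rw [this, smul_mul_assoc]
    split_ifs with hk
    · rw [hk, Matrix.single_mul_single_same, Matrix.smul_single]
    · rw [Matrix.single_mul_single_of_ne _ _ _ _ hk, smul_zero]
  rw [Finset.sum_congr rfl fun k _ => h k]
  have h2 : ∑ k, μ⁻¹ • (star (C.e k) * star (C.e k)) =
      algebraMap ℝ D ((2 - (Module.finrank ℝ D : ℝ)) / μ) := by
    rw [← Finset.smul_sum, C.sum_star_e_mul_star_e, C.finrank_eq, Algebra.smul_def, ← map_mul]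
    congr 1
    ring
  rw [AlgHom.commutes, Matrix.algebraMap_eq_diagonal]
  simp only [Fintype.sum_prod_type, Finset.sum_ite_eq, Finset.mem_univ, if_true]
  ext i j
  simp only [Matrix.sum_apply, Matrix.single_apply, Matrix.diagonal_apply, Pi.algebraMap_apply, ← h2]
  by_cases hij : i = j
  · subst hij
    simp
  · rw [if_neg hij]
    refine Finset.sum_eq_zero fun k _ => Finset.sum_eq_zero fun a _ => if_neg ?_
    rintro ⟨rfl, h⟩
    exact hij h

/-- The laws of `H^𝔻_{n,μ}`. -/
def matrixLaws (C : Conjugation D re) (n : ℕ) {μ : ℝ} (hμ : μ ≠ 0) :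
    EquippedData.CasimirLaws.{0, v, v, 0} ((μ ^ 2 / (Module.finrank ℝ D : ℝ)) •
      (re ∘ₗ (Subalgebra.center ℝ D).val.toLinearMap))
      (μ • (re ∘ₗ Matrix.traceLinearMap (Fin n) ℝ D)) (centerToMatrix D n)
      (algebraMap ℝ _ ((2 - (Module.finrank ℝ D : ℝ)) / μ)) (centerStar D) (matrixStar D n) where
  cA := C.centerPair hμ
  cB := C.matrixPair n hμ
  lB_comm b b' := by simp [C.re_trace_mul_comm b b']
  central a b := by
    ext i j
    simpa [centerToMatrix] using (Subalgebra.mem_center_iff.1 a.2 (b i j)).symm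
  -- Duality fixes the constant: `(μ² / d) (d / μ) = μ`, and projecting the trace to the center does
  -- not change real parts of its products with central elements.
  φstar := ((C.d : ℝ) / μ) • (C.centerProj ∘ₗ Matrix.traceLinearMap (Fin n) ℝ D)
  lA_φstar b a := by
    have := C.d_ne_zero
    have h1 : C.centerProj (Matrix.trace b) * a = C.centerProj (Matrix.trace b * a) :=
      (C.centerProj_mul _ _).symm
    have h2 : Matrix.trace (b * centerToMatrix D n a) = Matrix.trace b * a := by
      simp [Matrix.trace, centerToMatrix, Finset.sum_mul]
    simp only [LinearMap.smul_apply, LinearMap.comp_apply, Matrix.traceLinearMap_apply,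
      smul_mul_assoc, h1, h2, map_smul, C.finrank_eq, AlgHom.toLinearMap_apply,
      Subalgebra.coe_val, C.re_centerProj, smul_eq_mul]
    field_simp
  φ_φstar b := (C.sum_matrixPair_mul_mul μ b).symm
  starA_invol a := Subtype.ext (star_star _)
  starB_invol b := Matrix.conjTranspose_conjTranspose b
  starA_mul a a' := Subtype.ext (star_mul _ _)
  starB_mul b b' := Matrix.conjTranspose_mul _ _
  lA_star a := by simp [centerStar, C.re_star]
  lB_star b := by simp [matrixStar, Matrix.trace_conjTranspose, C.re_star]
  φ_star a := (Matrix.diagonal_conjTranspose _).symm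
  U_sq := (C.sum_centerPair hμ).symm
  φ_U := (C.sum_matrixPair_star n μ).symm

end Conjugation

end MatrixLaws

/-! ### The cases `ℝ`, `ℂ`, `ℍ`, and semisimplicity of the models -/

namespace Conjugation

/-- Complex conjugation on `ℝ`. -/
def real : Conjugation ℝ (LinearMap.id : ℝ →ₗ[ℝ] ℝ) where
  d := 1
  e _ := 1
  finrank_eq := Module.finrank_self ℝ
  re_one := rfl
  re_mul_comm := mul_comm
  star_eq x := by simp; ring
  star_mul_self x := rfl
  pos x hx := by simpa using mul_self_pos.2 hx
  orthonormal i j := by simp [Subsingleton.elim i j]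
  expand x := by simp

/-- Complex conjugation on `ℂ`. -/
def complex : Conjugation ℂ Complex.reLm where
  d := 2
  e := ![1, Complex.I]
  finrank_eq := Complex.finrank_real_complex
  re_one := rfl
  re_mul_comm x y := by rw [mul_comm]
  star_eq x := by apply Complex.ext <;> simp; ring
  star_mul_self x := by apply Complex.ext <;> simp; ring
  pos x hx := by
    simpa [Complex.normSq_apply] using Complex.normSq_pos.2 hx
  orthonormal i j := by fin_cases i <;> fin_cases j <;> simp
  expand x := by apply Complex.ext <;> simp [Fin.sum_univ_two]

theorem quaternion_reₗ (x : ℍ[ℝ]) :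
    (show ℍ[ℝ] →ₗ[ℝ] ℝ from QuaternionAlgebra.reₗ (-1 : ℝ) 0 (-1)) x = x.re := rfl

/-- The basis `1, i, j, k` of `ℍ`. -/
def quaternionBasis (k : Fin 4) : ℍ[ℝ] :=
  ⟨if k = 0 then 1 else 0, if k = 1 then 1 else 0, if k = 2 then 1 else 0, if k = 3 then 1 else 0⟩

theorem re_quaternionBasis (k : Fin 4) : (quaternionBasis k).re = if k = 0 then 1 else 0 := rfl

theorem imI_quaternionBasis (k : Fin 4) : (quaternionBasis k).imI = if k = 1 then 1 else 0 := rfl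

theorem imJ_quaternionBasis (k : Fin 4) : (quaternionBasis k).imJ = if k = 2 then 1 else 0 := rfl

theorem imK_quaternionBasis (k : Fin 4) : (quaternionBasis k).imK = if k = 3 then 1 else 0 := rfl

/-- Quaternionic conjugation on `ℍ`. -/
def quaternion : Conjugation ℍ[ℝ] (show ℍ[ℝ] →ₗ[ℝ] ℝ from QuaternionAlgebra.reₗ (-1 : ℝ) 0 (-1)) where
  d := 4
  e := quaternionBasis
  finrank_eq := Quaternion.finrank_eq_four
  re_one := rfl
  re_mul_comm x y := by simp [quaternion_reₗ]; ring
  star_eq x := by ext <;> simp [quaternion_reₗ]; ring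
  star_mul_self x := by ext <;> simp [quaternion_reₗ] <;> ring
  pos x hx := by
    have := lt_of_le_of_ne Quaternion.normSq_nonneg (Quaternion.normSq_ne_zero.2 hx).symm
    rw [Quaternion.normSq_def'] at this
    simp [quaternion_reₗ]
    nlinarith
  orthonormal i j := by
    rw [quaternion_reₗ]
    fin_cases i <;> fin_cases j <;> simp [re_quaternionBasis, imI_quaternionBasis,
      imJ_quaternionBasis, imK_quaternionBasis]
  expand x := by
    ext <;> simp [Fin.sum_univ_four, quaternion_reₗ, re_quaternionBasis, imI_quaternionBasis,
      imJ_quaternionBasis, imK_quaternionBasis]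

end Conjugation

/-- The laws of `H^𝔻_{n,μ}`. -/
def stdCertificate (D : DivAlg) (n : ℕ) {μ : ℝ} (hμ : μ ≠ 0) :
    EquippedData.Certificate.{0, 0, 0, 0} (stdData D n μ) :=
  match D with
  | .real => Conjugation.real.matrixLaws n hμ
  | .complex => Conjugation.complex.matrixLaws n hμ
  | .quaternion => Conjugation.quaternion.matrixLaws n hμ

theorem isSemisimple_matrixData (D : Type v) [DivisionRing D] [Algebra ℝ D] [StarRing D]
    [StarModule ℝ D] [Module.Finite ℝ D] (re : D →ₗ[ℝ] ℝ) (n : ℕ) (μ : ℝ) :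
    (matrixData D re n μ).IsSemisimple := by
  constructor
  · change IsSemisimpleRing (Subalgebra.center ℝ D)
    have : IsArtinianRing (Subalgebra.center ℝ D) := isArtinian_of_tower ℝ inferInstance
    exact IsArtinianRing.isSemisimpleRing_of_isReduced _
  · change IsSemisimpleRing (Matrix (Fin n) (Fin n) D)
    infer_instance

theorem isSemisimple_stdData (D : DivAlg) (n : ℕ) (μ : ℝ) : (stdData D n μ).IsSemisimple :=
  match D with
  | .real => isSemisimple_matrixData ℝ _ n μ
  | .complex => isSemisimple_matrixData ℂ _ n μ
  | .quaternion => isSemisimple_matrixData ℍ[ℝ] _ n μ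

/-! ### Invariant forms and adjoints -/

section Form

variable {G : Type u} [Group G] {V : Type v} [AddCommGroup V] [Module ℝ V]

/-- The form is the standard dot product in a basis, summed over the translates by `G`; the term of
`1 ∈ G` already makes it definite. -/
theorem exists_posDef_invariantForm [Fintype G] [FiniteDimensional ℝ V]
    (ρ : Representation ℝ G V) :
    ∃ β : InvariantForm ρ, ∀ x, x ≠ 0 → 0 < β.form x x := by
  let b := Module.finBasis ℝ V
  let f : LinearMap.BilinForm ℝ V := ∑ g : G, ∑ i,
    (LinearMap.mul ℝ ℝ).compl₁₂ (b.coord i ∘ₗ ρ g) (b.coord i ∘ₗ ρ g)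
  have hf (x y : V) : f x y = ∑ g : G, ∑ i, b.coord i (ρ g x) * b.coord i (ρ g y) := by
    simp [f, LinearMap.sum_apply]
  have hsymm (x y : V) : f x y = f y x := by
    simp only [hf, mul_comm]
  have hpos (x : V) (hx : x ≠ 0) : 0 < f x x := by
    rw [hf]
    refine Finset.sum_pos' (fun g _ => Finset.sum_nonneg fun i _ => mul_self_nonneg _)
      ⟨1, Finset.mem_univ _, ?_⟩
    obtain ⟨i, hi⟩ : ∃ i, b.coord i x ≠ 0 := by
      by_contra! h
      exact hx (b.ext_elem fun i => by simpa using h i)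
    refine Finset.sum_pos' (fun i _ => mul_self_nonneg _) ⟨i, Finset.mem_univ _, ?_⟩
    simpa using mul_self_pos.2 hi
  have hsep : f.SeparatingLeft := fun x hx => by
    by_contra h
    exact (hpos x h).ne' (hx x)
  refine ⟨⟨f, ⟨hsymm⟩, ⟨hsep, fun y hy => hsep y fun x => by rw [hsymm, hy]⟩, fun h x y => ?_⟩, hpos⟩
  simp only [hf]
  refine Fintype.sum_equiv (Equiv.mulRight h) _ _ fun g => ?_
  simp

variable {ρ : Representation ℝ G V} [FiniteDimensional ℝ V]

namespace InvariantForm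

theorem form_comm (β : InvariantForm ρ) (x y : V) : β.form x y = β.form y x := β.symm.eq x y

theorem eq_of_form_eq (β : InvariantForm ρ) {x y : V} (h : ∀ w, β.form x w = β.form y w) :
    x = y := by
  rw [← sub_eq_zero]
  exact β.nondegenerate.1 _ fun w => by simp [h]

theorem eq_adjoint (β : InvariantForm ρ) {x y : Module.End ℝ V}
    (h : ∀ v w, β.form (y v) w = β.form v (x w)) : y = β.adjoint x :=
  LinearMap.ext fun v => β.eq_of_form_eq fun w => by rw [h, β.form_adjoint]

theorem adjoint_adjoint (β : InvariantForm ρ) (x : Module.End ℝ V) :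
    β.adjoint (β.adjoint x) = x :=
  (β.eq_adjoint fun v w => by rw [form_comm, ← β.form_adjoint, form_comm]).symm

theorem adjoint_mul (β : InvariantForm ρ) (x y : Module.End ℝ V) :
    β.adjoint (x * y) = β.adjoint y * β.adjoint x :=
  (β.eq_adjoint fun v w => by simp [form_adjoint]).symm

theorem adjoint_one (β : InvariantForm ρ) : β.adjoint 1 = 1 :=
  (β.eq_adjoint fun v w => by simp).symm

theorem adjoint_apply_group (β : InvariantForm ρ) (g : G) : β.adjoint (ρ g) = ρ g⁻¹ :=
  (β.eq_adjoint fun v w => by rw [← β.invariant g]; simp).symm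

theorem adjoint_asAlgebraHom (β : InvariantForm ρ) (x : MonoidAlgebra ℝ G) :
    β.adjoint (ρ.asAlgebraHom x) = ρ.asAlgebraHom (HopfAlgebra.antipode ℝ x) := by
  induction x using MonoidAlgebra.induction_linear with
  | zero => simp
  | add x y hx hy => simp [hx, hy]
  | single g a => simp [Representation.asAlgebraHom_single, adjoint_apply_group]

theorem trace_adjoint (β : InvariantForm ρ) (x : Module.End ℝ V) :
    LinearMap.trace ℝ V (β.adjoint x) = LinearMap.trace ℝ V x := by
  simp only [adjoint, LinearMap.comp_apply, LinearEquiv.coe_coe]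
  rw [LinearMap.trace_conj', LinearMap.trace_transpose']

end InvariantForm

end Form

/-! ### Averaging linear maps over the group -/

section Average

variable {G : Type u} [Group G] [Fintype G] {W : Type v} [AddCommGroup W] [Module ℝ W]
  {W' : Type w} [AddCommGroup W'] [Module ℝ W']

/-- The sum `∑ σ(g) X π(g)⁻¹`. -/
def groupSum (π : Representation ℝ G W) (σ : Representation ℝ G W') :
    (W →ₗ[ℝ] W') →ₗ[ℝ] W →ₗ[ℝ] W' where
  toFun X := ∑ g, σ g ∘ₗ X ∘ₗ π g⁻¹
  map_add' X Y := by simp [LinearMap.add_comp, LinearMap.comp_add, Finset.sum_add_distrib]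
  map_smul' r X := by simp [LinearMap.smul_comp, LinearMap.comp_smul, Finset.smul_sum]

theorem groupSum_apply (π : Representation ℝ G W) (σ : Representation ℝ G W') (X : W →ₗ[ℝ] W')
    (v : W) : groupSum π σ X v = ∑ g, σ g (X (π g⁻¹ v)) := by
  simp [groupSum, LinearMap.sum_apply]

theorem groupSum_comp (π : Representation ℝ G W) (σ : Representation ℝ G W') (X : W →ₗ[ℝ] W')
    (h : G) : groupSum π σ X ∘ₗ π h = σ h ∘ₗ groupSum π σ X := by
  ext v
  simp only [LinearMap.comp_apply, groupSum_apply, map_sum]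
  refine Fintype.sum_equiv (Equiv.mulLeft h⁻¹) _ _ fun g => ?_
  simp

theorem groupSum_mem_endG (π : Representation ℝ G W) (X : Module.End ℝ W) :
    groupSum π π X ∈ EndG π := by
  rw [Subalgebra.mem_centralizer_iff]
  rintro _ ⟨g, rfl⟩
  exact (groupSum_comp π π X g).symm

end Average

/-! ### Representations with a given algebra of endomorphisms -/

section Typed

variable {G : Type u} [Group G] {W : Type v} [AddCommGroup W] [Module ℝ W] [FiniteDimensional ℝ W]
  {π : Representation ℝ G W} {D : Type w} [DivisionRing D] [Algebra ℝ D] [StarRing D]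
  [StarModule ℝ D] {re : D →ₗ[ℝ] ℝ}

/-- The action of `𝔻` on `W` given by an isomorphism `End_G(W) ≅ 𝔻`. -/
def divAction (E : EndG π ≃ₐ[ℝ] D) : D →ₐ[ℝ] Module.End ℝ W :=
  (EndG π).val.comp E.symm.toAlgHom

theorem divAction_mem (E : EndG π ≃ₐ[ℝ] D) (x : D) : divAction E x ∈ EndG π := (E.symm x).2

theorem divAction_apply (E : EndG π ≃ₐ[ℝ] D) (f : EndG π) : divAction E (E f) = f := by
  simp [divAction]

theorem divAction_comm (E : EndG π ≃ₐ[ℝ] D) (x : D) (g : G) :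
    π g * divAction E x = divAction E x * π g :=
  (Subalgebra.mem_centralizer_iff ℝ).1 (divAction_mem E x) _ ⟨g, rfl⟩

namespace Conjugation

theorem mul_self_of_re_eq_zero (C : Conjugation D re) {x : D} (hx : re x = 0) :
    x * x = -algebraMap ℝ D (re (star x * x)) := by
  have h : star x = -x := by rw [C.star_eq, hx]; simp
  rw [← C.star_mul_self, h]
  simp

/-- A positive involution of `𝔻` is the conjugation. -/
theorem eq_star_of_positive (C : Conjugation D re) (s : D →ₗ[ℝ] D) (s_invol : ∀ x, s (s x) = x)
    (s_mul : ∀ x y, s (x * y) = s y * s x)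
    (s_pos : ∀ x, s x = x → ∀ r : ℝ, x * x = algebraMap ℝ D r → 0 ≤ r) (x : D) :
    s x = star x := by
  have s_one : s 1 = 1 := by
    have := s_mul 1 (s 1)
    rwa [one_mul, s_invol, one_mul, eq_comm] at this
  have s_alg (r : ℝ) : s (algebraMap ℝ D r) = algebraMap ℝ D r := by
    rw [Algebra.algebraMap_eq_smul_one, map_smul, s_one]
  -- First `s` preserves purely imaginary elements. The square of `s x` is real because `x²` is; if
  -- `Re (s x) ≠ 0`, the quadratic equation of `s x` makes `s x` real, hence `x = s (s x)` real with
  -- real part zero, so `s x` would be zero.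
  have key (x : D) (hx : re x = 0) : s x = -x := by
    have hy0 : re (s x) = 0 := by
      by_contra hy
      have h1 : s x * s x = -algebraMap ℝ D (re (star x * x)) := by
        rw [← s_mul, C.mul_self_of_re_eq_zero hx, map_neg, s_alg]
      have h2 : star (s x) = algebraMap ℝ D (2 * re (s x)) - s x := C.star_eq _
      have h3 := C.star_mul_self (s x)
      rw [h2, sub_mul, h1, sub_neg_eq_add, ← eq_sub_iff_add_eq, ← map_sub] at h3
      set c := 2 * re (s x) with hc
      have hc0 : c ≠ 0 := mul_ne_zero two_ne_zero hy
      obtain ⟨q, hq⟩ : ∃ q : ℝ, algebraMap ℝ D c * s x = algebraMap ℝ D q := ⟨_, h3⟩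
      have h4 : ∃ r : ℝ, s x = algebraMap ℝ D r := by
        refine ⟨c⁻¹ * q, ?_⟩
        rw [map_mul, ← hq, ← mul_assoc, ← map_mul, inv_mul_cancel₀ hc0, map_one, one_mul]
      obtain ⟨r, hr⟩ := h4
      have h5 : x = algebraMap ℝ D r := by rw [← s_invol x, hr, s_alg]
      rw [hr, ← h5, hx] at hy
      exact hy rfl
    -- Now `x + s x` is `s`-symmetric and purely imaginary; if nonzero, its square is a negative
    -- real, against positivity.
    by_contra hne
    have hz : x + s x ≠ 0 := fun h => hne (eq_neg_of_add_eq_zero_right h)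
    have hzre : re (x + s x) = 0 := by rw [map_add, hx, hy0, add_zero]
    have h1 := C.mul_self_of_re_eq_zero hzre
    rw [← map_neg] at h1
    have h2 := s_pos (x + s x) (by rw [map_add, s_invol, add_comm]) _ h1
    have h3 := C.pos _ hz
    linarith
  have hx : x = algebraMap ℝ D (re x) + (x - algebraMap ℝ D (re x)) := by abel
  conv_lhs => rw [hx]
  rw [map_add, s_alg, key _ (by rw [map_sub, C.re_algebraMap, sub_self]), C.star_eq, two_mul,
    map_add]
  abel

/-- The adjoint with respect to a positive definite invariant form corresponds to conjugation. -/
theorem adjoint_divAction (C : Conjugation D re) [Nontrivial W] (E : EndG π ≃ₐ[ℝ] D)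
    (β : InvariantForm π) (hβ : ∀ x, x ≠ 0 → 0 < β.form x x) (x : D) :
    β.adjoint (divAction E x) = divAction E (star x) := by
  let s : D →ₗ[ℝ] D := E.toLinearMap ∘ₗ β.adjointG ∘ₗ E.symm.toLinearMap
  have hs (x : D) : divAction E (s x) = β.adjoint (divAction E x) := by
    change divAction E (E (β.adjointG (E.symm x))) = _
    rw [divAction_apply]
    rfl
  have hinj : Function.Injective (divAction E) := (divAction E).toRingHom.injective
  rw [← hs, C.eq_star_of_positive s]
  · exact fun x => hinj (by rw [hs, hs, β.adjoint_adjoint])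
  · exact fun x y => hinj (by rw [hs, map_mul (divAction E), β.adjoint_mul, map_mul (divAction E), hs, hs])
  · intro x hx r hr
    obtain ⟨v, hv⟩ := exists_ne (0 : W)
    -- Self-adjointness and `x² = r` give `β(x v, x v) = r β(v, v)`, so `r ≥ 0` by definiteness.
    have h1 : β.form (divAction E x v) (divAction E x v) = r * β.form v v := by
      have h0 : β.adjoint (divAction E x) = divAction E x := by rw [← hs, hx]
      calc β.form (divAction E x v) (divAction E x v) =
          β.form (β.adjoint (divAction E x) v) (divAction E x v) := by rw [h0]
        _ = β.form v (divAction E (x * x) v) := by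
          rw [β.form_adjoint, map_mul, Module.End.mul_apply]
        _ = r * β.form v v := by
          rw [hr, AlgHom.commutes, Module.algebraMap_end_apply, map_smul, smul_eq_mul]
    have h2 : 0 ≤ β.form (divAction E x v) (divAction E x v) := by
      by_cases h : divAction E x v = 0
      · simp [h]
      · exact (hβ _ h).le
    rw [h1] at h2
    exact nonneg_of_mul_nonneg_left h2 (hβ v hv)

/-- An operator and its adjoint have equal traces, and the adjoint of `x` is `2 Re x - x`; hence
twice the trace is `2 Re x · dim W`. -/
theorem trace_divAction (C : Conjugation D re) [Nontrivial W] (E : EndG π ≃ₐ[ℝ] D)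
    (β : InvariantForm π) (hβ : ∀ x, x ≠ 0 → 0 < β.form x x) (x : D) :
    LinearMap.trace ℝ W (divAction E x) = Module.finrank ℝ W * re x := by
  have h1 := β.trace_adjoint (divAction E x)
  rw [C.adjoint_divAction E β hβ, C.star_eq, map_sub, map_sub, AlgHom.commutes,
    Algebra.algebraMap_eq_smul_one, map_smul, LinearMap.trace_one, smul_eq_mul] at h1
  linarith

end Conjugation

end Typed

/-! ### Frobenius–Schur count and character elements -/

section Typed

variable {G : Type u} [Group G] [Fintype G] {W : Type v} [AddCommGroup W] [Module ℝ W]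
  [FiniteDimensional ℝ W]
  {π : Representation ℝ G W} {D : Type w} [DivisionRing D] [Algebra ℝ D] [StarRing D]
  [StarModule ℝ D] {re : D →ₗ[ℝ] ℝ}

/-- As `a` commutes with `π(g)`, cyclicity of the trace removes the conjugation by `π(g)` from every
summand. -/
theorem trace_mul_groupSum (π : Representation ℝ G W) {a : Module.End ℝ W} (ha : a ∈ EndG π)
    (X : Module.End ℝ W) :
    LinearMap.trace ℝ W (a * groupSum π π X) = Fintype.card G * LinearMap.trace ℝ W (a * X) := by
  have h (g : G) : LinearMap.trace ℝ W (a * (π g ∘ₗ X ∘ₗ π g⁻¹)) =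
      LinearMap.trace ℝ W (a * X) := by
    have hc : π g * a = a * π g := (Subalgebra.mem_centralizer_iff ℝ).1 ha _ ⟨g, rfl⟩
    have h1 : a * (π g ∘ₗ X ∘ₗ π g⁻¹) = π g * (a * X * π g⁻¹) := by
      simp only [← Module.End.mul_eq_comp, ← mul_assoc, hc]
    rw [h1, LinearMap.trace_mul_comm, mul_assoc, ← map_mul, inv_mul_cancel, map_one, mul_one]
  have h2 : groupSum π π X = ∑ g, π g ∘ₗ X ∘ₗ π g⁻¹ := rfl
  rw [h2, Finset.mul_sum, map_sum, Finset.sum_congr rfl fun g _ => h g]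
  simp

namespace Conjugation

variable [Nontrivial W]

theorem finrank_ne_zero : (Module.finrank ℝ W : ℝ) ≠ 0 := by
  exact_mod_cast (Module.finrank_pos (R := ℝ) (M := W)).ne'

/-- Averaging over the group is the orthogonal projection onto `End_G(W) ≅ 𝔻`. -/
theorem groupSum_eq (C : Conjugation D re) (E : EndG π ≃ₐ[ℝ] D) (X : Module.End ℝ W) :
    groupSum π π X = ((Fintype.card G : ℝ) / Module.finrank ℝ W) •
      ∑ k, LinearMap.trace ℝ W (divAction E (star (C.e k)) * X) • divAction E (C.e k) := by
  obtain ⟨β, hβ⟩ := exists_posDef_invariantForm π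
  have hm := finrank_ne_zero (W := W)
  have h0 : groupSum π π X = divAction E (E ⟨groupSum π π X, groupSum_mem_endG π X⟩) := by
    rw [divAction_apply]
  set x := E ⟨groupSum π π X, groupSum_mem_endG π X⟩ with hx
  -- The average lies in `End_G(W) ≅ 𝔻`, so it is determined by its coordinates `Re (ē_k x)`. These
  -- are traces divided by `dim W`, and under the trace the average becomes `|G|` times `X`.
  have h1 (k : Fin C.d) : re (star (C.e k) * x) = ((Fintype.card G : ℝ) / Module.finrank ℝ W) *
      LinearMap.trace ℝ W (divAction E (star (C.e k)) * X) := by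
    have h2 := C.trace_divAction E β hβ (star (C.e k) * x)
    rw [map_mul, ← h0, trace_mul_groupSum π (divAction_mem E _)] at h2
    field_simp
    rw [h2, mul_comm]
  rw [h0, ← C.expand x]
  simp only [map_sum, map_smul, h1, Finset.smul_sum, smul_smul]

/-- `∑ g²` acts on an irreducible representation as the scalar `(2 - d) |G| / dim`. -/
theorem sum_mul_self (C : Conjugation D re) (E : EndG π ≃ₐ[ℝ] D) :
    ∑ g, π g * π g =
      algebraMap ℝ (Module.End ℝ W) ((2 - C.d) * Fintype.card G / Module.finrank ℝ W) := by
  obtain ⟨β, hβ⟩ := exists_posDef_invariantForm π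
  classical
  let b := Module.finBasis ℝ W
  let b' := β.form.dualBasis β.nondegenerate b
  have hexp (u : W) : ∑ i, β.form u (b' i) • b i = u := by
    conv_rhs => rw [← b.sum_repr u]
    refine Finset.sum_congr rfl fun i _ => ?_
    congr 1
    rw [← β.form.dualBasis_dualBasis β.nondegenerate β.symm b,
      LinearMap.BilinForm.dualBasis_repr_apply]
  have hexp' (u : W) : ∑ i, β.form u (b i) • b' i = u := by
    conv_rhs => rw [← b'.sum_repr u]
    simp [b']
  ext v
  -- For dual bases `b`, `b'`, invariance gives `π(g)² v = ∑_i β(v, π(g)⁻¹ b'_i) π(g) b_i`. With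
  -- `X_i = β(v, ·) b_i` this is `∑_i π(g) X_i π(g)⁻¹ b'_i`, so the sum over `g` is an average of
  -- the kind just computed.
  let X (i : Fin (Module.finrank ℝ W)) : Module.End ℝ W := (β.form v).smulRight (b i)
  have h1 : (∑ g, π g * π g) v = ∑ i, groupSum π π (X i) (b' i) := by
    simp only [groupSum_apply, LinearMap.sum_apply, Module.End.mul_apply]
    rw [Finset.sum_comm]
    refine Finset.sum_congr rfl fun g _ => ?_
    conv_lhs => rw [← hexp (π g v)]
    rw [map_sum]
    refine Finset.sum_congr rfl fun i _ => ?_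
    rw [← β.invariant g⁻¹]
    simp [X]
  rw [h1]
  have h2 (k : Fin C.d) (i) : LinearMap.trace ℝ W (divAction E (star (C.e k)) * X i) =
      β.form (divAction E (C.e k) v) (b i) := by
    have : divAction E (star (C.e k)) * X i =
        (β.form v).smulRight (divAction E (star (C.e k)) (b i)) := by
      ext; simp [X]
    rw [this, LinearMap.trace_smulRight, ← C.adjoint_divAction E β hβ, β.form_comm,
      β.form_adjoint, β.form_comm]
  have h3 (i) : groupSum π π (X i) (b' i) = ((Fintype.card G : ℝ) / Module.finrank ℝ W) •
      ∑ k, divAction E (C.e k) (β.form (divAction E (C.e k) v) (b i) • b' i) := by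
    rw [C.groupSum_eq E]
    simp [LinearMap.sum_apply, h2]
  simp only [h3]
  rw [← Finset.smul_sum, Finset.sum_comm]
  simp only [← map_sum, hexp', ← Module.End.mul_apply, ← map_mul]
  -- Resumming over the dual bases has left `(|G| / dim W) ∑ e_k² v`, and `∑ e_k² = 2 - d`.
  have h4 := congrArg (fun x => divAction E x v) C.sum_e_mul_e
  simp only [map_sum, LinearMap.sum_apply, AlgHom.commutes, Module.algebraMap_end_apply] at h4
  rw [h4, smul_smul, Module.algebraMap_end_apply]
  congr 1
  ring

variable (π) in
/-- The element `∑ tr(z π(g)⁻¹) g` of the group algebra. -/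
def characterElement (z : Module.End ℝ W) : MonoidAlgebra ℝ G :=
  ∑ g, MonoidAlgebra.single g (LinearMap.trace ℝ W (z * π g⁻¹))

theorem characterElement_coeff_one (z : Module.End ℝ W) :
    (characterElement π z).coeff 1 = LinearMap.trace ℝ W z := by
  classical
  simp [characterElement, MonoidAlgebra.coeff_sum, Finsupp.finsetSum_apply, Finsupp.single_apply]

/-- Writing the trace as a sum over a basis exhibits the action on any `σ` as averages of rank-one
maps `W → W'`. These averages are intertwiners, so Schur's lemma applies when `σ` and `π` are not
isomorphic. -/
theorem asAlgebraHom_characterElement_apply {W' : Type v'} [AddCommGroup W'] [Module ℝ W']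
    (σ : Representation ℝ G W') (z : Module.End ℝ W) (v : W') :
    σ.asAlgebraHom (characterElement π z) v =
      ∑ i, groupSum π σ (((Module.finBasis ℝ W).coord i ∘ₗ z).smulRight v)
        (Module.finBasis ℝ W i) := by
  simp only [characterElement, map_sum, LinearMap.sum_apply, Representation.asAlgebraHom_single,
    groupSum_apply]
  rw [Finset.sum_comm]
  refine Finset.sum_congr rfl fun g _ => ?_
  rw [LinearMap.trace_eq_matrix_trace ℝ (Module.finBasis ℝ W), Matrix.trace]
  simp [LinearMap.toMatrix_apply, Finset.sum_smul]

/-- The averages give `(|G| / dim W) ∑ e_k z ē_k`, and each of the `d` terms equals `z` because `z`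
is central and `e_k ē_k = 1`. -/
theorem asAlgebraHom_characterElement_self (C : Conjugation D re) (E : EndG π ≃ₐ[ℝ] D)
    {z : D} (hz : z ∈ Subalgebra.center ℝ D) :
    π.asAlgebraHom (characterElement π (divAction E z)) =
      ((C.d : ℝ) * Fintype.card G / Module.finrank ℝ W) • divAction E z := by
  ext v
  rw [asAlgebraHom_characterElement_apply]
  let b := Module.finBasis ℝ W
  have h2 (k : Fin C.d) (i) : LinearMap.trace ℝ W (divAction E (star (C.e k)) *
      (b.coord i ∘ₗ divAction E z).smulRight v) =
      b.repr (divAction E (z * star (C.e k)) v) i := by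
    have : divAction E (star (C.e k)) * (b.coord i ∘ₗ divAction E z).smulRight v =
        (b.coord i ∘ₗ divAction E z).smulRight (divAction E (star (C.e k)) v) := by
      ext; simp
    rw [this, LinearMap.trace_smulRight, map_mul]
    simp
  have h3 (i) : groupSum π π ((b.coord i ∘ₗ divAction E z).smulRight v) (b i) =
      ((Fintype.card G : ℝ) / Module.finrank ℝ W) • ∑ k, divAction E (C.e k)
        (b.repr (divAction E (z * star (C.e k)) v) i • b i) := by
    rw [C.groupSum_eq E]
    simp only [LinearMap.smul_apply, LinearMap.sum_apply, h2, map_smul]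
  rw [Finset.sum_congr rfl fun i _ => h3 i, ← Finset.smul_sum, Finset.sum_comm]
  have h4 (k : Fin C.d) : C.e k * (z * star (C.e k)) = z := by
    rw [← mul_assoc, Subalgebra.mem_center_iff.1 hz, mul_assoc, C.e_mul_star_e, mul_one]
  have h5 (k : Fin C.d) : ∑ i, divAction E (C.e k)
      (b.repr (divAction E (z * star (C.e k)) v) i • b i) = divAction E z v := by
    rw [← map_sum, b.sum_repr, ← Module.End.mul_apply, ← map_mul, h4]
  rw [Finset.sum_congr rfl fun k _ => h5 k, Finset.sum_const, Finset.card_univ, Fintype.card_fin,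
    LinearMap.smul_apply, ← Nat.cast_smul_eq_nsmul ℝ, smul_smul]
  congr 1
  ring

end Conjugation

end Typed

/-! ### Frobenius' theorem for algebras with a positive involution -/

section Frobenius

variable {F : Type v} [Ring F] [Algebra ℝ F] [Nontrivial F]

/-- A real algebra with a positive involution, all of whose symmetric elements are real, is
isomorphic to `ℝ`, `ℂ` or `ℍ`. -/
theorem nonempty_algEquiv_of_positive (s : F →ₗ[ℝ] F) (s_invol : ∀ x, s (s x) = x)
    (s_mul : ∀ x y, s (x * y) = s y * s x)
    (s_real : ∀ x, s x = x → ∃ r : ℝ, x = algebraMap ℝ F r)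
    (s_pos : ∀ x, x ≠ 0 → ∀ r : ℝ, s x * x = algebraMap ℝ F r → 0 < r) :
    Nonempty (F ≃ₐ[ℝ] ℝ) ∨ Nonempty (F ≃ₐ[ℝ] ℂ) ∨ Nonempty (F ≃ₐ[ℝ] ℍ[ℝ]) := by
  have decomp (x : F) : ∃ (r : ℝ) (y : F), s y = -y ∧ x = r • 1 + y := by
    obtain ⟨r, hr⟩ := s_real (x + s x) (by rw [map_add, s_invol, add_comm])
    rw [Algebra.algebraMap_eq_smul_one] at hr
    refine ⟨r / 2, (1 / 2 : ℝ) • (x - s x), ?_, ?_⟩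
    · rw [map_smul, map_sub, s_invol, ← smul_neg, neg_sub]
    · rw [div_eq_inv_mul, mul_smul, ← hr, ← one_div, ← smul_add]
      rw [add_add_sub_cancel, ← two_smul ℝ x, smul_smul]
      norm_num
  have normalize (x : F) (hx : s x = -x) (hx0 : x ≠ 0) :
      ∃ (c : ℝ) (y : F), y = c • x ∧ s y = -y ∧ y * y = -1 := by
    obtain ⟨r, hr⟩ := s_real (s x * x) (by rw [s_mul, s_invol])
    have hpos := s_pos x hx0 r hr
    refine ⟨(√r)⁻¹, _, rfl, by rw [map_smul, hx, smul_neg], ?_⟩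
    rw [hx, neg_mul, neg_eq_iff_eq_neg] at hr
    rw [smul_mul_smul_comm, hr, ← mul_inv, Real.mul_self_sqrt hpos.le, smul_neg,
      Algebra.algebraMap_eq_smul_one, smul_smul, inv_mul_cancel₀ hpos.ne', one_smul]
  -- The anticommutator of two skew elements is symmetric, hence real; it plays the role of an inner
  -- product on the skew part.
  have anti (i y : F) (hi : s i = -i) (hy : s y = -y) :
      ∃ r : ℝ, i * y + y * i = r • 1 := by
    obtain ⟨r, hr⟩ := s_real (i * y + y * i) (by
      rw [map_add, s_mul, s_mul, hi, hy, neg_mul_neg, neg_mul_neg, add_comm])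
    exact ⟨r, by rw [hr, Algebra.algebraMap_eq_smul_one]⟩
  by_cases h1 : ∀ x : F, s x = -x → x = 0
  · refine .inl ⟨(AlgEquiv.ofBijective (Algebra.ofId ℝ F)
      ⟨(algebraMap ℝ F).injective, fun x => ?_⟩).symm⟩
    obtain ⟨r, y, hy, rfl⟩ := decomp x
    exact ⟨r, by rw [h1 y hy, add_zero, Algebra.ofId_apply, Algebra.algebraMap_eq_smul_one]⟩
  push Not at h1
  obtain ⟨x, hx, hx0⟩ := h1
  obtain ⟨-, i, -, hi, hii⟩ := normalize x hx hx0
  have reduce (y : F) (hy : s y = -y) :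
      ∃ (a : ℝ) (z : F), s z = -z ∧ i * z + z * i = 0 ∧ y = a • i + z := by
    obtain ⟨r, hr⟩ := anti i y hi hy
    refine ⟨-(r / 2), (r / 2) • i + y, ?_, ?_, by rw [neg_smul]; abel⟩
    · rw [map_add, map_smul, hi, hy, smul_neg, neg_add]
    · have : i * ((r / 2) • i + y) + ((r / 2) • i + y) * i =
          (r / 2 + r / 2) • (i * i) + (i * y + y * i) := by
        rw [mul_add, add_mul, mul_smul_comm, smul_mul_assoc, add_smul]
        abel
      rw [this, hr, hii, add_halves, smul_neg, neg_add_cancel]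
  by_cases h2 : ∀ z : F, s z = -z → i * z + z * i = 0 → z = 0
  · refine .inr (.inl ⟨(AlgEquiv.ofBijective (Complex.lift ⟨i, hii⟩)
      ⟨(Complex.lift ⟨i, hii⟩).toRingHom.injective, fun x => ?_⟩).symm⟩)
    obtain ⟨r, y, hy, rfl⟩ := decomp x
    obtain ⟨a, z, hz, hiz, rfl⟩ := reduce y hy
    refine ⟨⟨r, a⟩, ?_⟩
    rw [h2 z hz hiz, add_zero, Complex.lift_apply, Complex.liftAux_apply,
      Algebra.algebraMap_eq_smul_one]
  push Not at h2
  obtain ⟨x', hx', hix', hx0'⟩ := h2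
  obtain ⟨c, j, hj', hj, hjj⟩ := normalize x' hx' hx0'
  have hij : j * i = -(i * j) := by
    rw [eq_neg_iff_add_eq_zero, hj', mul_smul_comm, smul_mul_assoc, ← smul_add, add_comm, hix',
      smul_zero]
  let q : QuaternionAlgebra.Basis F (-1 : ℝ) 0 (-1) :=
    { i := i, j := j, k := i * j, i_mul_i := by simp [hii], j_mul_j := by simp [hjj],
      i_mul_j := rfl, j_mul_i := by simp [hij] }
  have hk : s (i * j) = -(i * j) := by rw [s_mul, hi, hj, neg_mul_neg, hij]
  have hkk : i * j * (i * j) = -1 := by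
    rw [mul_assoc, ← mul_assoc j, hij, neg_mul, mul_assoc i, hjj]
    simp [hii]
  let Q : ℍ[ℝ] →ₐ[ℝ] F := QuaternionAlgebra.lift q
  refine .inr (.inr ⟨(AlgEquiv.ofBijective Q
      ⟨(Q : ℍ[ℝ] →+* F).injective, fun x => ?_⟩).symm⟩)
  obtain ⟨r, y, hy, rfl⟩ := decomp x
  obtain ⟨a, ha⟩ := anti i y hi hy
  obtain ⟨b, hb⟩ := anti j y hj hy
  obtain ⟨c, hc⟩ := anti (i * j) y hk hy
  -- Here `y` loses its components along `i`, `j`, `ij`: since each of these squares to `-1`, adding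
  -- half the anticommutator times the unit makes the remainder anticommute with all three.
  set z := y + (a / 2) • i + (b / 2) • j + (c / 2) • (i * j) with hz
  have hiij : i * (i * j) = -j := by rw [← mul_assoc, hii, neg_one_mul]
  have hiji : i * j * i = j := by rw [mul_assoc, hij, mul_neg, hiij, neg_neg]
  have hijj : i * j * j = -i := by rw [mul_assoc, hjj, mul_neg_one]
  have hjij : j * (i * j) = i := by rw [← mul_assoc, hij, neg_mul, hijj, neg_neg]
  have half (t : ℝ) : t • (1 : F) = (t / 2) • 1 + (t / 2) • 1 := by rw [← add_smul, add_halves]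
  have hzi : i * z = -(z * i) := by
    rw [eq_neg_iff_add_eq_zero, hz]
    simp only [mul_add, add_mul, mul_smul_comm, smul_mul_assoc, hii, hij, hiij, hiji, smul_neg]
    rw [half] at ha
    rw [← sub_eq_zero] at ha
    rw [← ha]
    abel
  have hzj : j * z = -(z * j) := by
    rw [eq_neg_iff_add_eq_zero, hz]
    simp only [mul_add, add_mul, mul_smul_comm, smul_mul_assoc, hjj, hij, hijj, hjij, smul_neg]
    rw [half] at hb
    rw [← sub_eq_zero] at hb
    rw [← hb]
    abel
  have hzk : i * j * z = -(z * (i * j)) := by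
    rw [eq_neg_iff_add_eq_zero, hz]
    simp only [mul_add, add_mul, mul_smul_comm, smul_mul_assoc, hkk, hiji, hijj, hiij, hjij,
      smul_neg]
    rw [half] at hc
    rw [← sub_eq_zero] at hc
    rw [← hc]
    abel
  -- Anticommuting with `i` and with `j` means commuting with `ij`. As `z` also anticommutes with
  -- the invertible `ij`, it is zero.
  have hzk' : i * j * z = z * (i * j) := by
    rw [mul_assoc, hzj, mul_neg, ← mul_assoc, hzi, neg_mul, neg_neg, mul_assoc]
  have hz0 : z = 0 := by
    rw [hzk', eq_neg_iff_add_eq_zero, ← two_smul ℝ, smul_eq_zero] at hzk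
    have := congrArg (fun t => t * (i * j)) (hzk.resolve_left two_ne_zero)
    simpa [mul_assoc z, hkk] using this
  refine ⟨⟨r, -(a / 2), -(b / 2), -(c / 2)⟩, ?_⟩
  change algebraMap ℝ F r + (-(a / 2)) • i + (-(b / 2)) • j + (-(c / 2)) • (i * j) = _
  rw [Algebra.algebraMap_eq_smul_one]
  have : y = -((a / 2) • i) - (b / 2) • j - (c / 2) • (i * j) := by
    rw [← sub_eq_zero, ← hz0, hz]
    abel
  rw [this]
  simp only [neg_smul]
  abel

end Frobenius

/-! ### Schur's lemma and the types of irreducible representations -/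

section Schur

variable {G : Type u} [Group G] {W : Type v} [AddCommGroup W] [Module ℝ W]
  {W' : Type w} [AddCommGroup W'] [Module ℝ W']

theorem bijective_or_eq_zero_of_irreducible {π : Representation ℝ G W} {σ : Representation ℝ G W'}
    (hπ : π.IsIrreducible) (hσ : σ.IsIrreducible) (f : W →ₗ[ℝ] W')
    (hf : ∀ g, f ∘ₗ π g = σ g ∘ₗ f) : Function.Bijective f ∨ f = 0 := by
  rcases Representation.IsIrreducible.bijective_or_eq_zero
    (⟨f, hf⟩ : Representation.IntertwiningMap π σ) with h | h
  · exact .inl h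
  · exact .inr (congrArg Representation.IntertwiningMap.toLinearMap h)

theorem nontrivial_of_irreducible {π : Representation ℝ G W} (hπ : π.IsIrreducible) :
    Nontrivial W := by
  have : IsSimpleModule (MonoidAlgebra ℝ G) π.asModule := inferInstance
  exact IsSimpleModule.nontrivial (MonoidAlgebra ℝ G) π.asModule

/-- A real spectral theorem for irreducible representations: a self-adjoint operator has no
irreducible quadratic factor in its minimal polynomial, and by Schur's lemma a linear factor already
annihilates an intertwiner. -/
theorem exists_algebraMap_of_adjoint_eq [FiniteDimensional ℝ W] {π : Representation ℝ G W}
    (hπ : π.IsIrreducible) (β : InvariantForm π) (hβ : ∀ x, x ≠ 0 → 0 < β.form x x)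
    (f : Module.End ℝ W) (hf : f ∈ EndG π) (hs : β.adjoint f = f) :
    ∃ r : ℝ, f = algebraMap ℝ _ r := by
  have hW := nontrivial_of_irreducible hπ
  have comm (h : Module.End ℝ W) (hh : h ∈ EndG π) : Function.Bijective h ∨ h = 0 :=
    bijective_or_eq_zero_of_irreducible hπ hπ h fun g =>
      ((Subalgebra.mem_centralizer_iff ℝ).1 hh _ ⟨g, rfl⟩).symm
  have hint : IsIntegral ℝ f := Algebra.IsIntegral.isIntegral f
  obtain ⟨z, hz⟩ := IsAlgClosed.exists_aeval_eq_zero ℂ (minpoly ℝ f)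
    (minpoly.degree_pos hint).ne'
  -- `p(f)` is an intertwiner, so it is zero or bijective. In the latter case `q(f) = 0`,
  -- contradicting minimality of the degree.
  have factor (p q : Polynomial ℝ) (hp : minpoly ℝ f = p * q) (hd : 0 < p.natDegree) :
      Polynomial.aeval f p = 0 := by
    have hmem : Polynomial.aeval f p ∈ EndG π :=
      Algebra.adjoin_le (Set.singleton_subset_iff.2 hf)
        (Polynomial.aeval_mem_adjoin_singleton ℝ f)
    refine (comm _ hmem).resolve_left fun hb => ?_
    have h0 : Polynomial.aeval f p * Polynomial.aeval f q = 0 := by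
      rw [← map_mul, ← hp, minpoly.aeval]
    have hq : Polynomial.aeval f q = 0 := by
      ext v
      exact hb.1 (by simpa using LinearMap.congr_fun h0 v)
    have hne := minpoly.ne_zero hint
    have hq0 : q ≠ 0 := by rintro rfl; exact hne (by simpa using hp)
    have hp0 : p ≠ 0 := by rintro rfl; simp at hd
    have h1 := Polynomial.natDegree_le_of_dvd (minpoly.dvd ℝ f hq) hq0
    rw [hp, Polynomial.natDegree_mul hp0 hq0] at h1
    omega
  by_cases him : z.im = 0
  · have hzr : z = algebraMap ℝ ℂ z.re := Complex.ext rfl (by simpa using him)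
    rw [hzr, Polynomial.aeval_algebraMap_apply, map_eq_zero_iff _ (algebraMap ℝ ℂ).injective,
      Polynomial.coe_aeval_eq_eval] at hz
    obtain ⟨q, hq⟩ := Polynomial.dvd_iff_isRoot.2 hz
    have := factor _ _ hq (by simp)
    rw [map_sub, Polynomial.aeval_X, Polynomial.aeval_C, sub_eq_zero] at this
    exact ⟨_, this⟩
  -- A non-real root `z` gives `(f - Re z)² = -(Im z)²`; evaluated on `v`, the vector `y = (f - Re
  -- z) v` would satisfy `β(y, y) = -(Im z)² β(v, v) < 0`.
  · exfalso
    obtain ⟨q, hq⟩ := Polynomial.quadratic_dvd_of_aeval_eq_zero_im_ne_zero _ hz him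
    have hdeg : (Polynomial.X ^ 2 - Polynomial.C (2 * z.re) * Polynomial.X +
        Polynomial.C (‖z‖ ^ 2)).natDegree = 2 := by compute_degree!
    have h1 := factor _ _ hq (by rw [hdeg]; norm_num)
    simp only [map_add, map_sub, map_mul, map_pow, Polynomial.aeval_X, Polynomial.aeval_C] at h1
    obtain ⟨v, hv⟩ := exists_ne (0 : W)
    have h2 := congrArg (fun t => β.form v t) (LinearMap.congr_fun h1 v)
    have hn : ‖z‖ ^ 2 = z.re ^ 2 + z.im ^ 2 := by
      rw [← Complex.normSq_eq_norm_sq, Complex.normSq_apply]; ring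
    rw [← map_pow, ← map_mul, hn] at h2
    simp only [pow_two, LinearMap.add_apply, LinearMap.sub_apply, Module.End.mul_apply,
      Module.algebraMap_end_apply, map_add, map_sub, map_smul, LinearMap.zero_apply, map_zero,
      smul_eq_mul] at h2
    have h3 : β.form v (f (f v)) = β.form (f v) (f v) := by rw [← β.form_adjoint, hs]
    set y := f v - z.re • v with hy
    have h4 : β.form y y = β.form (f v) (f v) - 2 * z.re * β.form v (f v) +
        z.re * z.re * β.form v v := by
      rw [hy]
      simp only [map_sub, LinearMap.sub_apply, map_smul, LinearMap.smul_apply, smul_eq_mul,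
        β.form_comm (f v) v]
      ring
    have h5 : 0 ≤ β.form y y := by
      by_cases h : y = 0
      · simp [h]
      · exact (hβ y h).le
    have h6 : 0 < z.im * z.im * β.form v v := mul_pos (mul_self_pos.2 him) (hβ v hv)
    rw [h3] at h2
    nlinarith

/-- The algebra of endomorphisms of an irreducible real representation of a finite group is
`ℝ`, `ℂ` or `ℍ`. -/
theorem nonempty_endG_algEquiv [Fintype G] [FiniteDimensional ℝ W] {π : Representation ℝ G W}
    (hπ : π.IsIrreducible) : Nonempty (EndG π ≃ₐ[ℝ] ℝ) ∨ Nonempty (EndG π ≃ₐ[ℝ] ℂ) ∨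
      Nonempty (EndG π ≃ₐ[ℝ] ℍ[ℝ]) := by
  obtain ⟨β, hβ⟩ := exists_posDef_invariantForm π
  have hW := nontrivial_of_irreducible hπ
  refine nonempty_algEquiv_of_positive β.adjointG (fun x => Subtype.ext (β.adjoint_adjoint _))
    (fun x y => Subtype.ext (β.adjoint_mul _ _)) (fun x hx => ?_) (fun x hx r hr => ?_)
  · obtain ⟨r, hr⟩ := exists_algebraMap_of_adjoint_eq hπ β hβ x x.2 (congrArg Subtype.val hx)
    exact ⟨r, Subtype.ext hr⟩
  · obtain ⟨v, hv⟩ : ∃ v, (x : Module.End ℝ W) v ≠ 0 := by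
      by_contra! h
      exact hx (Subtype.ext (LinearMap.ext h))
    have h1 : (β.adjoint (x : Module.End ℝ W) * x) v = r • v :=
      LinearMap.congr_fun (congrArg Subtype.val hr) v
    have h2 : β.form ((x : Module.End ℝ W) v) ((x : Module.End ℝ W) v) = r * β.form v v := by
      rw [← smul_eq_mul, ← LinearMap.smul_apply, ← map_smul, ← h1, Module.End.mul_apply,
        β.form_adjoint]
    have hv0 : v ≠ 0 := by rintro rfl; simp at hv
    exact pos_of_mul_pos_left (h2 ▸ hβ _ hv) (hβ v hv0).le

theorem Irr.exists_hasType [Fintype G] (π : Irr G) : ∃ D, π.HasType D := by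
  rcases nonempty_endG_algEquiv (π := π.rep) π.out.irr with h | h | h
  exacts [⟨.real, h⟩, ⟨.complex, h⟩, ⟨.quaternion, h⟩]

/-- The dimension of a real division algebra. -/
def DivAlg.dim : DivAlg → ℕ
  | .real => 1
  | .complex => 2
  | .quaternion => 4

theorem Irr.HasType.finrank_eq {π : Irr G} {D : DivAlg} (h : π.HasType D) :
    Module.finrank ℝ (EndG π.rep) = D.dim := by
  cases D with
  | real => exact (LinearEquiv.finrank_eq h.some.toLinearEquiv).trans (Module.finrank_self ℝ)
  | complex =>
    exact (LinearEquiv.finrank_eq h.some.toLinearEquiv).trans Complex.finrank_real_complex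
  | quaternion =>
    exact (LinearEquiv.finrank_eq h.some.toLinearEquiv).trans
      (QuaternionAlgebra.finrank_eq_four _ _ _)

theorem Irr.HasType.unique {π : Irr G} {D D' : DivAlg} (h : π.HasType D) (h' : π.HasType D') :
    D = D' := by
  have := h.finrank_eq.symm.trans h'.finrank_eq
  cases D <;> cases D' <;> first | rfl | simp [DivAlg.dim] at this

/-- The dimensions 1, 2, 4 of `End_G(π)` separate the types, so the double sum over `𝔻` and
`Ir_𝔻(G)` counts no representation twice. -/
theorem TypedIrr.ext_irr {p q : TypedIrr G} (h : p.2.1 = q.2.1) : p = q := by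
  obtain ⟨D, π, hπ⟩ := p
  obtain ⟨D', σ, hσ⟩ := q
  obtain rfl : π = σ := h
  obtain rfl : D = D' := hπ.unique hσ
  rfl

theorem Irr.nontrivial (π : Irr G) : Nontrivial (Fin π.dim → ℝ) :=
  nontrivial_of_irreducible (π := π.rep) π.out.irr

theorem Irr.eq_zero_of_ne {π σ : Irr G} (h : π ≠ σ) (f : (Fin π.dim → ℝ) →ₗ[ℝ] Fin σ.dim → ℝ)
    (hf : ∀ g, f ∘ₗ π.rep g = σ.rep g ∘ₗ f) : f = 0 := by
  refine (bijective_or_eq_zero_of_irreducible π.out.irr σ.out.irr f hf).resolve_left fun hb => h ?_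
  have : π.out ≈ σ.out :=
    ⟨(⟨f, hf⟩ : Representation.IntertwiningMap π.rep σ.rep).ofBijective hb⟩
  rw [← Quotient.out_eq π, ← Quotient.out_eq σ]
  exact Quotient.sound this

end Schur

/-! ### Decomposition into irreducible representations -/

section Decomposition

variable {G : Type u} [Group G]

/-- A basis transports the module to some `ℝ^m`, and the result is then compared with the chosen
representative of its class. -/
theorem exists_irr_of_isSimpleModule (M : Type v) [AddCommGroup M] [Module ℝ M]
    [Module (MonoidAlgebra ℝ G) M] [IsScalarTower ℝ (MonoidAlgebra ℝ G) M] [Module.Finite ℝ M]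
    [IsSimpleModule (MonoidAlgebra ℝ G) M] :
    ∃ (π : Irr G) (e : M ≃ₗ[ℝ] (Fin π.dim → ℝ)),
      ∀ (x : MonoidAlgebra ℝ G) (v : M), e (x • v) = π.rep.asAlgebraHom x (e v) := by
  let b : M ≃ₗ[ℝ] (Fin (Module.finrank ℝ M) → ℝ) := (Module.finBasis ℝ M).equivFun
  let σ : Representation ℝ G (Fin (Module.finrank ℝ M) → ℝ) :=
    (b.conjAlgEquiv ℝ).toAlgHom.toMonoidHom.comp (Representation.ofModule' M)
  have hσ (x : MonoidAlgebra ℝ G) (v : M) : b (x • v) = σ.asAlgebraHom x (b v) := by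
    induction x using MonoidAlgebra.induction_linear with
    | zero => simp
    | add x y hx hy => simp [add_smul, hx, hy]
    | single g a =>
      rw [Representation.asAlgebraHom_single]
      have : MonoidAlgebra.single g a = a • MonoidAlgebra.single g (1 : ℝ) := by simp
      rw [this, smul_assoc, map_smul]
      simp [σ, Representation.ofModule']
  let E : M ≃ₗ[MonoidAlgebra ℝ G] σ.asModule :=
    { toFun := b, invFun := b.symm, left_inv := b.left_inv, right_inv := b.right_inv,
      map_add' := b.map_add, map_smul' := hσ }
  have hirr : σ.IsIrreducible := by
    rw [Representation.irreducible_iff_isSimpleModule_asModule]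
    exact IsSimpleModule.congr E.symm
  let p : IrrRep G := ⟨_, σ, hirr⟩
  obtain ⟨f⟩ : p ≈ Quotient.out (Quotient.mk _ p) := Setoid.symm (Quotient.mk_out p)
  have hf (x : MonoidAlgebra ℝ G) (v) :
      f (σ.asAlgebraHom x v) = (Quotient.out (Quotient.mk _ p)).rep.asAlgebraHom x (f v) := by
    induction x using MonoidAlgebra.induction_linear with
    | zero => simp
    | add x y hx hy => simp [hx, hy]
    | single g a =>
      simp only [Representation.asAlgebraHom_single, LinearMap.smul_apply, map_smul]
      congr 1
      exact f.toIntertwiningMap.isIntertwining _ _ g v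
  exact ⟨Quotient.mk _ p, b.trans f.toLinearEquiv, fun x v => by
    refine (congrArg f (hσ x v)).trans (hf x (b v))⟩

/-- By Maschke's theorem `ℝ[G]` is a direct sum of simple modules; `x` kills each of them, in
particular `x = x · 1 = 0`. This lets identities in `ℝ[G]` be checked on irreducible
representations. -/
theorem eq_zero_of_forall_irr [Fintype G] (x : MonoidAlgebra ℝ G)
    (hx : ∀ π : Irr G, π.rep.asAlgebraHom x = 0) : x = 0 := by
  have : NeZero (Nat.card G : ℝ) := ⟨by exact_mod_cast Nat.card_pos.ne'⟩
  obtain ⟨s, e, -, hs⟩ := IsSemisimpleModule.exists_linearEquiv_dfinsupp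
    (MonoidAlgebra ℝ G) (MonoidAlgebra ℝ G)
  refine e.map_eq_zero_iff.1 ?_
  rw [← mul_one x, ← smul_eq_mul, map_smul]
  ext m : 1
  have := hs m
  have : Module.Finite ℝ (m : Submodule (MonoidAlgebra ℝ G) (MonoidAlgebra ℝ G)) :=
    Module.Finite.of_injective
      ((m : Submodule (MonoidAlgebra ℝ G) (MonoidAlgebra ℝ G)).subtype.restrictScalars ℝ)
      Subtype.val_injective
  obtain ⟨π, f, hf⟩ := exists_irr_of_isSimpleModule (G := G)
    (m : Submodule (MonoidAlgebra ℝ G) (MonoidAlgebra ℝ G))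
  refine f.map_eq_zero_iff.1 ?_
  rw [DFinsupp.smul_apply, hf, hx, LinearMap.zero_apply]

theorem exists_equiv_sumRep [Fintype G] {V : Type v} [AddCommGroup V] [Module ℝ V]
    [FiniteDimensional ℝ V] (ρ : Representation ℝ G V) :
    ∃ n : Irr G → ℕ, Nonempty (ρ.Equiv (sumRep n)) := by
  have : NeZero (Nat.card G : ℝ) := ⟨by exact_mod_cast Nat.card_pos.ne'⟩
  have : Module.Finite (MonoidAlgebra ℝ G) ρ.asModule := Module.Finite.of_restrictScalars_finite ℝ _ _
  obtain ⟨k, S, e, hs⟩ := IsSemisimpleModule.exists_linearEquiv_fin_dfinsupp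
    (MonoidAlgebra ℝ G) ρ.asModule
  have hfin (i : Fin k) : Module.Finite ℝ (S i) :=
    Module.Finite.of_injective ((S i).subtype.restrictScalars ℝ) Subtype.val_injective
  choose p f hf using fun i => exists_irr_of_isSimpleModule (G := G) (S i)
  classical
  have := Fintype.ofFinite (Irr G)
  -- The multiplicity of `π` is the number of simple summands in its class; `q` lists all summands
  -- class by class.
  let n (π : Irr G) : ℕ := Fintype.card {i // p i = π}
  let q : (Σ π : Irr G, Fin (n π)) ≃ Fin k :=
    (Equiv.sigmaCongrRight fun π => (Fintype.equivFin {i // p i = π}).symm).trans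
      (Equiv.sigmaFiberEquiv p)
  have hq (x : Σ π : Irr G, Fin (n π)) : p (q x) = x.1 :=
    ((Fintype.equivFin {i // p i = x.1}).symm x.2).2
  have key (x : Σ π : Irr G, Fin (n π)) : ∃ h : S (q x) ≃ₗ[ℝ] (Fin x.1.dim → ℝ),
      ∀ (g : MonoidAlgebra ℝ G) (v : S (q x)), h (g • v) = x.1.rep.asAlgebraHom g (h v) := by
    rw [← hq x]
    exact ⟨f _, hf _⟩
  choose h hh using key
  let E : V ≃ₗ[ℝ] DirectSum (Σ π : Irr G, Fin (n π)) fun p => Fin p.1.dim → ℝ :=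
    ρ.asModuleEquiv.symm ≪≫ₗ e.restrictScalars ℝ ≪≫ₗ DFinsupp.linearEquivFunOnFintype ≪≫ₗ
      (LinearEquiv.piCongrLeft ℝ (fun i => S i) q).symm ≪≫ₗ LinearEquiv.piCongrRight h ≪≫ₗ
      (DirectSum.linearEquivFunOnFintype ℝ _ _).symm
  have hE (v : V) (x) : E v x = h x (e (ρ.asModuleEquiv.symm v) (q x)) := rfl
  refine ⟨n, ⟨.mk E fun g => ?_⟩⟩
  ext v x : 2
  have hv : ρ.asModuleEquiv.symm (ρ g v) =
      MonoidAlgebra.of ℝ G g • ρ.asModuleEquiv.symm v := ρ.asModuleEquiv_symm_map_rho g v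
  change E (ρ g v) x = x.1.rep g (E v x)
  rw [hE, hE, hv, map_smul, DFinsupp.smul_apply, hh, Representation.asAlgebraHom_of]

end Decomposition

/-! ### Intertwiners as block matrices, and the orthogonal sum form -/

section Blocks

variable {G : Type u} [Group G] {V : Type v} [AddCommGroup V] [Module ℝ V]

/-- Inclusions and projections exhibiting `ρ` as the direct sum of `n_π` copies of each `π`. -/
structure Blocks [Fintype (Irr G)] (ρ : Representation ℝ G V) (n : Irr G → ℕ) where
  incl : ∀ π : Irr G, Fin (n π) → (Fin π.dim → ℝ) →ₗ[ℝ] V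
  proj : ∀ π : Irr G, Fin (n π) → V →ₗ[ℝ] (Fin π.dim → ℝ)
  incl_comm : ∀ π i g, ρ g ∘ₗ incl π i = incl π i ∘ₗ π.rep g
  proj_comm : ∀ π i g, proj π i ∘ₗ ρ g = π.rep g ∘ₗ proj π i
  proj_incl : ∀ π i, proj π i ∘ₗ incl π i = LinearMap.id
  proj_incl_ne : ∀ π i j, i ≠ j → proj π i ∘ₗ incl π j = 0
  sum_incl_proj : ∑ π, ∑ i, incl π i ∘ₗ proj π i = LinearMap.id

theorem nonempty_blocks [Fintype (Irr G)] {ρ : Representation ℝ G V} {n : Irr G → ℕ}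
    (e : ρ.Equiv (sumRep n)) : Nonempty (Blocks ρ n) := by
  classical
  have he (g : G) (v : V) : e.toLinearEquiv (ρ g v) = sumRep n g (e.toLinearEquiv v) :=
    e.toIntertwiningMap.isIntertwining _ _ g v
  have he' (g : G) (v) : e.toLinearEquiv.symm (sumRep n g v) = ρ g (e.toLinearEquiv.symm v) := by
    rw [LinearEquiv.symm_apply_eq, he, LinearEquiv.apply_symm_apply]
  let J := Σ π : Irr G, Fin (n π)
  let W (a : J) : Type := Fin a.1.dim → ℝ
  refine ⟨{
    incl := fun π i => e.toLinearEquiv.symm.toLinearMap ∘ₗ DirectSum.lof ℝ J W ⟨π, i⟩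
    proj := fun π i => DirectSum.component ℝ J W ⟨π, i⟩ ∘ₗ e.toLinearEquiv.toLinearMap
    incl_comm := fun π i g => ?_
    proj_comm := fun π i g => ?_
    proj_incl := fun π i => ?_
    proj_incl_ne := fun π i j h => ?_
    sum_incl_proj := ?_ }⟩
  · refine LinearMap.ext fun v => ?_
    change ρ g (e.toLinearEquiv.symm (DirectSum.lof ℝ J W ⟨π, i⟩ v)) =
      e.toLinearEquiv.symm (DirectSum.lof ℝ J W ⟨π, i⟩ (π.rep g v))
    rw [← he']
    congr 1
    exact DirectSum.lmap_lof (f := fun p : J => p.1.rep g) ⟨π, i⟩ v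
  · refine LinearMap.ext fun v => ?_
    change e.toLinearEquiv (ρ g v) ⟨π, i⟩ = _
    rw [he]
    rfl
  · refine LinearMap.ext fun v => ?_
    change DirectSum.component ℝ J W ⟨π, i⟩
      (e.toLinearEquiv (e.toLinearEquiv.symm (DirectSum.lof ℝ J W ⟨π, i⟩ v))) = v
    rw [LinearEquiv.apply_symm_apply, DirectSum.component.lof_self]
  · refine LinearMap.ext fun v => ?_
    change DirectSum.component ℝ J W ⟨π, i⟩
      (e.toLinearEquiv (e.toLinearEquiv.symm (DirectSum.lof ℝ J W ⟨π, j⟩ v))) = 0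
    rw [LinearEquiv.apply_symm_apply, DirectSum.component.of, dif_neg]
    exact fun hh => h (eq_of_heq (Sigma.mk.inj_iff.1 hh).2).symm
  · refine LinearMap.ext fun v => ?_
    have h := congrArg e.toLinearEquiv.symm (DirectSum.sum_univ_of (e.toLinearEquiv v))
    rw [LinearEquiv.symm_apply_apply, map_sum, Fintype.sum_sigma] at h
    simp only [LinearMap.sum_apply]
    exact h

namespace Blocks

variable [Fintype (Irr G)] {ρ : Representation ℝ G V} {n : Irr G → ℕ} (P : Blocks ρ n)

theorem block_comm {b : Module.End ℝ V} (hb : b ∈ EndG ρ) (π σ : Irr G) (i : Fin (n π))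
    (j : Fin (n σ)) (g : G) :
    (P.proj π i ∘ₗ b ∘ₗ P.incl σ j) ∘ₗ σ.rep g = π.rep g ∘ₗ (P.proj π i ∘ₗ b ∘ₗ P.incl σ j) := by
  have hc : ρ g ∘ₗ b = b ∘ₗ ρ g := (Subalgebra.mem_centralizer_iff ℝ).1 hb _ ⟨g, rfl⟩
  calc (P.proj π i ∘ₗ b ∘ₗ P.incl σ j) ∘ₗ σ.rep g =
      P.proj π i ∘ₗ b ∘ₗ P.incl σ j ∘ₗ σ.rep g := rfl
    _ = P.proj π i ∘ₗ (b ∘ₗ ρ g) ∘ₗ P.incl σ j := by rw [← P.incl_comm]; rfl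
    _ = (P.proj π i ∘ₗ ρ g) ∘ₗ b ∘ₗ P.incl σ j := by rw [← hc]; rfl
    _ = _ := by rw [P.proj_comm]; rfl

theorem block_mem {b : Module.End ℝ V} (hb : b ∈ EndG ρ) (π : Irr G) (i j : Fin (n π)) :
    P.proj π i ∘ₗ b ∘ₗ P.incl π j ∈ EndG π.rep := by
  rw [Subalgebra.mem_centralizer_iff]
  rintro _ ⟨g, rfl⟩
  exact (P.block_comm hb π π i j g).symm

theorem block_eq_zero {b : Module.End ℝ V} (hb : b ∈ EndG ρ) {π σ : Irr G} (h : π ≠ σ)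
    (i : Fin (n π)) (j : Fin (n σ)) : P.proj π i ∘ₗ b ∘ₗ P.incl σ j = 0 :=
  Irr.eq_zero_of_ne h.symm _ fun g => P.block_comm hb π σ i j g

theorem proj_incl_of_ne {π σ : Irr G} (h : π ≠ σ) (i : Fin (n π)) (j : Fin (n σ)) :
    P.proj π i ∘ₗ P.incl σ j = 0 :=
  P.block_eq_zero (one_mem (EndG ρ)) h i j

/-- Blocks between different classes vanish by Schur's lemma, so the blocks inside the classes
determine an intertwiner. -/
theorem eq_zero_of_block_eq_zero {b : Module.End ℝ V} (hb : b ∈ EndG ρ)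
    (h : ∀ π i j, P.proj π i ∘ₗ b ∘ₗ P.incl π j = 0) : b = 0 := by
  have h1 (π σ : Irr G) (i : Fin (n π)) (j : Fin (n σ)) :
      P.proj π i ∘ₗ b ∘ₗ P.incl σ j = 0 := by
    by_cases hn : π = σ
    · subst hn
      exact h π i j
    · exact P.block_eq_zero hb hn i j
  calc b = (∑ π, ∑ i, P.incl π i ∘ₗ P.proj π i) ∘ₗ b ∘ₗ
      ∑ σ, ∑ j, P.incl σ j ∘ₗ P.proj σ j := by
        rw [P.sum_incl_proj, LinearMap.id_comp, LinearMap.comp_id]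
    _ = ∑ σ, ∑ j, ∑ π, ∑ i, P.incl π i ∘ₗ (P.proj π i ∘ₗ b ∘ₗ P.incl σ j) ∘ₗ P.proj σ j := by
        refine LinearMap.ext fun v => ?_
        simp only [LinearMap.comp_apply, LinearMap.sum_apply, map_sum]
    _ = 0 := by simp [h1]

/-- Inserting the resolution of the identity between the factors gives a sum over all classes, of
which Schur's lemma leaves only `π`. -/
theorem block_mul {b b' : Module.End ℝ V} (hb' : b' ∈ EndG ρ) (π : Irr G)
    (i j : Fin (n π)) : P.proj π i ∘ₗ (b * b') ∘ₗ P.incl π j =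
      ∑ k, (P.proj π i ∘ₗ b ∘ₗ P.incl π k) ∘ₗ (P.proj π k ∘ₗ b' ∘ₗ P.incl π j) := by
  classical
  calc P.proj π i ∘ₗ (b * b') ∘ₗ P.incl π j =
      P.proj π i ∘ₗ b ∘ₗ (∑ σ, ∑ k, P.incl σ k ∘ₗ P.proj σ k) ∘ₗ b' ∘ₗ P.incl π j := by
        rw [P.sum_incl_proj, LinearMap.id_comp]
        rfl
    _ = ∑ σ, ∑ k, (P.proj π i ∘ₗ b ∘ₗ P.incl σ k) ∘ₗ (P.proj σ k ∘ₗ b' ∘ₗ P.incl π j) := by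
        refine LinearMap.ext fun v => ?_
        simp only [LinearMap.comp_apply, LinearMap.sum_apply, map_sum]
    _ = _ := by
        refine Finset.sum_eq_single π (fun σ _ h => ?_) (by simp)
        refine Finset.sum_eq_zero fun k _ => ?_
        rw [P.block_eq_zero hb' h, LinearMap.comp_zero]

theorem asAlgebraHom_incl (π : Irr G) (i : Fin (n π)) (x : MonoidAlgebra ℝ G) :
    ρ.asAlgebraHom x ∘ₗ P.incl π i = P.incl π i ∘ₗ π.rep.asAlgebraHom x := by
  induction x using MonoidAlgebra.induction_linear with
  | zero => simp
  | add x y hx hy => simp [LinearMap.add_comp, LinearMap.comp_add, hx, hy]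
  | single g a =>
    simp [Representation.asAlgebraHom_single, LinearMap.smul_comp, LinearMap.comp_smul,
      P.incl_comm]

/-- The orthogonal sum of forms on the blocks. -/
def blockForm (β : ∀ π : Irr G, InvariantForm π.rep) : LinearMap.BilinForm ℝ V :=
  ∑ π, ∑ i, (β π).form.compl₁₂ (P.proj π i) (P.proj π i)

theorem blockForm_apply (β : ∀ π : Irr G, InvariantForm π.rep) (v w : V) :
    P.blockForm β v w = ∑ π, ∑ i, (β π).form (P.proj π i v) (P.proj π i w) := by
  simp [blockForm, LinearMap.sum_apply]

theorem blockForm_pos [Fintype G] (β : ∀ π : Irr G, InvariantForm π.rep)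
    (hβ : ∀ π x, x ≠ 0 → 0 < (β π).form x x) (v : V) (hv : v ≠ 0) : 0 < P.blockForm β v v := by
  have h0 (π : Irr G) (x) : 0 ≤ (β π).form x x := by
    by_cases h : x = 0
    · simp [h]
    · exact (hβ π x h).le
  obtain ⟨π, i, hi⟩ : ∃ π i, P.proj π i v ≠ 0 := by
    by_contra! h
    refine hv ?_
    have := LinearMap.congr_fun P.sum_incl_proj v
    simpa [LinearMap.sum_apply, h] using this.symm
  rw [blockForm_apply]
  refine Finset.sum_pos' (fun σ _ => Finset.sum_nonneg fun j _ => h0 _ _)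
    ⟨π, Finset.mem_univ _, ?_⟩
  exact Finset.sum_pos' (fun j _ => h0 _ _) ⟨i, Finset.mem_univ _, hβ π _ hi⟩

theorem blockForm_incl (β : ∀ π : Irr G, InvariantForm π.rep) (v : V) (π : Irr G) (i : Fin (n π))
    (w : Fin π.dim → ℝ) : P.blockForm β v (P.incl π i w) = (β π).form (P.proj π i v) w := by
  classical
  have h1 (σ : Irr G) (j : Fin (n σ)) (h : σ ≠ π) : P.proj σ j (P.incl π i w) = 0 :=
    LinearMap.congr_fun (P.proj_incl_of_ne h j i) w
  have h2 (j : Fin (n π)) (h : j ≠ i) : P.proj π j (P.incl π i w) = 0 :=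
    LinearMap.congr_fun (P.proj_incl_ne π j i h) w
  have h3 : P.proj π i (P.incl π i w) = w := LinearMap.congr_fun (P.proj_incl π i) w
  rw [blockForm_apply, Finset.sum_eq_single π, Finset.sum_eq_single i, h3]
  · intro j _ h
    rw [h2 j h, map_zero]
  · simp
  · intro σ _ h
    exact Finset.sum_eq_zero fun j _ => by rw [h1 σ j h, map_zero]
  · simp

/-- The orthogonal sum of positive definite invariant forms on the blocks. -/
def invariantForm [Fintype G] (β : ∀ π : Irr G, InvariantForm π.rep)
    (hβ : ∀ π x, x ≠ 0 → 0 < (β π).form x x) : InvariantForm ρ where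
  form := P.blockForm β
  symm := ⟨fun v w => by
    simp only [blockForm_apply, (β _).form_comm (P.proj _ _ v)]⟩
  nondegenerate := by
    refine ⟨fun v hv => ?_, fun v hv => ?_⟩ <;>
    · by_contra h
      exact (P.blockForm_pos β hβ v h).ne' (hv v)
  invariant g v w := by
    have h (π i v) : P.proj π i (ρ g v) = π.rep g (P.proj π i v) :=
      LinearMap.congr_fun (P.proj_comm π i g) v
    simp only [blockForm_apply, h, (β _).invariant]

/-- The blocks are mutually orthogonal, so the adjoint transposes block positions and takes adjoints
of entries. This is what becomes the conjugate transpose over `𝔻`. -/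
theorem proj_adjoint_incl [Fintype G] [FiniteDimensional ℝ V]
    (β : ∀ π : Irr G, InvariantForm π.rep)
    (hβ : ∀ π x, x ≠ 0 → 0 < (β π).form x x) (b : Module.End ℝ V) (π : Irr G) (i j : Fin (n π)) :
    P.proj π i ∘ₗ (P.invariantForm β hβ).adjoint b ∘ₗ P.incl π j =
      (β π).adjoint (P.proj π j ∘ₗ b ∘ₗ P.incl π i) := by
  refine (β π).eq_adjoint fun v w => ?_
  have h (v w) : (P.invariantForm β hβ).form v (P.incl π i w) =
    (β π).form (P.proj π i v) w := P.blockForm_incl β v π i w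
  have h' (v w) : (P.invariantForm β hβ).form v (P.incl π j w) =
    (β π).form (P.proj π j v) w := P.blockForm_incl β v π j w
  rw [LinearMap.comp_apply, LinearMap.comp_apply, ← h, InvariantForm.form_adjoint,
    InvariantForm.form_comm, h', InvariantForm.form_comm]
  rfl

end Blocks

end Blocks

/-! ### The projections of `H^ρ_μ` to its summands -/

section Component

variable {G : Type u} [Group G] [Fintype G] [Fintype (Irr G)]
  {V : Type v} [AddCommGroup V] [Module ℝ V] [FiniteDimensional ℝ V]
  {ρ : Representation ℝ G V} {n : Irr G → ℕ} {D : Type w} [DivisionRing D] [Algebra ℝ D]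
  [StarRing D] [StarModule ℝ D] {re : D →ₗ[ℝ] ℝ}

theorem divAction_injective {W : Type v'} [AddCommGroup W] [Module ℝ W]
    [FiniteDimensional ℝ W] {π : Representation ℝ G W} (E : EndG π ≃ₐ[ℝ] D) : Function.Injective (divAction E) :=
  Subtype.val_injective.comp E.symm.injective

theorem commute_asAlgebraHom {W : Type v'} [AddCommGroup W] [Module ℝ W]
    {π : Representation ℝ G W} {f : Module.End ℝ W} (hf : f ∈ EndG π) (x : MonoidAlgebra ℝ G) :
    π.asAlgebraHom x * f = f * π.asAlgebraHom x := by
  induction x using MonoidAlgebra.induction_linear with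
  | zero => simp
  | add x y hx hy => simp [add_mul, mul_add, hx, hy]
  | single g a =>
    have : π g * f = f * π g := (Subalgebra.mem_centralizer_iff ℝ).1 hf _ ⟨g, rfl⟩
    simp [Representation.asAlgebraHom_single, this]

/-- The action of the center of the group algebra on `π`, as a homomorphism to `Z(𝔻)`. -/
def centerHom {W : Type v'} [AddCommGroup W] [Module ℝ W]
    [FiniteDimensional ℝ W] {π : Representation ℝ G W}
    (E : EndG π ≃ₐ[ℝ] D) : ZGroupAlgebra G →ₐ[ℝ] Subalgebra.center ℝ D :=
  (E.toAlgHom.comp ((π.asAlgebraHom.comp (ZGroupAlgebra G).val).codRestrict (EndG π)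
    (asAlgebraHom_mem π))).codRestrict _ fun x => by
      rw [Subalgebra.mem_center_iff]
      intro d
      obtain ⟨f, rfl⟩ := E.surjective d
      change E f * E _ = E _ * E f
      rw [← map_mul, ← map_mul]
      exact congrArg E (Subtype.ext (commute_asAlgebraHom f.2 _).symm)

theorem divAction_centerHom {W : Type v'} [AddCommGroup W] [Module ℝ W]
    [FiniteDimensional ℝ W] {π : Representation ℝ G W}
    (E : EndG π ≃ₐ[ℝ] D) (x : ZGroupAlgebra G) :
    divAction E (centerHom E x : D) = π.asAlgebraHom (x : MonoidAlgebra ℝ G) :=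
  divAction_apply E ⟨_, asAlgebraHom_mem π x⟩

/-- The diagonal block of an intertwining operator that belongs to `π`, as a matrix over `𝔻`. -/
def Blocks.blockHom (P : Blocks ρ n) (π : Irr G) (E : EndG π.rep ≃ₐ[ℝ] D) :
    EndG ρ →ₐ[ℝ] Matrix (Fin (n π)) (Fin (n π)) D :=
  let f : EndG ρ →ₗ[ℝ] Matrix (Fin (n π)) (Fin (n π)) D :=
    { toFun := fun b => Matrix.of fun i j => E ⟨_, P.block_mem b.2 π i j⟩
      map_add' := fun b b' => by
        ext i j
        refine (congrArg E (Subtype.ext ?_)).trans (map_add E _ _)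
        change P.proj π i ∘ₗ ((b : Module.End ℝ V) + (b' : Module.End ℝ V)) ∘ₗ P.incl π j = _
        rw [LinearMap.add_comp, LinearMap.comp_add]
        rfl
      map_smul' := fun r b => by
        ext i j
        refine (congrArg E (Subtype.ext ?_)).trans (map_smul E r _)
        change P.proj π i ∘ₗ (r • (b : Module.End ℝ V)) ∘ₗ P.incl π j = _
        rw [LinearMap.smul_comp, LinearMap.comp_smul]
        rfl }
  have hf (b : EndG ρ) (i j : Fin (n π)) :
      divAction E (f b i j) = P.proj π i ∘ₗ (b : Module.End ℝ V) ∘ₗ P.incl π j :=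
    divAction_apply E ⟨_, P.block_mem b.2 π i j⟩
  AlgHom.ofLinearMap f
    (by
      ext i j
      refine divAction_injective E ?_
      rw [hf]
      by_cases h : i = j
      · subst h
        rw [Matrix.one_apply_eq, map_one]
        exact P.proj_incl π i
      · rw [Matrix.one_apply_ne h, map_zero]
        exact P.proj_incl_ne π i j h)
    (fun b b' => by
      ext i j
      refine divAction_injective E ?_
      rw [hf, Matrix.mul_apply, map_sum]
      simp only [map_mul, hf]
      exact P.block_mul b'.2 π i j)

theorem Blocks.divAction_blockHom (P : Blocks ρ n) (π : Irr G) (E : EndG π.rep ≃ₐ[ℝ] D)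
    (b : EndG ρ) (i j : Fin (n π)) :
    divAction E (P.blockHom π E b i j) = P.proj π i ∘ₗ (b : Module.End ℝ V) ∘ₗ P.incl π j :=
  divAction_apply E ⟨_, P.block_mem b.2 π i j⟩

open EquippedData in
/-- The projection of `H^ρ_μ` to the summand that belongs to `π`. -/
def Blocks.component (P : Blocks ρ n) (β : ∀ π : Irr G, InvariantForm π.rep)
    (hβ : ∀ π x, x ≠ 0 → 0 < (β π).form x x) (μ : (ZGroupAlgebra G)ˣ) (π : Irr G)
    {c : ℝ} (hc0 : c ≠ 0)
    (hc : π.rep.asAlgebraHom ((μ : ZGroupAlgebra G) : MonoidAlgebra ℝ G) = c • LinearMap.id)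
    (C : Conjugation D re) (E : EndG π.rep ≃ₐ[ℝ] D) :
    Component (repData ρ (P.invariantForm β hβ) μ)
      (matrixData D re (n π) (c * π.dim / Fintype.card G)) where
  fA := centerHom E
  fB := P.blockHom π E
  φ_eq := fun (a : ZGroupAlgebra G) => by
    change centerToMatrix D (n π) (centerHom E a) = P.blockHom π E ⟨_, asAlgebraHom_mem ρ a⟩
    refine Matrix.ext fun i j => divAction_injective E ?_
    rw [P.divAction_blockHom, P.asAlgebraHom_incl, ← LinearMap.comp_assoc]
    change divAction E (Matrix.diagonal (fun _ => (centerHom E a : D)) i j) = _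
    by_cases h : i = j
    · subst h
      rw [Matrix.diagonal_apply_eq, P.proj_incl, divAction_centerHom, LinearMap.id_comp]
    · rw [Matrix.diagonal_apply_ne _ h, P.proj_incl_ne π i j h, map_zero, LinearMap.zero_comp]
  U_eq := by
    have := π.nontrivial
    change centerHom E ((μ⁻¹ : (ZGroupAlgebra G)ˣ) * sumSquares G) =
      algebraMap ℝ _ ((2 - (Module.finrank ℝ D : ℝ)) / (c * π.dim / Fintype.card G))
    -- The Frobenius–Schur count meets the parameter here: dividing `(2 - d) |G| / dim π` by the
    -- scalar `c` of `μ` gives `(2 - d) / (c dim π / |G|)`.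
    have h1 : centerHom E (sumSquares G) =
        algebraMap ℝ _ ((2 - C.d) * Fintype.card G / π.dim) := by
      refine Subtype.ext (divAction_injective E ?_)
      have := C.sum_mul_self E
      rw [Module.finrank_fin_fun] at this
      change _ = divAction E (algebraMap ℝ D _)
      rw [divAction_centerHom, AlgHom.commutes, ← this]
      simp [sumSquares, Representation.asAlgebraHom_single, pow_two]
    have h2 : centerHom E μ = algebraMap ℝ _ c := by
      refine Subtype.ext (divAction_injective E ?_)
      change _ = divAction E (algebraMap ℝ D _)
      rw [divAction_centerHom, AlgHom.commutes, hc]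
      rfl
    have h3 : centerHom E ((μ⁻¹ : (ZGroupAlgebra G)ˣ) : ZGroupAlgebra G) =
        algebraMap ℝ _ c⁻¹ := by
      have h4 := congrArg (centerHom E) μ.mul_inv
      rw [map_mul, h2, map_one] at h4
      calc centerHom E ((μ⁻¹ : (ZGroupAlgebra G)ˣ) : ZGroupAlgebra G) =
          algebraMap ℝ _ c⁻¹ * (algebraMap ℝ _ c *
            centerHom E ((μ⁻¹ : (ZGroupAlgebra G)ˣ) : ZGroupAlgebra G)) := by
            rw [← mul_assoc, ← map_mul, inv_mul_cancel₀ hc0, map_one, one_mul]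
        _ = _ := by rw [h4, mul_one]
    rw [map_mul, h1, h3, ← map_mul, C.finrank_eq]
    congr 1
    field_simp
  starA_eq := fun (a : ZGroupAlgebra G) => by
    have := π.nontrivial
    change centerStar D (centerHom E a) = centerHom E (antipodeCenter G a)
    refine Subtype.ext (divAction_injective E ?_)
    rw [divAction_centerHom]
    change divAction E (star (centerHom E a : D)) =
      π.rep.asAlgebraHom (HopfAlgebra.antipode ℝ (a : MonoidAlgebra ℝ G))
    rw [← C.adjoint_divAction E (β π) (hβ π), divAction_centerHom,
      InvariantForm.adjoint_asAlgebraHom]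
  starB_eq := fun (b : EndG ρ) => by
    have := π.nontrivial
    change (P.blockHom π E b).conjTranspose =
      P.blockHom π E ((P.invariantForm β hβ).adjointG b)
    refine Matrix.ext fun i j => divAction_injective E ?_
    rw [P.divAction_blockHom, Matrix.conjTranspose_apply,
      ← C.adjoint_divAction E (β π) (hβ π), P.divAction_blockHom]
    exact (P.proj_adjoint_incl β hβ b π i j).symm

/-- The projections to the summands of `H^ρ_μ` split, compatibly with the linear forms. -/
theorem Blocks.exists_component (P : Blocks ρ n) (β : ∀ π : Irr G, InvariantForm π.rep)
    (hβ : ∀ π x, x ≠ 0 → 0 < (β π).form x x) (μ : (ZGroupAlgebra G)ˣ) {c : Irr G → ℝ}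
    (hc0 : ∀ π, c π ≠ 0)
    (hc : ∀ π : Irr G, π.rep.asAlgebraHom ((μ : ZGroupAlgebra G) : MonoidAlgebra ℝ G) =
      c π • LinearMap.id) (π : Irr G) (C : Conjugation D re) (E : EndG π.rep ≃ₐ[ℝ] D) :
    ∃ f : EquippedData.Component (repData ρ (P.invariantForm β hβ) μ)
      (matrixData D re (n π) (c π * π.dim / Fintype.card G)),
      (∀ a : ZGroupAlgebra G, f.fA a = 0 ↔ π.rep.asAlgebraHom (a : MonoidAlgebra ℝ G) = 0) ∧
      (∀ b : EndG ρ, f.fB b = 0 ↔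
        ∀ i j, P.proj π i ∘ₗ (b : Module.End ℝ V) ∘ₗ P.incl π j = 0) ∧
      (∀ a', ∃ a : ZGroupAlgebra G, f.fA a = a' ∧
        (∀ σ : Irr G, σ ≠ π → σ.rep.asAlgebraHom (a : MonoidAlgebra ℝ G) = 0) ∧
        (repData ρ (P.invariantForm β hβ) μ).lA a =
          (matrixData D re (n π) (c π * π.dim / Fintype.card G)).lA a') ∧
      (∀ b', ∃ b : EndG ρ, f.fB b = b' ∧
        (∀ σ : Irr G, σ ≠ π → ∀ i j,
          P.proj σ i ∘ₗ (b : Module.End ℝ V) ∘ₗ P.incl σ j = 0) ∧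
        (repData ρ (P.invariantForm β hβ) μ).lB b =
          (matrixData D re (n π) (c π * π.dim / Fintype.card G)).lB b') := by
  have := π.nontrivial
  have hm : (π.dim : ℝ) ≠ 0 := by simpa using Conjugation.finrank_ne_zero (W := Fin π.dim → ℝ)
  have hG : (Fintype.card G : ℝ) ≠ 0 := by exact_mod_cast Fintype.card_ne_zero
  refine ⟨P.component β hβ μ π (hc0 π) (hc π) C E, fun a => ?_, fun b => ?_, fun a' => ?_,
    fun b' => ?_⟩
  · change centerHom E a = 0 ↔ _
    rw [← divAction_centerHom E, map_eq_zero_iff _ (divAction_injective E),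
      ZeroMemClass.coe_eq_zero]
  · change P.blockHom π E b = 0 ↔ _
    rw [← Matrix.ext_iff]
    refine forall₂_congr fun i j => ?_
    rw [← P.divAction_blockHom π E, map_eq_zero_iff _ (divAction_injective E),
      Matrix.zero_apply]
  · change Subalgebra.center ℝ D at a'
    -- The coefficient is the inverse of the factor `d |G| / dim π` by which the character element
    -- acts on `π`.
    let x := ((π.dim : ℝ) / (C.d * Fintype.card G)) •
      Conjugation.characterElement π.rep (divAction E (a' : D))
    have hxπ : π.rep.asAlgebraHom x = divAction E (a' : D) := by
      rw [map_smul, C.asAlgebraHom_characterElement_self E a'.2, smul_smul, Module.finrank_fin_fun]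
      have := C.d_ne_zero
      rw [show (π.dim : ℝ) / (C.d * Fintype.card G) * (C.d * Fintype.card G / π.dim) = 1 by
        field_simp, one_smul]
    have hxσ (σ : Irr G) (h : σ ≠ π) : σ.rep.asAlgebraHom x = 0 := by
      rw [map_smul]
      refine smul_eq_zero_of_right _ (LinearMap.ext fun v => ?_)
      rw [Conjugation.asAlgebraHom_characterElement_apply]
      refine Finset.sum_eq_zero fun i _ => ?_
      rw [Irr.eq_zero_of_ne h.symm (groupSum π.rep σ.rep _) (groupSum_comp _ _ _)]
      rfl
    -- Centrality is tested on irreducible representations: on `π` the element acts by an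
    -- intertwiner, on the others by zero.
    have hx : x ∈ ZGroupAlgebra G := by
      rw [Subalgebra.mem_center_iff]
      intro y
      rw [← sub_eq_zero]
      refine eq_zero_of_forall_irr _ fun σ => ?_
      rw [map_sub, map_mul, map_mul, sub_eq_zero]
      by_cases h : σ = π
      · subst h
        rw [hxπ, commute_asAlgebraHom (divAction_mem E _)]
      · rw [hxσ σ h, mul_zero, zero_mul]
    have hμx : ((μ : ZGroupAlgebra G) : MonoidAlgebra ℝ G) ^ 2 * x = c π ^ 2 • x := by
      rw [← sub_eq_zero]
      refine eq_zero_of_forall_irr _ fun σ => ?_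
      rw [map_sub, map_mul, map_pow, map_smul σ.rep.asAlgebraHom (c π ^ 2) x, hc, sub_eq_zero]
      by_cases h : σ = π
      · subst h
        rw [← Module.End.one_eq_id, smul_pow, one_pow, smul_one_mul]
      · rw [hxσ σ h, mul_zero, smul_zero]
    refine ⟨⟨x, hx⟩, Subtype.ext (divAction_injective E ?_), hxσ, ?_⟩
    · exact (divAction_centerHom E _).trans hxπ
    · change (((μ : ZGroupAlgebra G) : MonoidAlgebra ℝ G) ^ 2 * x).coeff 1 / (Fintype.card G : ℝ) =
        (c π * π.dim / Fintype.card G) ^ 2 / (Module.finrank ℝ D : ℝ) * re (a' : D)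
      rw [hμx, MonoidAlgebra.coeff_smul, Finsupp.smul_apply, MonoidAlgebra.coeff_smul,
        Finsupp.smul_apply, Conjugation.characterElement_coeff_one,
        C.trace_divAction E (β π) (hβ π), Module.finrank_fin_fun, C.finrank_eq, smul_eq_mul,
        smul_eq_mul]
      have := C.d_ne_zero
      field_simp
  · change Matrix (Fin (n π)) (Fin (n π)) D at b'
    -- The operator with block matrix `b'` on the `π`-part and zero elsewhere.
    let y : Module.End ℝ V := ∑ i, ∑ j, P.incl π i ∘ₗ divAction E (b' i j) ∘ₗ P.proj π j
    have hy : y ∈ EndG ρ := by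
      refine sum_mem fun i _ => sum_mem fun j _ => ?_
      rw [Subalgebra.mem_centralizer_iff]
      rintro _ ⟨g, rfl⟩
      have h1 := divAction_comm E (b' i j) g
      calc ρ g * (P.incl π i ∘ₗ divAction E (b' i j) ∘ₗ P.proj π j) =
          (ρ g ∘ₗ P.incl π i) ∘ₗ divAction E (b' i j) ∘ₗ P.proj π j := rfl
        _ = P.incl π i ∘ₗ (π.rep g * divAction E (b' i j)) ∘ₗ P.proj π j := by
          rw [P.incl_comm]; rfl
        _ = P.incl π i ∘ₗ divAction E (b' i j) ∘ₗ (π.rep g ∘ₗ P.proj π j) := by rw [h1]; rfl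
        _ = _ := by rw [← P.proj_comm]; rfl
    have hblock (σ : Irr G) (i j : Fin (n σ)) : P.proj σ i ∘ₗ y ∘ₗ P.incl σ j =
        ∑ k, ∑ l, (P.proj σ i ∘ₗ P.incl π k) ∘ₗ divAction E (b' k l) ∘ₗ
          (P.proj π l ∘ₗ P.incl σ j) := by
      refine LinearMap.ext fun v => ?_
      simp [y, LinearMap.sum_apply]
    refine ⟨⟨y, hy⟩, Matrix.ext fun i j => divAction_injective E ?_, fun σ h i j => ?_, ?_⟩
    · refine (P.divAction_blockHom π E ⟨y, hy⟩ i j).trans ?_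
      rw [hblock, Finset.sum_eq_single i, Finset.sum_eq_single j]
      · rw [P.proj_incl, P.proj_incl]
        rfl
      · intro l _ hl
        rw [P.proj_incl_ne π l j hl, LinearMap.comp_zero, LinearMap.comp_zero]
      · simp
      · intro k _ hk
        exact Finset.sum_eq_zero fun l _ => by
          rw [P.proj_incl_ne π i k hk.symm, LinearMap.zero_comp]
      · simp
    · rw [hblock]
      refine Finset.sum_eq_zero fun k _ => Finset.sum_eq_zero fun l _ => ?_
      rw [P.proj_incl_of_ne h, LinearMap.zero_comp]
    · change (Fintype.card G : ℝ)⁻¹ * LinearMap.trace ℝ V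
        (ρ.asAlgebraHom ((μ : ZGroupAlgebra G) : MonoidAlgebra ℝ G) * y) =
        c π * π.dim / Fintype.card G * re (Matrix.trace b')
      have h1 : ρ.asAlgebraHom ((μ : ZGroupAlgebra G) : MonoidAlgebra ℝ G) * y = c π • y := by
        rw [Finset.mul_sum, Finset.smul_sum]
        refine Finset.sum_congr rfl fun i _ => ?_
        rw [Finset.mul_sum, Finset.smul_sum]
        refine Finset.sum_congr rfl fun j _ => ?_
        rw [Module.End.mul_eq_comp, ← LinearMap.comp_assoc, P.asAlgebraHom_incl, hc,
          LinearMap.comp_smul, LinearMap.smul_comp, LinearMap.comp_id]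
      have h2 (i j : Fin (n π)) : LinearMap.trace ℝ V
          (P.incl π i ∘ₗ divAction E (b' i j) ∘ₗ P.proj π j) =
          if i = j then π.dim * re (b' i j) else 0 := by
        rw [LinearMap.trace_comp_comm', LinearMap.comp_assoc]
        split_ifs with h
        · subst h
          rw [P.proj_incl, LinearMap.comp_id, C.trace_divAction E (β π) (hβ π),
            Module.finrank_fin_fun]
        · rw [P.proj_incl_ne π j i (Ne.symm h), LinearMap.comp_zero, map_zero]
      have h3 : LinearMap.trace ℝ V y = π.dim * re (Matrix.trace b') := by
        simp only [y, map_sum, h2, Matrix.trace, Matrix.diag_apply, Finset.mul_sum]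
        simp
      rw [h1, map_smul, h3, smul_eq_mul]
      ring

end Component

/-! ### Square roots after extension of scalars to `ℂ` -/

section SquareRoot

/-- Over an algebraically closed field every separable polynomial divides some `p² - X`. -/
theorem exists_dvd_sq_sub_X {k : Type u} [Field k] [IsAlgClosed k] {q : Polynomial k}
    (hq : q.Separable) : ∃ p : Polynomial k, q ∣ p ^ 2 - Polynomial.X := by
  classical
  choose r hr using fun z : k => IsAlgClosed.exists_pow_nat_eq z (n := 2) two_pos
  -- `p` interpolates chosen square roots at the roots of `q`. Those roots are simple by
  -- separability, so divisibility only requires that `p² - X` vanish at each of them.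
  refine ⟨Lagrange.interpolate q.roots.toFinset id r, ?_⟩
  by_cases h0 : Lagrange.interpolate q.roots.toFinset id r ^ 2 - Polynomial.X = 0
  · rw [h0]
    exact dvd_zero _
  rw [IsAlgClosed.dvd_iff_roots_le_roots hq.ne_zero h0,
    Multiset.le_iff_subset (Polynomial.nodup_roots hq)]
  intro z hz
  have h := Lagrange.eval_interpolate_at_node (s := q.roots.toFinset) (v := id) r
    Function.injective_id.injOn (Multiset.mem_toFinset.2 hz)
  rw [id_eq] at h
  rw [Polynomial.mem_roots h0, Polynomial.IsRoot, Polynomial.eval_sub, Polynomial.eval_pow,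
    Polynomial.eval_X, h, hr, sub_self]

/-- A symmetric element `S` with squarefree minimal polynomial has, after extension of scalars to
`ℂ`, a square root that is fixed by every anti-automorphism fixing `S`. -/
theorem exists_sqrt {R : Type v} [Ring R] [Algebra ℝ R] (S : Rˣ) {q : Polynomial ℝ}
    (hq : Squarefree q) (hS : Polynomial.aeval (S : R) q = 0) :
    ∃ T : (ℂ ⊗[ℝ] R)ˣ, (T * T : ℂ ⊗[ℝ] R) = 1 ⊗ₜ[ℝ] (S : R) ∧
      ∀ s : (ℂ ⊗[ℝ] R) →ₗ[ℂ] ℂ ⊗[ℝ] R, s 1 = 1 → (∀ x y, s (x * y) = s y * s x) →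
        s (1 ⊗ₜ[ℝ] (S : R)) = 1 ⊗ₜ[ℝ] (S : R) → s T = T := by
  obtain ⟨p, r, hp⟩ := exists_dvd_sq_sub_X
    ((PerfectField.separable_iff_squarefree.2 hq).map (f := algebraMap ℝ ℂ))
  set X : ℂ ⊗[ℝ] R := 1 ⊗ₜ[ℝ] (S : R) with hX
  have hX0 : Polynomial.aeval X (q.map (algebraMap ℝ ℂ)) = 0 := by
    rw [Polynomial.aeval_map_algebraMap]
    have := Polynomial.aeval_algHom_apply
      (Algebra.TensorProduct.includeRight : R →ₐ[ℝ] ℂ ⊗[ℝ] R) (S : R) q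
    rw [hS, map_zero] at this
    exact this
  have hT : Polynomial.aeval X p * Polynomial.aeval X p = X := by
    have := congrArg (Polynomial.aeval X) hp
    rw [map_mul, hX0, zero_mul, map_sub, Polynomial.aeval_X, map_pow, sub_eq_zero, pow_two] at this
    exact this
  have hu : IsUnit (Polynomial.aeval X p) := by
    have : IsUnit X :=
      S.isUnit.map (Algebra.TensorProduct.includeRight : R →ₐ[ℝ] ℂ ⊗[ℝ] R)
    rw [← hT, (Commute.refl _).isUnit_mul_iff] at this
    exact this.1
  refine ⟨hu.unit, hT, fun s s_one s_mul hs => ?_⟩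
  rw [IsUnit.unit_spec]
  -- The root is a polynomial in `1 ⊗ S`, so it is fixed as soon as the powers of that element are.
  have hpow (m : ℕ) : s (X ^ m) = X ^ m := by
    induction m with
    | zero => simpa using s_one
    | succ m ih => rw [pow_succ, s_mul, hs, ih, ← pow_succ', pow_succ]
  rw [Polynomial.aeval_eq_sum_range, map_sum]
  exact Finset.sum_congr rfl fun m _ => by rw [map_smul, hpow]

end SquareRoot

/-! ### Comparison of two invariant forms -/

section Form

variable {G : Type u} [Group G] {V : Type v} [AddCommGroup V] [Module ℝ V] [FiniteDimensional ℝ V]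
  {ρ : Representation ℝ G V}

namespace InvariantForm

/-- The adjoints with respect to two invariant forms differ by a symmetric twist. -/
theorem exists_transition (β₀ β : InvariantForm ρ) :
    ∃ S : (EndG ρ)ˣ, β₀.adjointG (S : EndG ρ) = S ∧
      ∀ b, β.adjointG b = ↑S⁻¹ * β₀.adjointG b * S := by
  -- `S` is the operator with `β₀(S v, w) = β(v, w)`.
  let e : V ≃ₗ[ℝ] V := β.form.toDual β.nondegenerate ≪≫ₗ (β₀.form.toDual β₀.nondegenerate).symm
  have he (v w : V) : β₀.form (e v) w = β.form v w := by
    simp [e, LinearMap.BilinForm.toDual_def]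
  have hinv (γ : InvariantForm ρ) (g : G) (v w : V) : γ.form (ρ g v) w = γ.form v (ρ g⁻¹ w) := by
    rw [← γ.invariant g⁻¹ (ρ g v) w]
    simp
  have hcomm (g : G) (v : V) : e (ρ g v) = ρ g (e v) :=
    β₀.eq_of_form_eq fun w => by rw [he, hinv β, hinv β₀, he]
  have hmem : e.toLinearMap ∈ EndG ρ := by
    rw [Subalgebra.mem_centralizer_iff]
    rintro _ ⟨g, rfl⟩
    exact LinearMap.ext fun v => (hcomm g v).symm
  have hmem' : e.symm.toLinearMap ∈ EndG ρ := by
    rw [Subalgebra.mem_centralizer_iff]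
    rintro _ ⟨g, rfl⟩
    refine LinearMap.ext fun v => ?_
    change ρ g (e.symm v) = e.symm (ρ g v)
    rw [LinearEquiv.eq_symm_apply, hcomm, LinearEquiv.apply_symm_apply]
  refine ⟨⟨⟨_, hmem⟩, ⟨_, hmem'⟩, Subtype.ext (LinearMap.ext e.apply_symm_apply),
    Subtype.ext (LinearMap.ext e.symm_apply_apply)⟩, Subtype.ext ?_, fun b => ?_⟩
  · refine (β₀.eq_adjoint fun v w => ?_).symm
    change β₀.form (e v) w = β₀.form v (e w)
    rw [he, β.form_comm, ← he, β₀.form_comm]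
  · refine Subtype.ext (LinearMap.ext fun v => ?_)
    change β.adjoint (b : Module.End ℝ V) v = e.symm (β₀.adjoint (b : Module.End ℝ V) (e v))
    rw [LinearEquiv.eq_symm_apply]
    exact β₀.eq_of_form_eq fun w => by rw [he, β.form_adjoint, β₀.form_adjoint, he]

/-- A self-adjoint `N` with `N² = 0` satisfies `β₀(N v, N v) = β₀(v, N² v) = 0`, so it vanishes by
definiteness. If the minimal polynomial is `a² b`, this applies to `N = (a b)(S)`, and minimality
makes `a` a unit. -/
theorem squarefree_minpoly (β₀ : InvariantForm ρ) (hβ₀ : ∀ x, x ≠ 0 → 0 < β₀.form x x)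
    (S : EndG ρ) (hS : β₀.adjointG S = S) : Squarefree (minpoly ℝ S) := by
  have hint : IsIntegral ℝ S := Algebra.IsIntegral.isIntegral S
  have hpow (m : ℕ) : β₀.adjointG (S ^ m) = S ^ m := by
    induction m with
    | zero => exact Subtype.ext β₀.adjoint_one
    | succ m ih =>
      have : β₀.adjointG (S ^ m * S) = β₀.adjointG S * β₀.adjointG (S ^ m) :=
        Subtype.ext (β₀.adjoint_mul _ _)
      rw [pow_succ, this, hS, ih, ← pow_succ', pow_succ]
  have hpoly (p : Polynomial ℝ) :
      β₀.adjointG (Polynomial.aeval S p) = Polynomial.aeval S p := by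
    rw [Polynomial.aeval_eq_sum_range, map_sum]
    exact Finset.sum_congr rfl fun m _ => by rw [map_smul, hpow]
  rintro a ⟨b, hab⟩
  have hne := minpoly.ne_zero hint
  set N := Polynomial.aeval S (a * b) with hN
  have h0 : N * N = 0 := by
    rw [hN, ← map_mul, show a * b * (a * b) = a * a * b * b by ring, ← hab, map_mul,
      minpoly.aeval, zero_mul]
  have hN0 : N = 0 := by
    refine Subtype.ext (LinearMap.ext fun v => ?_)
    by_contra h
    refine (hβ₀ _ h).ne' ?_
    have h1 : β₀.adjoint (N : Module.End ℝ V) = N := congrArg Subtype.val (hpoly (a * b))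
    have h2 : (N : Module.End ℝ V) ((N : Module.End ℝ V) v) = 0 :=
      LinearMap.congr_fun (congrArg Subtype.val h0) v
    conv_lhs => rw [← h1]
    rw [β₀.form_adjoint, h1, h2, map_zero]
  have hdvd := minpoly.dvd ℝ S hN0
  rw [hab] at hdvd hne
  have hab0 : a * b ≠ 0 := fun h => hne (by rw [mul_assoc, h, mul_zero])
  rw [mul_assoc] at hdvd
  exact isUnit_of_dvd_one ((mul_dvd_mul_iff_right hab0).1 (by rwa [one_mul]))

end InvariantForm

end Form

/-! ### Assembly of the isomorphisms -/

section Main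

variable {G : Type u} [Group G] [Fintype G] {V : Type v} [AddCommGroup V] [Module ℝ V]
  [FiniteDimensional ℝ V] {ρ : Representation ℝ G V}

/-- The antipode acts as the adjoint, so an antipode-invariant central element acts by a
self-adjoint intertwiner, hence by a real scalar; invertibility makes it nonzero. -/
theorem exists_scalar (μ : (ZGroupAlgebra G)ˣ)
    (hμ : antipodeCenter G (μ : ZGroupAlgebra G) = μ) (π : Irr G) :
    ∃ c : ℝ, c ≠ 0 ∧
      π.rep.asAlgebraHom ((μ : ZGroupAlgebra G) : MonoidAlgebra ℝ G) = c • LinearMap.id := by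
  have := π.nontrivial
  obtain ⟨β, hβ⟩ := exists_posDef_invariantForm π.rep
  obtain ⟨c, hc⟩ := exists_algebraMap_of_adjoint_eq π.out.irr β hβ
    (π.rep.asAlgebraHom ((μ : ZGroupAlgebra G) : MonoidAlgebra ℝ G)) (asAlgebraHom_mem π.rep μ)
    ((β.adjoint_asAlgebraHom _).trans (congrArg π.rep.asAlgebraHom (congrArg Subtype.val hμ)))
  refine ⟨c, ?_, hc⟩
  rintro rfl
  have h : IsUnit (π.rep.asAlgebraHom ((μ : ZGroupAlgebra G) : MonoidAlgebra ℝ G)) :=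
    μ.isUnit.map (π.rep.asAlgebraHom.comp (ZGroupAlgebra G).val)
  rw [hc, map_zero] at h
  exact not_isUnit_zero h

/-- For the orthogonal sum of definite forms no extension of scalars is needed. -/
theorem Blocks.nonempty_iso [Fintype (Irr G)] {n : Irr G → ℕ} (P : Blocks ρ n)
    (β : ∀ π : Irr G, InvariantForm π.rep)
    (hβ : ∀ π x, x ≠ 0 → 0 < (β π).form x x) (μ : (ZGroupAlgebra G)ˣ) {c : Irr G → ℝ}
    (hc0 : ∀ π, c π ≠ 0)
    (hc : ∀ π : Irr G, π.rep.asAlgebraHom ((μ : ZGroupAlgebra G) : MonoidAlgebra ℝ G) =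
      c π • LinearMap.id) :
    Nonempty (EquippedData.Iso (repData ρ (P.invariantForm β hβ) μ)
      (EquippedData.directSum fun p : TypedIrr G =>
        stdData p.1 (n p.2) (c p.2 * p.2.1.dim / Fintype.card G))) := by
  classical
  have key (p : TypedIrr G) : ∃ f : EquippedData.Component (repData ρ (P.invariantForm β hβ) μ)
      (stdData p.1 (n p.2) (c p.2 * p.2.1.dim / Fintype.card G)),
      (∀ a : ZGroupAlgebra G, f.fA a = 0 ↔
        p.2.1.rep.asAlgebraHom (a : MonoidAlgebra ℝ G) = 0) ∧
      (∀ b : EndG ρ, f.fB b = 0 ↔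
        ∀ i j, P.proj p.2 i ∘ₗ (b : Module.End ℝ V) ∘ₗ P.incl p.2 j = 0) ∧
      (∀ a', ∃ a : ZGroupAlgebra G, f.fA a = a' ∧
        (∀ σ : Irr G, σ ≠ p.2.1 → σ.rep.asAlgebraHom (a : MonoidAlgebra ℝ G) = 0) ∧
        (repData ρ (P.invariantForm β hβ) μ).lA a =
          (stdData p.1 (n p.2) (c p.2 * p.2.1.dim / Fintype.card G)).lA a') ∧
      (∀ b', ∃ b : EndG ρ, f.fB b = b' ∧
        (∀ σ : Irr G, σ ≠ p.2.1 → ∀ i j,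
          P.proj σ i ∘ₗ (b : Module.End ℝ V) ∘ₗ P.incl σ j = 0) ∧
        (repData ρ (P.invariantForm β hβ) μ).lB b =
          (stdData p.1 (n p.2) (c p.2 * p.2.1.dim / Fintype.card G)).lB b') :=
    match p with
    | ⟨.real, π, ⟨E⟩⟩ => P.exists_component β hβ μ hc0 hc π Conjugation.real E
    | ⟨.complex, π, ⟨E⟩⟩ => P.exists_component β hβ μ hc0 hc π Conjugation.complex E
    | ⟨.quaternion, π, ⟨E⟩⟩ => P.exists_component β hβ μ hc0 hc π Conjugation.quaternion E
  choose f hA hB liftA liftB using key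
  refine EquippedData.nonempty_iso_directSum f (fun a ha => ?_) (fun b hb => ?_)
    (fun p a' => ?_) (fun p b' => ?_)
  · refine Subtype.ext (eq_zero_of_forall_irr _ fun π => ?_)
    obtain ⟨D, hD⟩ := π.exists_hasType
    exact (hA ⟨D, π, hD⟩ a).1 (ha _)
  · refine Subtype.ext (P.eq_zero_of_block_eq_zero b.2 fun π => ?_)
    obtain ⟨D, hD⟩ := π.exists_hasType
    exact (hB ⟨D, π, hD⟩ b).1 (hb _)
  · obtain ⟨a, h1, h2, h3⟩ := liftA p a'
    exact ⟨a, h1, fun q hq => (hA q a).2 (h2 _ fun h => hq (TypedIrr.ext_irr h)), h3⟩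
  · obtain ⟨b, h1, h2, h3⟩ := liftB p b'
    exact ⟨b, h1, fun q hq => (hB q b).2 (h2 _ fun h => hq (TypedIrr.ext_irr h)), h3⟩

/-- The two data differ only by the twist of `⋆` by `S`; over `ℂ` conjugation by a symmetric square
root of `S` removes it. -/
theorem nonempty_iso_baseChange_repData (β₀ β : InvariantForm ρ)
    (hβ₀ : ∀ x, x ≠ 0 → 0 < β₀.form x x) (μ : (ZGroupAlgebra G)ˣ)
    (C : EquippedData.Certificate.{0, u, v, w} (repData ρ β₀ μ)) :
    Nonempty (EquippedData.Iso ((repData ρ β μ).baseChange ℂ) ((repData ρ β₀ μ).baseChange ℂ)) := by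
  obtain ⟨S, hS, hs⟩ := β₀.exists_transition β
  obtain ⟨T, hT, hTs⟩ := exists_sqrt S (β₀.squarefree_minpoly hβ₀ S hS) (minpoly.aeval ℝ _)
  let C' : EquippedData.Certificate ((repData ρ β₀ μ).baseChange ℂ) := C.baseChange ℂ
  have s_one : β₀.adjointG.baseChange ℂ (1 : ℂ ⊗[ℝ] EndG ρ) = 1 := by
    have h : β₀.adjointG (1 : EndG ρ) = 1 := Subtype.ext β₀.adjoint_one
    rw [Algebra.TensorProduct.one_def, LinearMap.baseChange_tmul, h]
  have hS' : β₀.adjointG.baseChange ℂ ((1 : ℂ) ⊗ₜ[ℝ] (S : EndG ρ)) = 1 ⊗ₜ[ℝ] (S : EndG ρ) := by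
    rw [LinearMap.baseChange_tmul, hS]
  refine ⟨EquippedData.isoTwist C' T (hTs _ s_one C'.starB_mul hS') (β.adjointG.baseChange ℂ)
    fun b => ?_⟩
  · change (T * T : ℂ ⊗[ℝ] EndG ρ) * β.adjointG.baseChange ℂ b =
      β₀.adjointG.baseChange ℂ b * (T * T : ℂ ⊗[ℝ] EndG ρ)
    change ℂ ⊗[ℝ] EndG ρ at b
    rw [hT]
    induction b using TensorProduct.induction_on with
    | zero => simp
    | add b b' hb hb' => simp only [map_add, mul_add, add_mul, hb, hb']
    | tmul z b =>
      rw [LinearMap.baseChange_tmul, LinearMap.baseChange_tmul,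
        Algebra.TensorProduct.tmul_mul_tmul, Algebra.TensorProduct.tmul_mul_tmul, one_mul, mul_one,
        hs, mul_assoc, Units.mul_inv_cancel_left]

end Main

end CardyFrobenius

theorem mainTheorem4 {G : Type u} [Group G] [Fintype G]
    {V : Type v} [AddCommGroup V] [Module ℝ V] [FiniteDimensional ℝ V]
    (ρ : Representation ℝ G V) (β : CardyFrobenius.InvariantForm ρ)
    (μ : (CardyFrobenius.ZGroupAlgebra G)ˣ)
    (hμ : CardyFrobenius.antipodeCenter G (μ : CardyFrobenius.ZGroupAlgebra G) = μ) :
    (CardyFrobenius.repData ρ β μ).IsEquipped ∧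
    (CardyFrobenius.repData ρ β μ).IsSemisimple ∧
    ((CardyFrobenius.repData ρ β μ).baseChange ℂ).IsEquipped ∧
    ((CardyFrobenius.repData ρ β μ).baseChange ℂ).IsSemisimple ∧
    ∃ (n : CardyFrobenius.Irr G → ℕ) (c : CardyFrobenius.Irr G → ℝ),
      Nonempty (ρ.Equiv (CardyFrobenius.sumRep n)) ∧
      (∀ π : CardyFrobenius.Irr G,
        π.rep.asAlgebraHom ((μ : CardyFrobenius.ZGroupAlgebra G) : MonoidAlgebra ℝ G) =
          c π • LinearMap.id) ∧
      (∀ π : CardyFrobenius.Irr G, c π ≠ 0) ∧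
      Nonempty (CardyFrobenius.EquippedData.Iso
        ((CardyFrobenius.repData ρ β μ).baseChange ℂ)
        (CardyFrobenius.EquippedData.directSum fun p : CardyFrobenius.TypedIrr G =>
          (CardyFrobenius.stdData p.1 (n p.2) (c p.2 * p.2.1.dim / Fintype.card G)).baseChange ℂ)) := by
  classical
  have := Fintype.ofFinite (CardyFrobenius.Irr G)
  choose c hc0 hc using CardyFrobenius.exists_scalar μ hμ
  choose γ hγ using fun π : CardyFrobenius.Irr G =>
    CardyFrobenius.exists_posDef_invariantForm π.rep
  obtain ⟨n, ⟨e⟩⟩ := CardyFrobenius.exists_equiv_sumRep ρ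
  obtain ⟨P⟩ := CardyFrobenius.nonempty_blocks e
  obtain ⟨I⟩ := P.nonempty_iso γ hγ μ hc0 hc
  have hpos : ∀ x, x ≠ 0 → 0 < (P.invariantForm γ hγ).form x x := P.blockForm_pos γ hγ
  set β₀ := P.invariantForm γ hγ
  have hparam (p : CardyFrobenius.TypedIrr G) : c p.2 * p.2.1.dim / Fintype.card G ≠ 0 := by
    have := p.2.1.nontrivial
    have hm : (p.2.1.dim : ℝ) ≠ 0 := by
      simpa using CardyFrobenius.Conjugation.finrank_ne_zero (W := Fin p.2.1.dim → ℝ)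
    exact div_ne_zero (mul_ne_zero (hc0 _) hm) (by exact_mod_cast Fintype.card_ne_zero)
  let C₁ : CardyFrobenius.EquippedData.Certificate
      (CardyFrobenius.EquippedData.directSum fun p : CardyFrobenius.TypedIrr G =>
        CardyFrobenius.stdData p.1 (n p.2) (c p.2 * p.2.1.dim / Fintype.card G)) :=
    CardyFrobenius.EquippedData.CasimirLaws.pi fun p =>
      CardyFrobenius.stdCertificate p.1 (n p.2) (hparam p)
  let C₀ : CardyFrobenius.EquippedData.Certificate (CardyFrobenius.repData ρ β₀ μ) := C₁.map I.symm
  obtain ⟨S, hS, hs⟩ := β₀.exists_transition β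
  -- Only `⋆` on `B` depends on the form, so the twisted laws for `β₀` are literally the laws for
  -- `β`.
  let C : CardyFrobenius.EquippedData.Certificate (CardyFrobenius.repData ρ β μ) :=
    C₀.twist S hS β.adjointG hs
  let C' : CardyFrobenius.EquippedData.Certificate ((CardyFrobenius.repData ρ β μ).baseChange ℂ) :=
    C.baseChange ℂ
  -- Semisimplicity ignores `⋆`, so the isomorphism available for `β₀` also settles it for `β`.
  have hss : (CardyFrobenius.repData ρ β μ).IsSemisimple :=
    I.symm.isSemisimple (CardyFrobenius.EquippedData.isSemisimple_directSum fun p =>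
      CardyFrobenius.isSemisimple_stdData _ _ _)
  obtain ⟨J⟩ := CardyFrobenius.nonempty_iso_baseChange_repData β₀ β hpos μ C₀
  have : Module.Finite ℝ (CardyFrobenius.repData ρ β μ).A :=
    inferInstanceAs (Module.Finite ℝ (CardyFrobenius.ZGroupAlgebra G))
  have : Module.Finite ℝ (CardyFrobenius.repData ρ β μ).B :=
    inferInstanceAs (Module.Finite ℝ (CardyFrobenius.EndG ρ))
  exact ⟨C.isEquipped, hss, C'.isEquipped, hss.baseChange ℂ, n, c, ⟨e⟩, hc, hc0,
    ⟨(J.trans (I.baseChange ℂ)).trans (CardyFrobenius.EquippedData.baseChangeDirectSum ℂ _)⟩⟩
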